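/- Let $\mathcal P$ be a simplicial tiling of $\mathbb R^d$ of finite local complexity: a covering of $\mathbb R^d$ by non-degenerate $d$-simplices (tiles) which meet face to face and of which there are only finitely many up to translation. The vertices of each tile are ordered so that translationally congruent tiles carry the same order and two tiles induce the same order on their common vertices; hence every face of $\mathcal P$ is an ordered, oriented simplex, with $i$-th face $\partial_i\sigma$ obtained by omitting the $i$-th vertex. Every face $\sigma$ has a puncture $p_\sigma\in\sigma$ such that translationally congruent faces have their punctures at the same relative position and distinct faces of the same dimension have distinct punctures (e.g. barycentres). Write $B_r[\mathcal P_1]=B_r[\mathcal P_2]$ if the sets of boundary points of the tiles of $\mathcal P_1$ and $\mathcal P_2$ coincide on the $r$-ball around $0$, and let $$D(\mathcal P_1,\mathcal P_2)=\inf\{\tfrac1{r+1}: r>0,\ \exists\, x,y\in B_{1/r}(0),\ B_r[\mathcal P_1-x]=B_r[\mathcal P_2-y]\}.$$ Let $\Omega_{\mathcal P}$ be the hull, the set of (face-to-face simplicial) tilings which are $D$-limits of translates of $\mathcal P$; each tile of a tiling of $\Omega_{\mathcal P}$ is a translate of a tile of $\mathcal P$ and inherits its vertex order and punctures. For $n\ge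 0$ let $\Xi^n$ be the set of all $\xi\in\Omega_{\mathcal P}$ which have the puncture of an $n$-dimensional face at $0$, with the topology given by $D$; this face is then unique, and is denoted $\sigma_\xi$. For $f:\Xi^n\to\mathbb R$ and $\xi\in\Xi^{n+1}$ let $$(d_{PV}f)(\xi)=\sum_{i=0}^{n+1}(-1)^i f(\xi-p_{\partial_i\sigma_\xi}).$$ The weak PV cohomology $H^*_{PV}(\Gamma_0,\mathcal C(\Xi,\mathbb R))$ is the cohomology of the complex of continuous functions $(\mathcal C(\Xi^*,\mathbb R),d_{PV})$, and the strong PV cohomology $H^*_{PV}(\Gamma_0,\mathcal C_{lc}(\Xi,\mathbb R))$ is the cohomology of the complex of locally constant functions $(\mathcal C_{lc}(\Xi^*,\mathbb R),d_{PV})$. A smooth $n$-form $\omega$ on $\mathbb R^d$, regarded as a function with values in $\Lambda^n(\mathbb R^d)^*$, is strongly pattern equivariant if there is $R>0$ such that $B_R[\mathcal P-x]=B_R[\mathcal P-y]$ implies $\omega(x)=\omega(y)$. It is weakly pattern equivariant if it lies in the closure of the strongly pattern equivariant smooth $n$-forms with respect to uniform convergence of all derivatives. Let $\mathcal A^n_{s-\mathcal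 P}(\mathbb R^d)\subset\mathcal A^n_{w-\mathcal P}(\mathbb R^d)$ be the spaces of these forms, and let $H^*_{s-\mathcal P}(\mathbb R^d)$ and $H^*_{w-\mathcal P}(\mathbb R^d)$ be the cohomologies of the corresponding complexes with the exterior derivative. Then for every $n$ and every $\omega\in\mathcal A^n_{w-\mathcal P}(\mathbb R^d)$ there is a unique continuous function $\psi(\omega)\in\mathcal C(\Xi^n,\mathbb R)$ such that $$\psi(\omega)(\mathcal P-p_\sigma)=\int_{\sigma}\omega\qquad\text{for every $n$-dimensional face }\sigma\text{ of }\mathcal P .$$ The resulting linear map $\psi$ satisfies $\psi\circ d=d_{PV}\circ\psi$, and it maps $\mathcal A^n_{s-\mathcal P}(\mathbb R^d)$ into $\mathcal C_{lc}(\Xi^n,\mathbb R)$. In every degree $n$, $[\omega]\mapsto[\psi(\omega)]$ defines an isomorphism of real vector spaces $$H^n_{w-\mathcal P}(\mathbb R^d)\;\cong\;H^n_{PV}(\Gamma_0,\mathcal C(\Xi,\mathbb R)),$$ and the restriction of $\psi$ to strongly pattern equivariant forms induces in the same way an isomorphism $$H^n_{s-\mathcal P}(\mathbb R^d)\;\cong\;H^n_{PV}(\Gamma_0,\mathcal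 C_{lc}(\Xi,\mathbb R)).$$ -/

import Mathlib

open scoped ENNReal

noncomputable section

namespace PVTiling

/-- The Euclidean space `ℝ^d`. -/
abbrev Space (d : ℕ) : Type := EuclideanSpace ℝ (Fin d)

/-- The translate `t + x` of a simplex, which is given by its finite vertex set. -/
def shift {d : ℕ} (t : Finset (Space d)) (x : Space d) : Finset (Space d) :=
  t.map (addRightEmbedding x)

/-- The translated tiling `τ^x(K) = K - x`. A collection of simplices is the set of the vertex sets
of its members. -/
def translate {d : ℕ} (K : Set (Finset (Space d))) (x : Space d) : Set (Finset (Space d)) :=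
  {t | shift t x ∈ K}

/-- The tiles are nondegenerate `d`-simplices which cover `ℝ^d` and which meet face to face: the
intersection of two tiles is the (possibly empty) simplex spanned by their common vertices. -/
structure IsFaceToFaceTiling {d : ℕ} (K : Set (Finset (Space d))) : Prop where
  card_eq : ∀ t ∈ K, t.card = d + 1
  affineIndependent : ∀ t ∈ K, AffineIndependent ℝ (fun v : t => (v : Space d))
  cover : ⋃ t ∈ K, convexHull ℝ (t : Set (Space d)) = Set.univ
  face_to_face : ∀ s ∈ K, ∀ t ∈ K,
    convexHull ℝ (s : Set (Space d)) ∩ convexHull ℝ (t : Set (Space d)) =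
      convexHull ℝ ((s : Set (Space d)) ∩ (t : Set (Space d)))

/-- The set of boundary points of the tiles. -/
def boundaryPoints {d : ℕ} (K : Set (Finset (Space d))) : Set (Space d) :=
  ⋃ t ∈ K, frontier (convexHull ℝ (t : Set (Space d)))

/-- `B_r[K] = B_r[L]`: the tilings coincide on the `r`-ball around the origin. -/
def Agree {d : ℕ} (r : ℝ) (K L : Set (Finset (Space d))) : Prop :=
  boundaryPoints K ∩ Metric.ball 0 r = boundaryPoints L ∩ Metric.ball 0 r

/-- The distance `D(K, L) = inf {1/(r+1) | r > 0, ∃ x y ∈ B_{1/r}(0), B_r[K - x] = B_r[L - y]}`. -/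
def tilingDist {d : ℕ} (K L : Set (Finset (Space d))) : ℝ≥0∞ :=
  ⨅ (r : ℝ) (_ : 0 < r ∧ ∃ x ∈ Metric.ball (0 : Space d) (1 / r),
    ∃ y ∈ Metric.ball (0 : Space d) (1 / r), Agree r (translate K x) (translate L y)),
    ENNReal.ofReal (1 / (r + 1))

/-- A punctured simplicial tiling of finite local complexity of `ℝ^d`. -/
structure SimplicialTiling (d : ℕ) where
  /-- The tiles, given by their vertex sets. -/
  tiles : Set (Finset (Space d))
  isTiling : IsFaceToFaceTiling tiles
  /-- There are only finitely many tiles up to translation. -/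
  finite_prototiles : ∃ F : Set (Finset (Space d)), F.Finite ∧
    ∀ t ∈ tiles, ∃ s ∈ F, ∃ x, t = shift s x
  /-- The characteristic map of a tile `t` is the affine map which sends the `i`-th vertex of the
  standard simplex to `vert t i`. Only the values on tiles are used. -/
  vert : Finset (Space d) → Fin (d + 1) → Space d
  range_vert : ∀ t ∈ tiles, Set.range (vert t) = (t : Set (Space d))
  /-- Characteristic maps of translationally congruent tiles differ by the translation. -/
  vert_shift : ∀ t ∈ tiles, ∀ x, shift t x ∈ tiles → ∀ i, vert (shift t x) i = vert t i + x
  /-- Two tiles induce the same order on their common vertices. -/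
  vert_compat : ∀ s ∈ tiles, ∀ t ∈ tiles, ∀ i j k l,
    vert s i = vert t k → vert s j = vert t l → (i < j ↔ k < l)
  /-- The puncture of a face, as a function of the vertex set of the face. Only the values on faces
  of tiles are used. -/
  punc : Set (Space d) → Space d
  punc_mem : ∀ t ∈ tiles, ∀ s ⊆ (t : Set (Space d)), s.Nonempty → punc s ∈ convexHull ℝ s
  /-- Punctures of translationally congruent faces are at the same relative position. -/
  punc_shift : ∀ t ∈ tiles, ∀ s ⊆ (t : Set (Space d)), s.Nonempty →
    ∀ t' ∈ tiles, ∀ x, (· + x) '' s ⊆ (t' : Set (Space d)) → punc ((· + x) '' s) = punc s + x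
  /-- Distinct faces of the same dimension have distinct punctures. -/
  punc_inj : ∀ t ∈ tiles, ∀ s ⊆ (t : Set (Space d)), s.Nonempty →
    ∀ t' ∈ tiles, ∀ s' ⊆ (t' : Set (Space d)), s'.Nonempty →
      s.ncard = s'.ncard → punc s = punc s' → s = s'

/-! ### Translations -/

section translations

variable {d : ℕ}

lemma shift_shift (t : Finset (Space d)) (x y : Space d) :
    shift (shift t x) y = shift t (x + y) := by
  ext z
  simp only [shift, Finset.mem_map, addRightEmbedding_apply, exists_exists_and_eq_and, add_assoc]

lemma shift_zero (t : Finset (Space d)) : shift t 0 = t := by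
  ext z
  simp [shift]

lemma translate_translate (K : Set (Finset (Space d))) (x y : Space d) :
    translate (translate K x) y = translate K (x + y) := by
  ext t
  simp [translate, shift_shift, add_comm]

lemma translate_zero (K : Set (Finset (Space d))) : translate K 0 = K := by
  ext t
  simp [translate, shift_zero]

lemma shift_mem_translate {K : Set (Finset (Space d))} {t : Finset (Space d)} {x : Space d}
    (h : shift t x ∈ K) (y : Space d) : shift t (x - y) ∈ translate K y := by
  simpa [translate, shift_shift] using h

lemma coe_shift (t : Finset (Space d)) (x : Space d) :
    (shift t x : Set (Space d)) = (· + x) '' (t : Set (Space d)) := by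
  simp [shift]

lemma convexHull_image_add (s : Set (Space d)) (x : Space d) :
    convexHull ℝ ((· + x) '' s) = (· + x) '' convexHull ℝ s := by
  simpa [add_comm] using
    ((AffineEquiv.constVAdd ℝ (Space d) x).toAffineMap.image_convexHull s).symm

lemma boundaryPoints_translate (K : Set (Finset (Space d))) (x : Space d) :
    boundaryPoints (translate K x) = (· + x) ⁻¹' boundaryPoints K := by
  have key : ∀ t : Finset (Space d), frontier (convexHull ℝ (shift t x : Set (Space d))) =
      (· + x) '' frontier (convexHull ℝ (t : Set (Space d))) := by
    intro t
    rw [coe_shift, convexHull_image_add]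
    exact ((Homeomorph.addRight x).image_frontier _).symm
  ext z
  simp only [boundaryPoints, Set.mem_iUnion, Set.mem_preimage, exists_prop]
  constructor
  · rintro ⟨t, ht, hz⟩
    exact ⟨shift t x, ht, by rw [key]; exact ⟨z, hz, rfl⟩⟩
  · rintro ⟨t, ht, hz⟩
    have e : shift (shift t (-x)) x = t := by rw [shift_shift]; simp [shift_zero]
    refine ⟨shift t (-x), by simpa [translate, e] using ht, ?_⟩
    rw [← e, key] at hz
    obtain ⟨w, hw, hwz⟩ := hz
    have : w = z := by simpa using hwz
    exact this ▸ hw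

lemma IsFaceToFaceTiling.translate {K : Set (Finset (Space d))} (hK : IsFaceToFaceTiling K)
    (x : Space d) : IsFaceToFaceTiling (translate K x) where
  card_eq t ht := by
    have := hK.card_eq _ ht
    simpa [shift] using this
  affineIndependent t ht := by
    have h := hK.affineIndependent _ ht
    let e : t ↪ (shift t x : Finset (Space d)) :=
      ⟨fun v => ⟨v + x, by rw [← Finset.mem_coe, coe_shift]; exact ⟨v, v.2, rfl⟩⟩, fun a b hab =>
        Subtype.ext (add_right_cancel (congrArg Subtype.val hab))⟩
    have h2 := h.comp_embedding e
    have h3 := h2.map' (AffineEquiv.constVAdd ℝ (Space d) (-x)).toAffineMap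
      (AffineEquiv.constVAdd ℝ (Space d) (-x)).injective
    convert h3 using 1
    funext v
    change (v : Space d) = -x + ((v : Space d) + x)
    abel
  cover := by
    rw [Set.eq_univ_iff_forall]
    intro z
    have hz : z + x ∈ ⋃ t ∈ K, convexHull ℝ (t : Set (Space d)) := hK.cover ▸ Set.mem_univ _
    simp only [Set.mem_iUnion, exists_prop] at hz ⊢
    obtain ⟨t, ht, hz⟩ := hz
    have e : shift (shift t (-x)) x = t := by rw [shift_shift]; simp [shift_zero]
    refine ⟨shift t (-x), by simpa [PVTiling.translate, e] using ht, ?_⟩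
    rw [coe_shift, convexHull_image_add]
    exact ⟨z + x, hz, by simp⟩
  face_to_face s hs t ht := by
    have h := hK.face_to_face _ hs _ ht
    have inj : Function.Injective (fun z : Space d => z + x) := add_left_injective x
    rw [coe_shift, coe_shift, ← Set.image_inter inj, convexHull_image_add, convexHull_image_add,
      convexHull_image_add, ← Set.image_inter inj] at h
    exact inj.image_injective h

lemma Agree.translate {r : ℝ} {K L : Set (Finset (Space d))} (h : Agree r K L) (x : Space d) :
    Agree (r - ‖x‖) (translate K x) (translate L x) := by
  unfold Agree at *
  rw [boundaryPoints_translate, boundaryPoints_translate]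
  ext z
  simp only [Set.mem_inter_iff, Set.mem_preimage, mem_ball_zero_iff, and_congr_left_iff]
  intro hz
  have hzx : z + x ∈ Metric.ball (0 : Space d) r := by
    rw [mem_ball_zero_iff]
    linarith [norm_add_le z x]
  have := Set.ext_iff.1 h (z + x)
  simpa [Set.mem_inter_iff, hzx] using this

end translations

namespace SimplicialTiling

variable {d : ℕ} (T : SimplicialTiling d)

/-! ### The hull, its transversals, and their topology -/

/-- The hull: the tilings which are limits, with respect to `tilingDist`, of translates of `T`. -/
def hull : Set (Set (Finset (Space d))) :=
  {K | IsFaceToFaceTiling K ∧ ∀ ε : ℝ≥0∞, 0 < ε → ∃ x, tilingDist K (translate T.tiles x) < ε}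

/-- An `n`-simplex of a tiling `K` of the hull, with its order and its puncture: it is the face of a
tile `tile + offset` of `K`, where `tile` is a tile of `T` from which `tile + offset` inherits the
characteristic map and the punctures, spanned by the vertices with indices in the range of
`emb`. -/
structure Simplex (K : Set (Finset (Space d))) (n : ℕ) where
  tile : Finset (Space d)
  tile_mem : tile ∈ T.tiles
  offset : Space d
  shift_mem : shift tile offset ∈ K
  emb : Fin (n + 1) ↪o Fin (d + 1)

namespace Simplex

variable {T} {K : Set (Finset (Space d))} {n : ℕ}

/-- The `i`-th vertex. -/
def vertex (c : T.Simplex K n) (i : Fin (n + 1)) : Space d := T.vert c.tile (c.emb i) + c.offset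

/-- The puncture. -/
def puncture (c : T.Simplex K n) : Space d :=
  T.punc (Set.range fun i => T.vert c.tile (c.emb i)) + c.offset

/-- The `i`-th face, which omits the `i`-th vertex. -/
def face (c : T.Simplex K (n + 1)) (i : Fin (n + 2)) : T.Simplex K n :=
  { c with emb := (Fin.succAboveOrderEmb i).trans c.emb }

/-- The translated simplex of the translated tiling. -/
def translate (c : T.Simplex K n) (x : Space d) : T.Simplex (translate K x) n :=
  { c with offset := c.offset - x, shift_mem := shift_mem_translate c.shift_mem x }

lemma puncture_translate (c : T.Simplex K n) (x : Space d) :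
    (c.translate x).puncture = c.puncture - x := by
  simp [puncture, translate, add_sub_assoc]

end Simplex

lemma translate_mem_hull {K : Set (Finset (Space d))} (hK : K ∈ T.hull) (x : Space d) :
    translate K x ∈ T.hull := by
  refine ⟨hK.1.translate x, fun ε hε => ?_⟩
  obtain ⟨R, hR0, hR⟩ : ∃ R : ℝ, 0 < R ∧ ENNReal.ofReal (1 / (R + 1)) < ε := by
    rcases eq_or_ne ε ⊤ with rfl | hε'
    · exact ⟨1, one_pos, ENNReal.ofReal_lt_top⟩
    · have hpos : 0 < ε.toReal := ENNReal.toReal_pos hε.ne' hε'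
      refine ⟨1 / ε.toReal, by positivity, ?_⟩
      rw [ENNReal.ofReal_lt_iff_lt_toReal (by positivity) hε', div_lt_iff₀ (by positivity)]
      field_simp
      linarith
  obtain ⟨y, hy⟩ := hK.2 (ENNReal.ofReal (1 / (R + ‖x‖ + 1)))
    (ENNReal.ofReal_pos.2 (by positivity))
  simp only [tilingDist, iInf_lt_iff] at hy
  obtain ⟨r, ⟨hr, a, ha, b, hb, hab⟩, hlt⟩ := hy
  rw [ENNReal.ofReal_lt_ofReal_iff (by positivity)] at hlt
  have hrR : R + ‖x‖ < r := by
    have := (one_div_lt_one_div (by positivity) (by positivity)).1 hlt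
    linarith
  refine ⟨y + x, lt_of_le_of_lt ?_ hR⟩
  have hsub : 1 / r ≤ 1 / R := one_div_le_one_div_of_le hR0 (by linarith [norm_nonneg x])
  refine iInf₂_le_of_le R ⟨hR0, a, Metric.ball_subset_ball hsub ha, b,
    Metric.ball_subset_ball hsub hb, ?_⟩ le_rfl
  have h := hab.translate x
  simp only [translate_translate] at h ⊢
  rw [add_comm x a, show y + x + b = y + b + x by abel]
  unfold Agree at h ⊢
  have hsb : Metric.ball (0 : Space d) R ⊆ Metric.ball 0 (r - ‖x‖) :=
    Metric.ball_subset_ball (by linarith)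
  have := congrArg (· ∩ Metric.ball (0 : Space d) R) h
  simpa only [Set.inter_assoc, Set.inter_eq_right.2 hsb] using this

lemma tiles_mem_hull : T.tiles ∈ T.hull := by
  refine ⟨T.isTiling, fun ε hε => ⟨0, ?_⟩⟩
  rw [translate_zero]
  obtain ⟨R, hR0, hR⟩ : ∃ R : ℝ, 0 < R ∧ ENNReal.ofReal (1 / (R + 1)) < ε := by
    rcases eq_or_ne ε ⊤ with rfl | hε'
    · exact ⟨1, one_pos, ENNReal.ofReal_lt_top⟩
    · have hpos : 0 < ε.toReal := ENNReal.toReal_pos hε.ne' hε'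
      refine ⟨1 / ε.toReal, by positivity, ?_⟩
      rw [ENNReal.ofReal_lt_iff_lt_toReal (by positivity) hε', div_lt_iff₀ (by positivity)]
      field_simp
      linarith
  refine lt_of_le_of_lt (iInf₂_le_of_le R ⟨hR0, 0, by simpa using hR0, 0, by simpa using hR0, rfl⟩
    le_rfl) hR

/-- The `n`-dimensional `Δ`-transversal: the tilings of the hull which have the puncture of an
`n`-simplex at the origin. -/
def Xi (n : ℕ) : Type :=
  {K : Set (Finset (Space d)) // K ∈ T.hull ∧ ∃ c : T.Simplex K n, c.puncture = 0}

/-- The topology of `Ξ^n` given by the restriction of `tilingDist`. -/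
instance (n : ℕ) : TopologicalSpace (T.Xi n) where
  IsOpen U := ∀ ξ ∈ U, ∃ ε : ℝ≥0∞, 0 < ε ∧ ∀ η : T.Xi n, tilingDist ξ.1 η.1 < ε → η ∈ U
  isOpen_univ := fun _ _ => ⟨1, one_pos, fun _ _ => Set.mem_univ _⟩
  isOpen_inter := by
    rintro U V hU hV ξ ⟨h1, h2⟩
    obtain ⟨a, ha, ha'⟩ := hU ξ h1
    obtain ⟨b, hb, hb'⟩ := hV ξ h2
    exact ⟨min a b, lt_min ha hb, fun η hη =>
      ⟨ha' η (hη.trans_le (min_le_left _ _)), hb' η (hη.trans_le (min_le_right _ _))⟩⟩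
  isOpen_sUnion := by
    rintro S hS ξ ⟨U, hU, hξ⟩
    obtain ⟨a, ha, ha'⟩ := hS U hU ξ hξ
    exact ⟨a, ha, fun η hη => ⟨U, hU, ha' η hη⟩⟩

/-- For a simplex `σ` with puncture `p` of a tiling `K` of the hull, the point `K - p` of `Ξ^n`. -/
def pointAt {n : ℕ} {K : Set (Finset (Space d))} (hK : K ∈ T.hull) (c : T.Simplex K n) :
    T.Xi n :=
  ⟨translate K c.puncture, T.translate_mem_hull hK _, c.translate c.puncture, by
    rw [Simplex.puncture_translate, sub_self]⟩

/-- The point `T - p` of `Ξ^n`, where `p` is the puncture of an `n`-simplex of `T`. -/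
def orbitPoint {n : ℕ} (c : T.Simplex T.tiles n) : T.Xi n := T.pointAt T.tiles_mem_hull c

/-- The (unique) `n`-simplex of `ξ ∈ Ξ^n` whose puncture is at the origin. -/
def simplexAt {n : ℕ} (ξ : T.Xi n) : T.Simplex ξ.1 n := ξ.2.2.choose

/-! ### PV cohomology -/

/-- The PV differential `(d f)(ξ) = ∑ i, (-1)^i f (ξ - p_i)`, where `p_i` is the puncture of the
`i`-th face of the simplex of `ξ` whose puncture is at the origin. -/
def dPV (n : ℕ) : (T.Xi n → ℝ) →ₗ[ℝ] (T.Xi (n + 1) → ℝ) where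
  toFun f ξ := ∑ i : Fin (n + 2),
    (-1 : ℝ) ^ (i : ℕ) * f (T.pointAt ξ.2.1 ((T.simplexAt ξ).face i))
  map_add' f g := by
    ext ξ
    simp [mul_add, Finset.sum_add_distrib]
  map_smul' a f := by
    ext ξ
    simp only [Pi.smul_apply, smul_eq_mul, RingHom.id_apply, Finset.mul_sum]
    exact Finset.sum_congr rfl fun i _ => by ring

/-- The weak PV cochains: the continuous functions on `Ξ^n`. -/
def weakCochains (n : ℕ) : Submodule ℝ (T.Xi n → ℝ) where
  carrier := {f | Continuous f}
  zero_mem' := continuous_const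
  add_mem' hf hg := Continuous.add hf hg
  smul_mem' a _ hf := Continuous.const_smul hf a

/-- The strong PV cochains: the locally constant functions on `Ξ^n`. -/
def strongCochains (n : ℕ) : Submodule ℝ (T.Xi n → ℝ) where
  carrier := {f | IsLocallyConstant f}
  zero_mem' := IsLocallyConstant.const 0
  add_mem' hf hg := IsLocallyConstant.add hf hg
  smul_mem' a _ hf := IsLocallyConstant.comp hf (a * ·)

end SimplicialTiling

/-! ### Differential forms -/

/-- The smooth differential `n`-forms on `ℝ^d`. -/
def smoothForms (d n : ℕ) : AddSubgroup (Space d → Space d [⋀^Fin n]→L[ℝ] ℝ) where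
  carrier := {ω | ContDiff ℝ (⊤ : ℕ∞) ω}
  zero_mem' := by
    change ContDiff ℝ (⊤ : ℕ∞) (fun _ => 0)
    exact contDiff_const
  add_mem' {f g} hf hg := by
    change ContDiff ℝ (⊤ : ℕ∞) f at hf
    change ContDiff ℝ (⊤ : ℕ∞) g at hg
    exact hf.add hg
  neg_mem' {f} hf := by
    change ContDiff ℝ (⊤ : ℕ∞) f at hf
    exact hf.neg

/-- The pointwise scalar multiplication of smooth forms. -/
instance (d n : ℕ) : Module ℝ (smoothForms d n) where
  smul a ω := ⟨a • ω.1, by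
    have h : ContDiff ℝ (⊤ : ℕ∞) ω.1 := ω.2
    exact h.const_smul a⟩
  one_smul ω := Subtype.ext (one_smul ℝ ω.1)
  mul_smul a b ω := Subtype.ext (mul_smul a b ω.1)
  smul_zero a := Subtype.ext (smul_zero a)
  smul_add a ω η := Subtype.ext (smul_add a ω.1 η.1)
  add_smul a b ω := Subtype.ext (add_smul a b ω.1)
  zero_smul ω := Subtype.ext (zero_smul ℝ ω.1)

lemma smoothForms.coe_smul {d n : ℕ} (a : ℝ) (ω : smoothForms d n) :
    (a • ω).1 = a • ω.1 := rfl

/-- The exterior derivative. -/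
def extD (d n : ℕ) : smoothForms d n →ₗ[ℝ] smoothForms d (n + 1) where
  toFun ω := ⟨extDeriv ω.1, by
    have h : ContDiff ℝ (⊤ : ℕ∞) (fderiv ℝ ω.1) :=
      ContDiff.fderiv_right (m := (⊤ : ℕ∞)) (n := (⊤ : ℕ∞)) ω.2 (by simp)
    exact (ContinuousAlternatingMap.alternatizeUncurryFinCLM ℝ (Space d) ℝ).contDiff.comp h⟩
  map_add' ω η := by
    apply Subtype.ext
    funext x
    exact extDeriv_add ((show ContDiff ℝ (⊤ : ℕ∞) ω.1 from ω.2).differentiable (by simp) x)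
      ((show ContDiff ℝ (⊤ : ℕ∞) η.1 from η.2).differentiable (by simp) x)
  map_smul' a ω := by
    apply Subtype.ext
    funext x
    exact extDeriv_smul a ω.1

/-- The integral of an `n`-form over the oriented simplex with the ordered vertices `v 0, …, v n`,
computed in the affine parametrization by `{s ∈ ℝ^n | 0 ≤ s i, ∑ s i ≤ 1}`. -/
def simplexIntegral {d n : ℕ} (ω : Space d → Space d [⋀^Fin n]→L[ℝ] ℝ)
    (v : Fin (n + 1) → Space d) : ℝ :=
  ∫ s in {s : Fin n → ℝ | (∀ i, 0 ≤ s i) ∧ ∑ i, s i ≤ 1},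
    ω (v 0 + ∑ i, s i • (v i.succ - v 0)) (fun i => v i.succ - v 0)

namespace SimplicialTiling

variable {d : ℕ} (T : SimplicialTiling d)

/-- `f` is pattern equivariant with range `R`. -/
def IsPatternEquivariant {F : Type*} (f : Space d → F) (R : ℝ) : Prop :=
  ∀ x y, Agree R (translate T.tiles x) (translate T.tiles y) → f x = f y

/-- Agreement on a ball implies agreement on any smaller ball. -/
lemma IsPatternEquivariant.mono {F : Type*} {f : Space d → F} {R S : ℝ}
    (h : T.IsPatternEquivariant f R) (hRS : R ≤ S) : T.IsPatternEquivariant f S := by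
  intro x y hxy
  apply h
  have := congrArg (· ∩ Metric.ball (0 : Space d) R) hxy
  simpa only [Agree, Set.inter_assoc, Set.inter_eq_right.2 (Metric.ball_subset_ball hRS)] using this

/-- The smooth strongly pattern equivariant `n`-forms. -/
def strongForms (n : ℕ) : Submodule ℝ (smoothForms d n) where
  carrier := {ω | ∃ R : ℝ, 0 < R ∧ T.IsPatternEquivariant ω.1 R}
  zero_mem' := ⟨1, one_pos, fun _ _ _ => rfl⟩
  add_mem' := by
    rintro ω η ⟨R, hR, h⟩ ⟨S, hS, h'⟩
    refine ⟨max R S, lt_max_of_lt_left hR, fun x y hxy => ?_⟩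
    have h1 := h.mono T (le_max_left R S) x y hxy
    have h2 := h'.mono T (le_max_right R S) x y hxy
    simp [h1, h2]
  smul_mem' := by
    rintro a ω ⟨R, hR, h⟩
    refine ⟨R, hR, fun x y hxy => ?_⟩
    rw [smoothForms.coe_smul, Pi.smul_apply, Pi.smul_apply, h x y hxy]

/-- The smooth weakly pattern equivariant `n`-forms: the closure of the strongly pattern equivariant
ones with respect to uniform convergence of all derivatives. -/
def weakForms (n : ℕ) : Submodule ℝ (smoothForms d n) where
  carrier := {ω | ∀ (k : ℕ) (ε : ℝ), 0 < ε → ∃ η ∈ T.strongForms n,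
    ∀ j ≤ k, ∀ x, ‖iteratedFDeriv ℝ j (ω - η : smoothForms d n).1 x‖ ≤ ε}
  zero_mem' := by
    intro k ε hε
    refine ⟨0, zero_mem _, fun j _ x => ?_⟩
    have : ((0 - 0 : smoothForms d n)).1 = fun _ => 0 := by simp; rfl
    rw [this]
    have h0 : iteratedFDeriv ℝ j (fun _ : Space d => (0 : Space d [⋀^Fin n]→L[ℝ] ℝ)) = 0 :=
      iteratedFDeriv_fun_zero
    rw [h0]
    simpa using hε.le
  add_mem' := by
    intro ω₁ ω₂ h₁ h₂ k ε hε
    obtain ⟨η₁, hη₁, h₁⟩ := h₁ k (ε / 2) (by positivity)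
    obtain ⟨η₂, hη₂, h₂⟩ := h₂ k (ε / 2) (by positivity)
    refine ⟨η₁ + η₂, add_mem hη₁ hη₂, fun j hj x => ?_⟩
    have e : (ω₁ + ω₂ - (η₁ + η₂) : smoothForms d n).1 = (ω₁ - η₁).1 + (ω₂ - η₂).1 := by
      simp [add_sub_add_comm]
    have c₁ : ContDiff ℝ (⊤ : ℕ∞) (ω₁ - η₁).1 := (ω₁ - η₁).2
    have c₂ : ContDiff ℝ (⊤ : ℕ∞) (ω₂ - η₂).1 := (ω₂ - η₂).2
    rw [e, iteratedFDeriv_add_apply (c₁.of_le (by exact_mod_cast le_top)).contDiffAt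
      (c₂.of_le (by exact_mod_cast le_top)).contDiffAt]
    refine (norm_add_le _ _).trans ?_
    linarith [h₁ j hj x, h₂ j hj x]
  smul_mem' := by
    intro a ω h k ε hε
    obtain ⟨η, hη, h⟩ := h k (ε / (|a| + 1)) (by positivity)
    refine ⟨a • η, Submodule.smul_mem _ a hη, fun j hj x => ?_⟩
    have e : (a • ω - a • η : smoothForms d n).1 = a • (ω - η).1 := by
      simp [smul_sub, smoothForms.coe_smul]
    have c : ContDiff ℝ (⊤ : ℕ∞) (ω - η).1 := (ω - η).2
    rw [e, iteratedFDeriv_const_smul_apply (c.of_le (by exact_mod_cast le_top)).contDiffAt,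
      norm_smul, Real.norm_eq_abs]
    calc |a| * ‖iteratedFDeriv ℝ j (ω - η).1 x‖ ≤ (|a| + 1) * (ε / (|a| + 1)) :=
          mul_le_mul (by linarith) (h j hj x) (norm_nonneg _) (by positivity)
      _ = ε := by field_simp

end SimplicialTiling

/-! ### Cohomology -/

section cohomology

variable {d : ℕ}

/-- The cocycles of a complex `C` of smooth forms with the exterior derivative. -/
def deRhamCocycles (C : ∀ n, Submodule ℝ (smoothForms d n)) (n : ℕ) :
    Submodule ℝ (smoothForms d n) :=
  C n ⊓ LinearMap.ker (extD d n)

/-- The coboundaries of a complex `C` of smooth forms with the exterior derivative. -/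
def deRhamCoboundaries (C : ∀ n, Submodule ℝ (smoothForms d n)) :
    ∀ n, Submodule ℝ (smoothForms d n)
  | 0 => ⊥
  | n + 1 => (C n).map (extD d n)

/-- The cohomology of a complex `C` of smooth forms: cocycles modulo coboundaries. -/
abbrev DeRhamCohomology (C : ∀ n, Submodule ℝ (smoothForms d n)) (n : ℕ) : Type :=
  deRhamCocycles C n ⧸ (deRhamCoboundaries C n).submoduleOf (deRhamCocycles C n)

/-- The class of a cocycle. -/
def deRhamClass (C : ∀ n, Submodule ℝ (smoothForms d n)) (n : ℕ) (z : smoothForms d n)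
    (hz : z ∈ deRhamCocycles C n) : DeRhamCohomology C n :=
  Submodule.Quotient.mk ⟨z, hz⟩

variable (T : SimplicialTiling d)

/-- The cocycles of a complex `C` of functions on the transversals with the PV differential. -/
def pvCocycles (C : ∀ n, Submodule ℝ (T.Xi n → ℝ)) (n : ℕ) : Submodule ℝ (T.Xi n → ℝ) :=
  C n ⊓ LinearMap.ker (T.dPV n)

/-- The coboundaries of a complex `C` of functions on the transversals with the PV differential. -/
def pvCoboundaries (C : ∀ n, Submodule ℝ (T.Xi n → ℝ)) : ∀ n, Submodule ℝ (T.Xi n → ℝ)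
  | 0 => ⊥
  | n + 1 => (C n).map (T.dPV n)

/-- The cohomology of a complex `C` of functions on the transversals: cocycles modulo
coboundaries. -/
abbrev PVCohomology (C : ∀ n, Submodule ℝ (T.Xi n → ℝ)) (n : ℕ) : Type :=
  pvCocycles T C n ⧸ (pvCoboundaries T C n).submoduleOf (pvCocycles T C n)

/-- The class of a cocycle. -/
def pvClass (C : ∀ n, Submodule ℝ (T.Xi n → ℝ)) (n : ℕ) (z : T.Xi n → ℝ)
    (hz : z ∈ pvCocycles T C n) : PVCohomology T C n :=
  Submodule.Quotient.mk ⟨z, hz⟩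

end cohomology

end PVTiling

end

open PVTiling

open scoped ENNReal

noncomputable section

namespace PVTiling

open ContinuousAlternatingMap MeasureTheory Set Filter Topology

/-! ### Uniform bounds for derivatives -/

section bounds

variable {E F G H : Type*} [NormedAddCommGroup E] [NormedSpace ℝ E]
  [NormedAddCommGroup F] [NormedSpace ℝ F] [NormedAddCommGroup G] [NormedSpace ℝ G]
  [NormedAddCommGroup H] [NormedSpace ℝ H]

/-! This is de Rham's theorem for the triangulation given by the tiling, proved with operators
explicit enough to keep track of pattern equivariance. Integration `I` over simplices sends forms to
cochains. In the opposite direction the Whitney map `W` sends a cochain `c` to the sum of `c (v₀, …,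
v_n) φ_{v₀} dφ_{v₁} ∧ … ∧ dφ_{v_n}` over tuples of vertices, for a smooth partition of unity `φ`
subordinate to the open vertex stars.

Let `h_v` be the cone operator with apex `v`. It satisfies `d h_v + h_v d = 1` in positive degrees
(`extDeriv_coneOp_add`), and the integral over a simplex is an iterated cone operator
(`coneIntegral_eq_simplexIntegral`). From this and `∑ dφ_v = 0`, formal inductions give Stokes'
formula (`coneIntegral_extDeriv`), the chain map property of `W` (`whitney_coboundary`), and a
homotopy `H` with `d H + H d = 1 - W I` (`extDeriv_homotopyOp_add`). Moreover `I W = 1` on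
alternating cochains (`coneIntegral_whitney`), because `φ_v` and `dφ_v` vanish on every face that
does not contain `v`.

The operators `W` and `H` are local and commute with translations between places where the tiling
looks the same, because `φ_v` is chosen as a function of the star of `v` seen from `v`. Finiteness
of the prototiles implies that there are only finitely many patches of a given size (`finite_seen`),
so all constants are uniform. Pattern equivariance is measured by `PEBound k ε R`: the derivatives
up to order `k` at points with equal `R`-neighbourhoods differ by at most `ε`. Strong forms have one
`R` for `ε = 0` and all `k`. Weak forms have some `R` for each `k` and each `ε > 0`
(`mem_weakForms_iff`). Since `W` and `H` cost only a factor in `ε` and a constant in `R`, they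
respect both classes.

For the functions on `Ξ^n`, uniform separation of punctures shows that closeness in `Ξ^n` means
equality of tiles on a large ball, with no translation left over
(`exists_sameTiles_of_tilingDist_lt`). The orbit is dense and sequences in it have limits. Hence
continuous functions correspond to cochains on the simplices of the tiling satisfying `OrbitBound`
for each `ε > 0` and some `R`, and locally constant ones to `ε = 0` (`exists_extension`,
`exists_orbitBound`). Both isomorphisms are then instances of `exists_cohomology_equiv`, which only
asks that the two complexes be preserved by integration, `W` and `H`. -/

/-- The map is smooth. -/
abbrev Smooth (f : E → F) : Prop := ContDiff ℝ (⊤ : ℕ∞) f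

lemma Smooth.natCast {f : E → F} (hf : Smooth f) (k : ℕ) : ContDiff ℝ k f :=
  ContDiff.of_le hf (by exact_mod_cast le_top)

lemma Smooth.fderiv {f : E → F} (hf : Smooth f) : Smooth (fderiv ℝ f) :=
  ContDiff.fderiv_right (m := (⊤ : ℕ∞)) (n := (⊤ : ℕ∞)) hf (by simp)

lemma Smooth.differentiable {f : E → F} (hf : Smooth f) : Differentiable ℝ f :=
  ContDiff.differentiable hf (by simp)

lemma Smooth.comp_add {f : E → F} (hf : Smooth f) (a : E) : Smooth fun z => f (z + a) :=
  ContDiff.comp hf (contDiff_id.add contDiff_const)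

lemma smooth_clm (L : F →L[ℝ] G) {f : E → F} (hf : Smooth f) : Smooth fun z => L (f z) :=
  L.contDiff.comp hf

lemma smooth_bilin (L : F →L[ℝ] G →L[ℝ] H) {f : E → F} {g : E → G} (hf : Smooth f)
    (hg : Smooth g) : Smooth fun z => L (f z) (g z) :=
  ContDiff.clm_apply (L.contDiff.comp hf) hg

lemma hasFDerivAt_bilin (L : F →L[ℝ] G →L[ℝ] H) {f : E → F} {g : E → G} {f' : E →L[ℝ] F}
    {g' : E →L[ℝ] G} {x : E} (hf : HasFDerivAt f f' x) (hg : HasFDerivAt g g' x) :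
    HasFDerivAt (fun z => L (f z) (g z)) (L.flip (g x) ∘L f' + L (f x) ∘L g') x := by
  refine ((L.hasFDerivAt.comp x hf).clm_apply hg).congr_fderiv ?_
  ext u
  simp [add_comm]

/-- The derivatives of order at most `k` are bounded by `A` on `B`. -/
def CkBound (k : ℕ) (B : Set E) (A : ℝ) (f : E → F) : Prop :=
  ∀ j ≤ k, ∀ z ∈ B, ‖iteratedFDeriv ℝ j f z‖ ≤ A

namespace CkBound

variable {k : ℕ} {B : Set E} {A A' M : ℝ} {f g : E → F}

lemma mono (h : CkBound k B A f) (hA : A ≤ A') : CkBound k B A' f :=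
  fun j hj z hz => (h j hj z hz).trans hA

lemma mono_set {B' : Set E} (h : CkBound k B A f) (hB : B' ⊆ B) : CkBound k B' A f :=
  fun j hj z hz => h j hj z (hB hz)

lemma mono_order {k' : ℕ} (h : CkBound k B A f) (hk : k' ≤ k) : CkBound k' B A f :=
  fun j hj z hz => h j (hj.trans hk) z hz

lemma congr (h : CkBound k B A f) (hB : IsOpen B) (hfg : ∀ z ∈ B, g z = f z) :
    CkBound k B A g := by
  intro j hj z hz
  have : g =ᶠ[𝓝 z] f := by
    filter_upwards [hB.mem_nhds hz] with y hy using hfg y hy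
  rw [(this.iteratedFDeriv ℝ j).self_of_nhds]
  exact h j hj z hz

lemma add (hf : CkBound k B A f) (hg : CkBound k B A' g) (sf : Smooth f) (sg : Smooth g) :
    CkBound k B (A + A') (fun z => f z + g z) := by
  intro j hj z hz
  rw [show (fun z => f z + g z) = f + g from rfl,
    iteratedFDeriv_add_apply (sf.natCast j).contDiffAt (sg.natCast j).contDiffAt]
  exact (norm_add_le _ _).trans (add_le_add (hf j hj z hz) (hg j hj z hz))

lemma sub (hf : CkBound k B A f) (hg : CkBound k B A' g) (sf : Smooth f) (sg : Smooth g) :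
    CkBound k B (A + A') (fun z => f z - g z) := by
  intro j hj z hz
  rw [show (fun z => f z - g z) = f - g from rfl,
    iteratedFDeriv_sub_apply (sf.natCast j).contDiffAt (sg.natCast j).contDiffAt]
  exact (norm_sub_le _ _).trans (add_le_add (hf j hj z hz) (hg j hj z hz))

lemma sum {ι : Type*} (S : Finset ι) {f : ι → E → F} (hf : ∀ i ∈ S, CkBound k B A (f i))
    (sf : ∀ i ∈ S, Smooth (f i)) : CkBound k B (S.card * A) (fun z => ∑ i ∈ S, f i z) := by
  intro j hj z hz
  rw [show (fun z => ∑ i ∈ S, f i z) = ∑ i ∈ S, f i by ext; simp,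
    iteratedFDeriv_sum_apply (fun i hi => ((sf i hi).natCast j).contDiffAt)]
  refine (norm_sum_le _ _).trans ?_
  rw [← nsmul_eq_mul]
  exact Finset.sum_le_card_nsmul _ _ _ fun i hi => hf i hi j hj z hz

lemma clm (L : F →L[ℝ] G) (hf : CkBound k B A f) (sf : Smooth f) :
    CkBound k B (‖L‖ * A) (fun z => L (f z)) := by
  intro j hj z hz
  exact (L.norm_iteratedFDeriv_comp_left (sf.natCast j).contDiffAt le_rfl).trans
    (mul_le_mul_of_nonneg_left (hf j hj z hz) (norm_nonneg _))

lemma bilin (L : F →L[ℝ] G →L[ℝ] H) {f : E → F} {g : E → G} (hf : CkBound k B M f)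
    (hg : CkBound k B A g) (sf : Smooth f) (sg : Smooth g) :
    CkBound k B (‖L‖ * 2 ^ k * M * A) (fun z => L (f z) (g z)) := by
  intro j hj z hz
  have hM : 0 ≤ M := (norm_nonneg _).trans (hf 0 (Nat.zero_le _) z hz)
  have hA : 0 ≤ A := (norm_nonneg _).trans (hg 0 (Nat.zero_le _) z hz)
  refine (L.norm_iteratedFDeriv_le_of_bilinear (sf.natCast j) (sg.natCast j) z le_rfl).trans ?_
  have : ∑ i ∈ Finset.range (j + 1), (j.choose i : ℝ) * ‖iteratedFDeriv ℝ i f z‖ *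
      ‖iteratedFDeriv ℝ (j - i) g z‖ ≤ ∑ i ∈ Finset.range (j + 1), (j.choose i : ℝ) * (M * A) := by
    refine Finset.sum_le_sum fun i hi => ?_
    rw [mul_assoc]
    refine mul_le_mul_of_nonneg_left ?_ (Nat.cast_nonneg _)
    exact mul_le_mul (hf i ((Finset.mem_range_succ_iff.1 hi).trans hj) z hz)
      (hg (j - i) ((Nat.sub_le _ _).trans hj) z hz) (norm_nonneg _) hM
  rw [← Finset.sum_mul, ← Nat.cast_sum, Nat.sum_range_choose] at this
  have h2 : ((2 ^ j : ℕ) : ℝ) * (M * A) ≤ 2 ^ k * (M * A) := by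
    push_cast
    exact mul_le_mul_of_nonneg_right (pow_le_pow_right₀ one_le_two hj) (mul_nonneg hM hA)
  calc _ ≤ ‖L‖ * (2 ^ k * (M * A)) :=
        mul_le_mul_of_nonneg_left (this.trans h2) (norm_nonneg L)
    _ = _ := by ring

lemma exists_bilin (L : F →L[ℝ] G →L[ℝ] H) (k : ℕ) {M : ℝ} (hM : 0 ≤ M) :
    ∃ C, 0 ≤ C ∧ ∀ (B : Set E) (f : E → F) (g : E → G) (A : ℝ), Smooth f → Smooth g →
      CkBound k B M f → CkBound k B A g → CkBound k B (C * A) (fun z => L (f z) (g z)) :=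
  ⟨‖L‖ * 2 ^ k * M, by positivity, fun _ _ _ _ sf sg hf hg => bilin L hf hg sf sg⟩

lemma fderiv (hf : CkBound (k + 1) B A f) : CkBound k B A (fderiv ℝ f) := by
  intro j hj z hz
  rw [norm_iteratedFDeriv_fderiv]
  exact hf (j + 1) (by lia) z hz

end CkBound

/-- The chain rule gives one factor `t ≤ 1` for each derivative. -/
lemma norm_iteratedFDeriv_comp_homothety_le {f : E → F} (hf : Smooth f) {t : ℝ} (h0 : 0 ≤ t)
    (h1 : t ≤ 1) (v z : E) (j : ℕ) :
    ‖iteratedFDeriv ℝ j (fun x => f (v + t • (x - v))) z‖ ≤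
      ‖iteratedFDeriv ℝ j f (v + t • (z - v))‖ := by
  have e : (fun x => f (v + t • (x - v))) =
      (fun y => f (y + (v - t • v))) ∘ (t • ContinuousLinearMap.id ℝ E) := by
    funext x
    simp only [Function.comp, _root_.smul_apply, ContinuousLinearMap.id_apply]
    congr 1
    module
  rw [e, ContinuousLinearMap.iteratedFDeriv_comp_right _ ((hf.comp_add _).natCast j) z le_rfl,
    iteratedFDeriv_comp_add_right]
  refine (ContinuousMultilinearMap.norm_compContinuousLinearMap_le _ _).trans ?_
  have hz : (t • ContinuousLinearMap.id ℝ E) z + (v - t • v) = v + t • (z - v) := by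
    simp only [_root_.smul_apply, ContinuousLinearMap.id_apply]
    module
  rw [hz]
  refine mul_le_of_le_one_right (norm_nonneg _) (Finset.prod_le_one (fun _ _ => norm_nonneg _) ?_)
  intro _ _
  calc ‖t • ContinuousLinearMap.id ℝ E‖ = |t| * ‖ContinuousLinearMap.id ℝ E‖ := norm_smul _ _
    _ ≤ 1 * 1 := mul_le_mul (by rwa [abs_of_nonneg h0]) ContinuousLinearMap.norm_id_le
        (norm_nonneg _) zero_le_one
    _ = 1 := one_mul 1

lemma ckBound_sub_const (k : ℕ) {B : Set E} (v : E) {ρ : ℝ} (hρ : ∀ z ∈ B, ‖z - v‖ ≤ ρ) :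
    CkBound k B (max ρ 1) (fun z : E => z - v) := by
  intro j _ z hz
  rcases j with _ | j
  · simpa using Or.inl (hρ z hz)
  · rw [← norm_iteratedFDeriv_fderiv]
    have : _root_.fderiv ℝ (fun z : E => z - v) = fun _ => ContinuousLinearMap.id ℝ E := by
      funext x
      exact ((hasFDerivAt_id x).sub_const v).fderiv
    rw [this]
    rcases j with _ | j
    · simpa using Or.inr ContinuousLinearMap.norm_id_le
    · rw [iteratedFDeriv_const_of_ne (by simp)]
      simp

end bounds

/-! ### Smooth integrals with a parameter in the unit interval -/

section param

universe u

variable {E : Type u} [NormedAddCommGroup E] [NormedSpace ℝ E]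

/-- The derivative of the integrand is continuous, hence bounded on a compact ball times the unit
interval; this constant is the dominating function. -/
lemma hasFDerivAt_integral_param [ProperSpace E] {F : Type u} [NormedAddCommGroup F] [NormedSpace ℝ F]
    {G : E × ℝ → F} (hG : Smooth G) (x : E) :
    HasFDerivAt (fun x => ∫ t in (0 : ℝ)..1, G (x, t))
      (∫ t in (0 : ℝ)..1, (fderiv ℝ G (x, t)).comp (ContinuousLinearMap.inl ℝ E ℝ)) x := by
  have hc : Continuous fun p : E × ℝ =>
      (fderiv ℝ G p).comp (ContinuousLinearMap.inl ℝ E ℝ) :=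
    (hG.fderiv.continuous).clm_comp continuous_const
  obtain ⟨C, hC⟩ := ((isCompact_closedBall x 1).prod (isCompact_Icc (a := (0 : ℝ)) (b := 1))
    ).exists_bound_of_continuousOn hc.continuousOn
  refine intervalIntegral.hasFDerivAt_integral_of_dominated_of_fderiv_le
    (F' := fun x t => (fderiv ℝ G (x, t)).comp (ContinuousLinearMap.inl ℝ E ℝ))
    (bound := fun _ => C)
    (Metric.closedBall_mem_nhds x one_pos) ?_ ?_ ?_ ?_ ?_ ?_
  · refine Eventually.of_forall fun y => ?_
    exact (hG.continuous.comp (Continuous.prodMk_right y)).aestronglyMeasurable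
  · exact (hG.continuous.comp (Continuous.prodMk_right x)).intervalIntegrable _ _
  · exact (hc.comp (Continuous.prodMk_right x)).aestronglyMeasurable
  · refine Eventually.of_forall fun t ht y hy => ?_
    rw [uIoc_of_le zero_le_one] at ht
    exact hC (y, t) ⟨hy, ⟨ht.1.le, ht.2⟩⟩
  · exact intervalIntegrable_const
  · refine Eventually.of_forall fun t _ y _ => ?_
    exact (hG.differentiable (y, t)).hasFDerivAt.comp y (hasFDerivAt_prodMk_left y t)

lemma fderiv_slice {F : Type u} [NormedAddCommGroup F] [NormedSpace ℝ F]
    {G : E × ℝ → F} (hG : Smooth G) (x : E) (t : ℝ) :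
    fderiv ℝ (fun x => G (x, t)) x =
      (fderiv ℝ G (x, t)).comp (ContinuousLinearMap.inl ℝ E ℝ) :=
  ((hG.differentiable (x, t)).hasFDerivAt.comp x (hasFDerivAt_prodMk_left x t)).fderiv

lemma smooth_slice_fderiv {F : Type u} [NormedAddCommGroup F] [NormedSpace ℝ F]
    {G : E × ℝ → F} (hG : Smooth G) :
    Smooth fun p : E × ℝ => (fderiv ℝ G p).comp (ContinuousLinearMap.inl ℝ E ℝ) :=
  ContDiff.clm_comp hG.fderiv contDiff_const

/-- Differentiating under the integral gives an integral of the same kind with values in `E →L[ℝ]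
F`, so the induction on the order has to range over all targets. The spaces share a universe so that
the new target is again admissible. -/
lemma contDiff_integral_param [ProperSpace E] {F : Type u} [NormedAddCommGroup F] [NormedSpace ℝ F]
    {G : E × ℝ → F} (hG : Smooth G) : Smooth fun x => ∫ t in (0 : ℝ)..1, G (x, t) := by
  rw [Smooth, contDiff_infty]
  intro k
  induction k generalizing F with
  | zero =>
    exact contDiff_zero.2 (continuous_iff_continuousAt.2 fun x =>
      (hasFDerivAt_integral_param hG x).continuousAt)
  | succ k ih =>
    rw [Nat.cast_succ, contDiff_succ_iff_fderiv]
    refine ⟨fun x => (hasFDerivAt_integral_param hG x).differentiableAt, by simp, ?_⟩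
    have : fderiv ℝ (fun x => ∫ t in (0 : ℝ)..1, G (x, t)) = fun x => ∫ t in (0 : ℝ)..1,
        (fderiv ℝ G (x, t)).comp (ContinuousLinearMap.inl ℝ E ℝ) :=
      funext fun x => (hasFDerivAt_integral_param hG x).fderiv
    rw [this]
    exact ih (smooth_slice_fderiv hG)

/-- Derivatives pass under the integral, and an average over the unit interval is bounded by any
bound for the integrand. The induction again varies the target. -/
lemma norm_iteratedFDeriv_integral_param_le [ProperSpace E] {F : Type u} [NormedAddCommGroup F] [NormedSpace ℝ F]
    {G : E × ℝ → F} (hG : Smooth G) (j : ℕ) (x : E) {A : ℝ}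
    (hA : ∀ t ∈ Icc (0 : ℝ) 1, ‖iteratedFDeriv ℝ j (fun x => G (x, t)) x‖ ≤ A) :
    ‖iteratedFDeriv ℝ j (fun x => ∫ t in (0 : ℝ)..1, G (x, t)) x‖ ≤ A := by
  induction j generalizing F with
  | zero =>
    simp only [norm_iteratedFDeriv_zero] at hA ⊢
    refine (intervalIntegral.norm_integral_le_of_norm_le_const (C := A) fun t ht => ?_).trans ?_
    · rw [uIoc_of_le zero_le_one] at ht
      exact hA t ⟨ht.1.le, ht.2⟩
    · simp
  | succ j ih =>
    have e : fderiv ℝ (fun x => ∫ t in (0 : ℝ)..1, G (x, t)) = fun x => ∫ t in (0 : ℝ)..1,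
        (fderiv ℝ G (x, t)).comp (ContinuousLinearMap.inl ℝ E ℝ) :=
      funext fun x => (hasFDerivAt_integral_param hG x).fderiv
    rw [← norm_iteratedFDeriv_fderiv, e]
    refine ih (G := fun p : E × ℝ => (fderiv ℝ G p).comp (ContinuousLinearMap.inl ℝ E ℝ))
      (smooth_slice_fderiv hG) fun t ht => ?_
    refine le_of_eq_of_le ?_ (hA t ht)
    rw [← norm_iteratedFDeriv_fderiv,
      show _root_.fderiv ℝ (fun x => G (x, t)) = _ from funext fun y => fderiv_slice hG y t]

/-- Used with `L` the alternatization, this moves the exterior derivative under the integral sign of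
the cone operator. -/
lemma clm_fderiv_integral_param [ProperSpace E] {F H : Type u} [NormedAddCommGroup F]
    [NormedSpace ℝ F] [CompleteSpace F] [NormedAddCommGroup H] [NormedSpace ℝ H] [CompleteSpace H]
    {G : E × ℝ → F} (hG : Smooth G) (L : (E →L[ℝ] F) →L[ℝ] H) (x : E) :
    IntervalIntegrable (fun t => L (fderiv ℝ (fun x => G (x, t)) x)) volume 0 1 ∧
      L (fderiv ℝ (fun x => ∫ t in (0 : ℝ)..1, G (x, t)) x) =
        ∫ t in (0 : ℝ)..1, L (fderiv ℝ (fun x => G (x, t)) x) := by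
  have hc : Continuous fun t => fderiv ℝ (fun x => G (x, t)) x := by
    simp only [fderiv_slice hG]
    exact (smooth_slice_fderiv hG).continuous.comp (Continuous.prodMk_right x)
  refine ⟨(L.continuous.comp hc).intervalIntegrable _ _, ?_⟩
  rw [L.intervalIntegral_comp_comm (hc.intervalIntegrable _ _),
    (hasFDerivAt_integral_param hG x).fderiv]
  simp only [fderiv_slice hG]

end param

/-! ### The wedge product with a covector -/

section wedge

variable {E : Type*} [NormedAddCommGroup E] [NormedSpace ℝ E] {n : ℕ}

/-- Differential `n`-forms on `E`. -/
abbrev Form (E : Type*) [NormedAddCommGroup E] [NormedSpace ℝ E] (n : ℕ) : Type _ :=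
  E → E [⋀^Fin n]→L[ℝ] ℝ

/-- The wedge product of a covector and an alternating form. -/
def wedgeL (E : Type*) [NormedAddCommGroup E] [NormedSpace ℝ E] (n : ℕ) :
    (E →L[ℝ] ℝ) →L[ℝ] (E [⋀^Fin n]→L[ℝ] ℝ) →L[ℝ] E [⋀^Fin (n + 1)]→L[ℝ] ℝ :=
  (ContinuousLinearMap.compL ℝ (E [⋀^Fin n]→L[ℝ] ℝ) (E →L[ℝ] E [⋀^Fin n]→L[ℝ] ℝ) _
    (alternatizeUncurryFinCLM ℝ E ℝ)).comp
      (ContinuousLinearMap.smulRightL ℝ E (E [⋀^Fin n]→L[ℝ] ℝ))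

lemma wedgeL_apply (β : E →L[ℝ] ℝ) (η : E [⋀^Fin n]→L[ℝ] ℝ) :
    wedgeL E n β η = alternatizeUncurryFin (β.smulRight η) := rfl

lemma smooth_extDeriv {η : Form E n} (hη : Smooth η) : Smooth (extDeriv η) :=
  smooth_clm (F := E →L[ℝ] E [⋀^Fin n]→L[ℝ] ℝ) (G := E [⋀^Fin (n + 1)]→L[ℝ] ℝ)
    (alternatizeUncurryFinCLM ℝ E ℝ) hη.fderiv

lemma smooth_wedge {f : E → ℝ} (hf : Smooth f) {η : Form E n} (hη : Smooth η) :
    Smooth fun z => wedgeL E n (fderiv ℝ f z) (η z) :=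
  smooth_bilin (F := E →L[ℝ] ℝ) (G := E [⋀^Fin n]→L[ℝ] ℝ) (H := E [⋀^Fin (n + 1)]→L[ℝ] ℝ)
    (wedgeL E n) hf.fderiv hη

lemma extDeriv_fun_smul_form {f : E → ℝ} (hf : Smooth f) {η : Form E n} (hη : Smooth η) (x : E) :
    extDeriv (fun z => f z • η z) x = f x • extDeriv η x + wedgeL E n (fderiv ℝ f x) (η x) := by
  rw [extDeriv, fderiv_fun_smul (hf.differentiable x) (hη.differentiable x),
    alternatizeUncurryFin_add, alternatizeUncurryFin_smul, wedgeL_apply, extDeriv]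

lemma extDeriv_fun_sum_form {ι : Type*} (S : Finset ι) {η : ι → Form E n}
    (hη : ∀ i ∈ S, Smooth (η i)) (x : E) :
    extDeriv (fun z => ∑ i ∈ S, η i z) x = ∑ i ∈ S, extDeriv (η i) x := by
  rw [extDeriv, fderiv_fun_sum fun i hi => (hη i hi).differentiable x]
  exact map_sum (alternatizeUncurryFinCLM ℝ E ℝ) _ _

lemma extDeriv_fun_sub_form {η θ : Form E n} (hη : Smooth η) (hθ : Smooth θ) (x : E) :
    extDeriv (fun z => η z - θ z) x = extDeriv η x - extDeriv θ x := by
  rw [extDeriv, fderiv_fun_sub (hη.differentiable x) (hθ.differentiable x)]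
  exact map_sub (alternatizeUncurryFinCLM ℝ E ℝ) _ _

lemma extDeriv_extDeriv_form {η : Form E n} (hη : Smooth η) (x : E) :
    extDeriv (extDeriv η) x = 0 :=
  extDeriv_extDeriv_apply (r := (⊤ : ℕ∞)) (ContDiff.contDiffAt hη)
    (by simpa using WithTop.coe_le_coe.2 (le_top (a := (2 : ℕ∞))))

/-- Since `df ∧ η = d(f η) - f dη`, only the Leibniz rule for functions and `d ∘ d = 0` are needed.
-/
lemma extDeriv_wedge {f : E → ℝ} (hf : Smooth f) {η : Form E n} (hη : Smooth η) (x : E) :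
    extDeriv (fun z => wedgeL E n (fderiv ℝ f z) (η z)) x =
      -wedgeL E (n + 1) (fderiv ℝ f x) (extDeriv η x) := by
  have hs : Smooth fun z => f z • η z := ContDiff.smul hf hη
  have hs' : Smooth fun z => f z • extDeriv η z := ContDiff.smul hf (smooth_extDeriv hη)
  have e : (fun z => wedgeL E n (fderiv ℝ f z) (η z)) =
      fun z => extDeriv (fun z => f z • η z) z - f z • extDeriv η z := by
    funext z
    rw [extDeriv_fun_smul_form hf hη]
    abel
  rw [e, extDeriv_fun_sub_form (smooth_extDeriv hs) hs', extDeriv_extDeriv_form hs,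
    extDeriv_fun_smul_form hf (smooth_extDeriv hη), extDeriv_extDeriv_form hη]
  simp

/-- The contraction of `alternatizeUncurryFin` with a vector. -/
lemma curryLeft_alternatizeUncurryFin (A : E →L[ℝ] E [⋀^Fin (n + 1)]→L[ℝ] ℝ) (y : E) :
    alternatizeUncurryFin
      ((ContinuousLinearMap.apply ℝ (E [⋀^Fin n]→L[ℝ] ℝ) y) ∘L
        (curryLeftLI (𝕜 := ℝ) (E := E) (F := ℝ) (n := n)).toContinuousLinearMap ∘L A) +
      (alternatizeUncurryFin A).curryLeft y = A y := by
  ext w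
  -- The summand of index `0` of the alternatization is `A y`; the others carry the shifted sign and
  -- cancel the first term of the left-hand side.
  rw [ContinuousAlternatingMap.add_apply, curryLeft_apply_apply, alternatizeUncurryFin_apply,
    alternatizeUncurryFin_apply, Fin.sum_univ_succ (n := n + 1)]
  have h0 : (0 : Fin (n + 2)).removeNth (Matrix.vecCons y w) = w := by
    funext i
    simp [Fin.removeNth]
  have hi : ∀ i : Fin (n + 1), i.succ.removeNth (Matrix.vecCons y w) =
      Matrix.vecCons y (i.removeNth w) := by
    intro i
    funext j
    refine Fin.cases ?_ (fun j => ?_) j <;> simp [Fin.removeNth]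
  simp only [h0, hi, Fin.val_zero, pow_zero, one_smul, Matrix.cons_val_zero, Matrix.cons_val_succ,
    Fin.val_succ, pow_succ, mul_neg, mul_one, neg_smul, Finset.sum_neg_distrib]
  have : ∀ i : Fin (n + 1), ((ContinuousLinearMap.apply ℝ (E [⋀^Fin n]→L[ℝ] ℝ) y) ∘L
        (curryLeftLI (𝕜 := ℝ) (E := E) (F := ℝ) (n := n)).toContinuousLinearMap ∘L A) (w i)
        (i.removeNth w) = A (w i) (Matrix.vecCons y (i.removeNth w)) := fun i => rfl
  simp only [this]
  abel

lemma curryLeft_alternatizeUncurryFin_zero (A : E →L[ℝ] E [⋀^Fin 0]→L[ℝ] ℝ) (y : E) :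
    (alternatizeUncurryFin A).curryLeft y = A y := by
  ext w
  rw [curryLeft_apply_apply, alternatizeUncurryFin_apply]
  simp

end wedge

/-! ### The cone operator -/

section cone

universe u

variable {E : Type u} [NormedAddCommGroup E] [NormedSpace ℝ E] {n : ℕ}

/-- The cone operator: the contraction to `v` lowers the degree of a form by one. -/
def coneOp (v : E) (η : Form E (n + 1)) : Form E n := fun x =>
  ∫ t in (0 : ℝ)..1, t ^ n • (η (v + t • (x - v))).curryLeft (x - v)

/-- The integrand of the cone operator. -/
def coneIntegrand (v : E) (η : Form E (n + 1)) (p : E × ℝ) : E [⋀^Fin n]→L[ℝ] ℝ :=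
  p.2 ^ n • (η (v + p.2 • (p.1 - v))).curryLeft (p.1 - v)

lemma smooth_coneIntegrand (v : E) {η : Form E (n + 1)} (hη : Smooth η) :
    Smooth (coneIntegrand v η) := by
  have h0 : Smooth fun p : E × ℝ => v + p.2 • (p.1 - v) := by unfold Smooth; fun_prop
  have h1 : Smooth fun p : E × ℝ => η (v + p.2 • (p.1 - v)) := ContDiff.comp hη h0
  have h2 : Smooth fun p : E × ℝ => p.1 - v := by unfold Smooth; fun_prop
  have h3 : Smooth fun p : E × ℝ => p.2 ^ n := by unfold Smooth; fun_prop
  exact ContDiff.smul h3 (smooth_bilin (F := E [⋀^Fin (n + 1)]→L[ℝ] ℝ) (G := E)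
    (H := E [⋀^Fin n]→L[ℝ] ℝ) (curryLeftLI (𝕜 := ℝ) (E := E) (F := ℝ) (n := n)
      ).toContinuousLinearMap h1 h2)

lemma coneOp_eq (v : E) (η : Form E (n + 1)) :
    coneOp v η = fun x => ∫ t in (0 : ℝ)..1, coneIntegrand v η (x, t) := rfl

lemma intervalIntegrable_coneIntegrand (v : E) {η : Form E (n + 1)} (hη : Smooth η) (x : E) :
    IntervalIntegrable (fun t => coneIntegrand v η (x, t)) volume 0 1 :=
  ((smooth_coneIntegrand v hη).continuous.comp (Continuous.prodMk_right x)).intervalIntegrable _ _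

lemma smooth_coneOp [ProperSpace E] (v : E) {η : Form E (n + 1)} (hη : Smooth η) :
    Smooth (coneOp v η) :=
  contDiff_integral_param (smooth_coneIntegrand v hη)

lemma coneOp_sub (v : E) {η θ : Form E (n + 1)} (hη : Smooth η) (hθ : Smooth θ) :
    coneOp v (fun z => η z - θ z) = fun x => coneOp v η x - coneOp v θ x := by
  funext x
  rw [coneOp_eq, coneOp_eq, coneOp_eq, ← intervalIntegral.integral_sub
    (intervalIntegrable_coneIntegrand v hη x) (intervalIntegrable_coneIntegrand v hθ x)]
  refine intervalIntegral.integral_congr fun t _ => ?_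
  dsimp only [coneIntegrand]
  exact smul_sub (t ^ n) ((η (v + t • (x - v))).curryLeft (x - v))
    ((θ (v + t • (x - v))).curryLeft (x - v))

lemma coneOp_comp_add (v a : E) (η : Form E (n + 1)) (x : E) :
    coneOp (v + a) η (x + a) = coneOp v (fun z => η (z + a)) x := by
  unfold coneOp
  refine intervalIntegral.integral_congr fun t _ => ?_
  simp only [add_sub_add_right_eq_sub]
  rw [show v + a + t • (x - v) = v + t • (x - v) + a by abel]

/-- Product rule: one term differentiates the form, with a factor `t` from the homothety, the other
differentiates the contracted vector `x - v`. -/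
lemma hasFDerivAt_coneIntegrand (v : E) {η : Form E (n + 1)} (hη : Smooth η) (x : E) (t : ℝ) :
    HasFDerivAt (fun x => coneIntegrand v η (x, t))
      (t ^ n • (t • ((ContinuousLinearMap.apply ℝ (E [⋀^Fin n]→L[ℝ] ℝ) (x - v)) ∘L
        (curryLeftLI (𝕜 := ℝ) (E := E) (F := ℝ) (n := n)).toContinuousLinearMap ∘L
          fderiv ℝ η (v + t • (x - v))) + (η (v + t • (x - v))).curryLeft)) x := by
  have h0 : HasFDerivAt (fun x : E => v + t • (x - v)) (t • ContinuousLinearMap.id ℝ E) x :=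
    (((hasFDerivAt_id x).sub_const v).const_smul t).const_add v
  have h1 := ((hη.differentiable (v + t • (x - v))).hasFDerivAt).comp x h0
  have h3 := (hasFDerivAt_bilin (F := E [⋀^Fin (n + 1)]→L[ℝ] ℝ) (G := E)
    (H := E [⋀^Fin n]→L[ℝ] ℝ) (curryLeftLI (𝕜 := ℝ) (E := E) (F := ℝ) (n := n)
    ).toContinuousLinearMap h1 ((hasFDerivAt_id x).sub_const v)).const_smul (t ^ n)
  refine h3.congr_fderiv ?_
  congr 1
  ext u w
  simp

/-- The Poincaré lemma. The two integrands add up to the `t`-derivative of `t ^ (n + 1) • η (v + t •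
(x - v))`, which is `η x` at `t = 1` and zero at `t = 0`. Cartan's formula at a point
(`curryLeft_alternatizeUncurryFin`) produces the derivative of `η` along the ray, and the
alternatization of the contraction of `η` produces the term `(n + 1) t ^ n η`. -/
lemma extDeriv_coneOp_add [ProperSpace E] (v : E) {η : Form E (n + 1)} (hη : Smooth η) (x : E) :
    extDeriv (coneOp v η) x + coneOp v (extDeriv η) x = η x := by
  have hG := smooth_coneIntegrand v hη
  obtain ⟨hint', h1⟩ := clm_fderiv_integral_param (F := E [⋀^Fin n]→L[ℝ] ℝ)
    (H := E [⋀^Fin (n + 1)]→L[ℝ] ℝ) hG (alternatizeUncurryFinCLM ℝ E ℝ) x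
  rw [← coneOp_eq] at h1
  change extDeriv (coneOp v η) x = _ at h1
  have hint2 := intervalIntegrable_coneIntegrand v (smooth_extDeriv hη) x
  rw [h1, coneOp_eq, ← intervalIntegral.integral_add hint' hint2]
  have key : ∀ t : ℝ, HasDerivAt (fun t : ℝ => t ^ (n + 1) • η (v + t • (x - v)))
      (alternatizeUncurryFinCLM ℝ E ℝ (fderiv ℝ (fun x => coneIntegrand v η (x, t)) x) +
        coneIntegrand v (extDeriv η) (x, t)) t := by
    intro t
    have e1 : HasDerivAt (fun t : ℝ => v + t • (x - v)) (x - v) t := by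
      simpa using ((hasDerivAt_id t).smul_const (x - v)).const_add v
    have e2 := (hη.differentiable (v + t • (x - v))).hasFDerivAt.comp_hasDerivAt t e1
    have e3 := (hasDerivAt_pow (n + 1) t).smul e2
    refine e3.congr_deriv ?_
    rw [(hasFDerivAt_coneIntegrand v hη x t).fderiv, alternatizeUncurryFinCLM_apply,
      alternatizeUncurryFin_smul, alternatizeUncurryFin_add, alternatizeUncurryFin_smul,
      alternatizeUncurryFin_curryLeft, coneIntegrand]
    have := curryLeft_alternatizeUncurryFin (fderiv ℝ η (v + t • (x - v))) (x - v)
    rw [← this, extDeriv]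
    simp only [Nat.add_sub_cancel, Function.comp]
    push_cast
    rw [← Nat.cast_smul_eq_nsmul ℝ]
    push_cast
    module
  rw [intervalIntegral.integral_eq_sub_of_hasDerivAt (fun t _ => key t) (hint'.add hint2)]
  simp

/-- The fundamental theorem of calculus on the ray from `v` to `x`. Unlike in positive degrees, the
boundary term at `t = 0` survives; it is the source of the cochain in the homotopy formula. -/
lemma coneOp_extDeriv_zero (v : E) {f : Form E 0} (hf : Smooth f) (x : E) :
    coneOp v (extDeriv f) x = f x - f v := by
  have key : ∀ t : ℝ, HasDerivAt (fun t : ℝ => f (v + t • (x - v)))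
      (coneIntegrand v (extDeriv f) (x, t)) t := by
    intro t
    have e1 : HasDerivAt (fun t : ℝ => v + t • (x - v)) (x - v) t := by
      simpa using ((hasDerivAt_id t).smul_const (x - v)).const_add v
    have e2 := (hf.differentiable (v + t • (x - v))).hasFDerivAt.comp_hasDerivAt t e1
    refine e2.congr_deriv ?_
    rw [coneIntegrand, extDeriv, curryLeft_alternatizeUncurryFin_zero]
    simp
  rw [coneOp_eq]
  dsimp only
  rw [intervalIntegral.integral_eq_sub_of_hasDerivAt (fun t _ => key t)
    (intervalIntegrable_coneIntegrand v (smooth_extDeriv hf) x)]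
  simp

/-- Homotheties towards `v` preserve a ball containing `v` and do not increase derivatives. The
contracted vector `x - v` has length at most `2 * ρ` and first derivative of norm at most `1`,
whence `max (2 * ρ) 1`; the constant does not depend on the centre or on the apex. -/
lemma ckBound_coneOp [ProperSpace E] (n k : ℕ) (ρ : ℝ) :
    ∃ C, 0 ≤ C ∧ ∀ (x₀ v : E) (η : Form E (n + 1)) (A : ℝ), Smooth η → v ∈ Metric.ball x₀ ρ →
      CkBound k (Metric.ball x₀ ρ) A η → CkBound k (Metric.ball x₀ ρ) (C * A) (coneOp v η) := by
  set L := (curryLeftLI (𝕜 := ℝ) (E := E) (F := ℝ) (n := n)).toContinuousLinearMap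
  refine ⟨‖L.flip‖ * 2 ^ k * max (2 * ρ) 1, by positivity, fun x₀ v η A hη hv hA => ?_⟩
  intro j hj z hz
  have hA0 : 0 ≤ A := (norm_nonneg _).trans (hA 0 (Nat.zero_le _) z hz)
  refine norm_iteratedFDeriv_integral_param_le (smooth_coneIntegrand v hη) j z fun t ht => ?_
  have hcomp : Smooth fun y => η (v + t • (y - v)) := ContDiff.comp hη (by fun_prop)
  have b1 : CkBound k (Metric.ball x₀ ρ) A (fun y => η (v + t • (y - v))) := by
    intro i hi y hy
    refine (norm_iteratedFDeriv_comp_homothety_le hη ht.1 ht.2 v y i).trans (hA i hi _ ?_)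
    have := (convex_ball x₀ ρ) hv hy (sub_nonneg.2 ht.2) ht.1 (by ring)
    rwa [show v + t • (y - v) = (1 - t) • v + t • y by module]
  have b2 : CkBound k (Metric.ball x₀ ρ) (max (2 * ρ) 1) (fun y : E => y - v) := by
    refine ckBound_sub_const k v fun y hy => ?_
    rw [Metric.mem_ball] at hy hv
    rw [← dist_eq_norm]
    linarith [dist_triangle_right y v x₀]
  have b3 := CkBound.bilin (F := E) (G := E [⋀^Fin (n + 1)]→L[ℝ] ℝ) (H := E [⋀^Fin n]→L[ℝ] ℝ)
    L.flip b2 b1 (contDiff_id.sub contDiff_const) hcomp j hj z hz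
  have e : (fun y => coneIntegrand v η (y, t)) =
      fun y => t ^ n • (L.flip (y - v) (η (v + t • (y - v)))) := rfl
  have sm : Smooth fun y => L.flip (y - v) (η (v + t • (y - v))) :=
    smooth_bilin (F := E) (G := E [⋀^Fin (n + 1)]→L[ℝ] ℝ) (H := E [⋀^Fin n]→L[ℝ] ℝ)
      L.flip (contDiff_id.sub contDiff_const) hcomp
  rw [e, iteratedFDeriv_const_smul_apply' (sm.natCast j).contDiffAt, norm_smul, Real.norm_eq_abs,
    abs_of_nonneg (pow_nonneg ht.1 n)]
  calc _ ≤ 1 * (‖L.flip‖ * 2 ^ k * max (2 * ρ) 1 * A) :=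
        mul_le_mul (pow_le_one₀ ht.1 ht.2) b3 (norm_nonneg _) zero_le_one
    _ = _ := by ring

end cone

/-! ### Homotopy operators built from a finite family of functions -/

section operators

universe u

variable {E : Type u} [NormedAddCommGroup E] [NormedSpace ℝ E] {n : ℕ}

/-- The operator `η ↦ ∑ k, (-1)^k ∑ dφ_{v₁} ∧ … ∧ dφ_{v_k} ∧ h_{v_k} … h_{v₁} η`, where `h_v` is the
cone operator. -/
def corr (S : Finset E) (φ : E → E → ℝ) : ∀ n : ℕ, Form E n → Form E n
  | 0, η => η
  | n + 1, η => fun x =>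
      η x - ∑ v ∈ S, wedgeL E n (fderiv ℝ (φ v) x) (corr S φ n (coneOp v η) x)

/-- The homotopy between the identity and the composition of integration and `whitney`. -/
def homotopyOp (S : Finset E) (φ : E → E → ℝ) (n : ℕ) (ω : Form E (n + 1)) : Form E n :=
  fun x => ∑ v ∈ S, φ v x • corr S φ n (coneOp v ω) x

/-- The iterated cone operators applied to a form; this is the integral of the form over the simplex
with the given vertices. -/
def coneIntegral : ∀ n : ℕ, Form E n → (Fin (n + 1) → E) → ℝ
  | 0, η, w => η (w 0) ![]
  | n + 1, η, w => coneIntegral n (coneOp (w 0) η) (Fin.tail w)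

/-- The form `∑ c (v₁, …, v_n) dφ_{v₁} ∧ … ∧ dφ_{v_n}`. -/
def dWhitney (S : Finset E) (φ : E → E → ℝ) : ∀ n : ℕ, ((Fin n → E) → ℝ) → Form E n
  | 0, c => fun _ => constOfIsEmpty ℝ E (Fin 0) (c ![])
  | n + 1, c => fun x =>
      ∑ v ∈ S, wedgeL E n (fderiv ℝ (φ v) x) (dWhitney S φ n (fun w => c (Fin.cons v w)) x)

/-- The form `∑ c (v₀, …, v_n) φ_{v₀} dφ_{v₁} ∧ … ∧ dφ_{v_n}`. -/
def whitney (S : Finset E) (φ : E → E → ℝ) (n : ℕ) (c : (Fin (n + 1) → E) → ℝ) : Form E n :=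
  fun x => ∑ v ∈ S, φ v x • dWhitney S φ n (fun w => c (Fin.cons v w)) x

/-- The coboundary of a function on tuples. -/
def coboundary {V : Type*} (n : ℕ) (b : (Fin (n + 1) → V) → ℝ) (w : Fin (n + 2) → V) : ℝ :=
  ∑ j : Fin (n + 2), (-1 : ℝ) ^ (j : ℕ) * b (w ∘ j.succAbove)

lemma cons_comp_succAbove_zero {V : Type*} (v : V) (w : Fin (n + 1) → V) :
    (Fin.cons v w : Fin (n + 2) → V) ∘ (0 : Fin (n + 2)).succAbove = w := by
  funext i
  simp

lemma cons_comp_succAbove_succ {V : Type*} (v : V) (w : Fin (n + 1) → V) (j : Fin (n + 1)) :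
    (Fin.cons v w : Fin (n + 2) → V) ∘ j.succ.succAbove = Fin.cons v (w ∘ j.succAbove) := by
  funext i
  refine Fin.cases ?_ (fun i => ?_) i <;> simp

lemma coboundary_cons {V : Type*} (b : (Fin (n + 1) → V) → ℝ) (v : V) (w : Fin (n + 1) → V) :
    coboundary n b (Fin.cons v w) =
      b w - ∑ j : Fin (n + 1), (-1 : ℝ) ^ (j : ℕ) * b (Fin.cons v (w ∘ j.succAbove)) := by
  rw [coboundary, Fin.sum_univ_succ]
  simp only [cons_comp_succAbove_zero, cons_comp_succAbove_succ, Fin.val_zero, pow_zero, one_mul,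
    Fin.val_succ, pow_succ, mul_neg, mul_one, neg_mul, Finset.sum_neg_distrib]
  ring

/-! #### Smoothness and linearity -/

section smooth

variable (S : Finset E) (φ : E → E → ℝ)

lemma smooth_corr [ProperSpace E] (hφ : ∀ v, Smooth (φ v)) {η : Form E n} (hη : Smooth η) :
    Smooth (corr S φ n η) := by
  induction n with
  | zero => exact hη
  | succ n ih =>
    exact ContDiff.sub hη (ContDiff.sum fun v _ => smooth_wedge (hφ v) (ih (smooth_coneOp v hη)))

lemma smooth_homotopyOp [ProperSpace E] (hφ : ∀ v, Smooth (φ v)) {ω : Form E (n + 1)}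
    (hω : Smooth ω) : Smooth (homotopyOp S φ n ω) :=
  ContDiff.sum fun v _ => ContDiff.smul (hφ v) (smooth_corr S φ hφ (smooth_coneOp v hω))

lemma smooth_dWhitney (hφ : ∀ v, Smooth (φ v)) (c : (Fin n → E) → ℝ) :
    Smooth (dWhitney S φ n c) := by
  induction n with
  | zero => exact contDiff_const
  | succ n ih => exact ContDiff.sum fun v _ => smooth_wedge (hφ v) (ih _)

lemma smooth_whitney (hφ : ∀ v, Smooth (φ v)) (c : (Fin (n + 1) → E) → ℝ) :
    Smooth (whitney S φ n c) :=
  ContDiff.sum fun v _ => ContDiff.smul (hφ v) (smooth_dWhitney S φ hφ _)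

lemma corr_sub [ProperSpace E] {η θ : Form E n} (hη : Smooth η) (hθ : Smooth θ) (x : E) :
    corr S φ n (fun z => η z - θ z) x = corr S φ n η x - corr S φ n θ x := by
  induction n generalizing x with
  | zero => rfl
  | succ n ih =>
    simp only [corr, coneOp_sub _ hη hθ, ih (smooth_coneOp _ hη) (smooth_coneOp _ hθ), map_sub,
      Finset.sum_sub_distrib]
    abel

lemma homotopyOp_sub [ProperSpace E] {ω θ : Form E (n + 1)} (hω : Smooth ω) (hθ : Smooth θ)
    (x : E) :
    homotopyOp S φ n (fun z => ω z - θ z) x = homotopyOp S φ n ω x - homotopyOp S φ n θ x := by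
  simp only [homotopyOp, coneOp_sub _ hω hθ,
    corr_sub S φ (smooth_coneOp _ hω) (smooth_coneOp _ hθ), smul_sub, Finset.sum_sub_distrib]

lemma coneIntegral_sub [ProperSpace E] {η θ : Form E n} (hη : Smooth η) (hθ : Smooth θ)
    (w : Fin (n + 1) → E) :
    coneIntegral n (fun z => η z - θ z) w = coneIntegral n η w - coneIntegral n θ w := by
  induction n with
  | zero => rfl
  | succ n ih =>
    simp only [coneIntegral, coneOp_sub _ hη hθ, ih (smooth_coneOp _ hη) (smooth_coneOp _ hθ)]

lemma dWhitney_sub (c c' : (Fin n → E) → ℝ) (x : E) :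
    dWhitney S φ n (fun w => c w - c' w) x = dWhitney S φ n c x - dWhitney S φ n c' x := by
  induction n with
  | zero =>
    ext
    simp [dWhitney]
  | succ n ih => simp only [dWhitney, ih, map_sub, Finset.sum_sub_distrib]

lemma dWhitney_smul (a : ℝ) (c : (Fin n → E) → ℝ) (x : E) :
    dWhitney S φ n (fun w => a * c w) x = a • dWhitney S φ n c x := by
  induction n with
  | zero =>
    ext
    simp [dWhitney]
  | succ n ih => simp only [dWhitney, ih, map_smul, Finset.smul_sum]

lemma dWhitney_sum {ι : Type*} (I : Finset ι) (c : ι → (Fin n → E) → ℝ) (x : E) :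
    dWhitney S φ n (fun w => ∑ i ∈ I, c i w) x = ∑ i ∈ I, dWhitney S φ n (c i) x := by
  induction n with
  | zero =>
    ext
    simp [dWhitney]
  | succ n ih =>
    simp only [dWhitney, ih, _root_.map_sum]
    exact Finset.sum_comm

lemma whitney_sub (c c' : (Fin (n + 1) → E) → ℝ) (x : E) :
    whitney S φ n (fun w => c w - c' w) x = whitney S φ n c x - whitney S φ n c' x := by
  simp only [whitney, dWhitney_sub S φ (fun w => c (Fin.cons _ w)), smul_sub,
    Finset.sum_sub_distrib]

end smooth

/-! #### The homotopy formulas -/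

section homotopy

variable {S : Finset E} {φ : E → E → ℝ}

lemma sum_fderiv_eq_zero (hφ : ∀ v, Smooth (φ v)) {U : Set E} (hU : IsOpen U)
    (h1 : ∀ x ∈ U, ∑ v ∈ S, φ v x = 1) {x : E} (hx : x ∈ U) :
    ∑ v ∈ S, fderiv ℝ (φ v) x = 0 := by
  rw [← fderiv_fun_sum fun v _ => (hφ v).differentiable x]
  have : (fun z => ∑ v ∈ S, φ v z) =ᶠ[𝓝 x] fun _ => (1 : ℝ) := by
    filter_upwards [hU.mem_nhds hx] with z hz using h1 z hz
  rw [this.fderiv_eq]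
  simp

lemma sum_wedge_const_eq_zero {x : E} (h : ∑ v ∈ S, fderiv ℝ (φ v) x = 0)
    (η : E [⋀^Fin n]→L[ℝ] ℝ) : ∑ v ∈ S, wedgeL E n (fderiv ℝ (φ v) x) η = 0 := by
  have : ∑ v ∈ S, wedgeL E n (fderiv ℝ (φ v) x) η =
      wedgeL E n (∑ v ∈ S, fderiv ℝ (φ v) x) η := by
    rw [_root_.map_sum, _root_.sum_apply]
  rw [this, h, _root_.map_zero]
  rfl

lemma constOfIsEmpty_apply_default (a : E [⋀^Fin 0]→L[ℝ] ℝ) :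
    constOfIsEmpty ℝ E (Fin 0) (a ![]) = a := by
  ext w
  rw [constOfIsEmpty_apply]
  congr 1
  exact Subsingleton.elim _ _

/-- Substitute `h_v d = 1 - d h_v` in the recursion. The term without a cone operator is independent
of `v`, so it disappears by `∑ dφ_v = 0`. At the bottom, in degree zero, `h_v d f = f - f v` leaves
the constants `f v`, which are the iterated cone integrals. -/
lemma extDeriv_corr [ProperSpace E] (hφ : ∀ v, Smooth (φ v)) {U : Set E} (hU : IsOpen U)
    (h1 : ∀ x ∈ U, ∑ v ∈ S, φ v x = 1) {η : Form E n} (hη : Smooth η) {x : E} (hx : x ∈ U) :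
    extDeriv (corr S φ n η) x =
      corr S φ (n + 1) (extDeriv η) x - dWhitney S φ (n + 1) (coneIntegral n η) x := by
  have hsum := sum_fderiv_eq_zero hφ hU h1 hx
  induction n with
  | zero =>
    simp only [corr, dWhitney, coneOp_extDeriv_zero _ hη, coneIntegral, Fin.cons_zero,
      constOfIsEmpty_apply_default, map_sub, Finset.sum_sub_distrib,
      sum_wedge_const_eq_zero hsum]
    abel
  | succ n ih =>
    have e1 : extDeriv (corr S φ (n + 1) η) x = extDeriv η x +
        ∑ v ∈ S, wedgeL E (n + 1) (fderiv ℝ (φ v) x) (extDeriv (corr S φ n (coneOp v η)) x) := by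
      have hs : ∀ v ∈ S, Smooth fun z => wedgeL E n (fderiv ℝ (φ v) z)
          (corr S φ n (coneOp v η) z) :=
        fun v _ => smooth_wedge (hφ v) (smooth_corr S φ hφ (smooth_coneOp v hη))
      rw [show corr S φ (n + 1) η = fun x => η x - ∑ v ∈ S, wedgeL E n (fderiv ℝ (φ v) x)
        (corr S φ n (coneOp v η) x) from rfl, extDeriv_fun_sub_form hη (ContDiff.sum hs),
        extDeriv_fun_sum_form S hs, sub_eq_add_neg, ← Finset.sum_neg_distrib]
      congr 1
      refine Finset.sum_congr rfl fun v _ => ?_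
      rw [extDeriv_wedge (hφ v) (smooth_corr S φ hφ (smooth_coneOp v hη)), neg_neg]
    have e2 : ∀ v, coneOp v (extDeriv η) = fun z => η z - extDeriv (coneOp v η) z := by
      intro v
      funext z
      rw [← extDeriv_coneOp_add v hη z]
      abel
    rw [e1, corr, dWhitney, Finset.sum_congr rfl fun v _ => congrArg _ (ih (smooth_coneOp v hη))]
    simp only [e2, corr_sub S φ hη (smooth_extDeriv (smooth_coneOp _ hη)), map_sub,
      Finset.sum_sub_distrib, sum_wedge_const_eq_zero hsum, coneIntegral, Fin.cons_zero,
      Fin.tail_cons]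
    abel

/-- The homotopy formula in positive degrees. -/
lemma extDeriv_homotopyOp_add [ProperSpace E] (hφ : ∀ v, Smooth (φ v)) {U : Set E}
    (hU : IsOpen U) (h1 : ∀ x ∈ U, ∑ v ∈ S, φ v x = 1) {ω : Form E (n + 1)} (hω : Smooth ω)
    {x : E} (hx : x ∈ U) :
    extDeriv (homotopyOp S φ n ω) x + homotopyOp S φ (n + 1) (extDeriv ω) x =
      ω x - whitney S φ (n + 1) (coneIntegral (n + 1) ω) x := by
  have hs := fun v => smooth_corr S φ hφ (smooth_coneOp v hω)
  have e1 : extDeriv (homotopyOp S φ n ω) x =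
      ∑ v ∈ S, (φ v x • extDeriv (corr S φ n (coneOp v ω)) x +
        wedgeL E n (fderiv ℝ (φ v) x) (corr S φ n (coneOp v ω) x)) := by
    rw [show homotopyOp S φ n ω = fun x => ∑ v ∈ S, φ v x • corr S φ n (coneOp v ω) x from rfl,
      extDeriv_fun_sum_form S (η := fun v x => φ v x • corr S φ n (coneOp v ω) x)
        fun v _ => ContDiff.smul (hφ v) (hs v)]
    exact Finset.sum_congr rfl fun v _ => extDeriv_fun_smul_form (hφ v) (hs v) x
  have e2 : ∀ v, coneOp v (extDeriv ω) = fun z => ω z - extDeriv (coneOp v ω) z := by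
    intro v
    funext z
    rw [← extDeriv_coneOp_add v hω z]
    abel
  -- This is the recursion that defines `corr`, read backwards.
  have e3 : ∑ v ∈ S, wedgeL E n (fderiv ℝ (φ v) x) (corr S φ n (coneOp v ω) x) =
      ω x - corr S φ (n + 1) ω x := by
    exact (sub_sub_cancel _ _).symm
  have e4 : ∑ v ∈ S, φ v x • corr S φ (n + 1) ω x = corr S φ (n + 1) ω x := by
    rw [← Finset.sum_smul, h1 x hx, one_smul]
  rw [e1, Finset.sum_add_distrib, e3, homotopyOp, whitney]
  simp only [e2, corr_sub S φ hω (smooth_extDeriv (smooth_coneOp _ hω)),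
    extDeriv_corr hφ hU h1 (smooth_coneOp _ hω) hx, smul_sub, Finset.sum_sub_distrib, e4,
    coneIntegral, Fin.cons_zero, Fin.tail_cons]
  abel

/-- The homotopy formula in degree zero. -/
lemma homotopyOp_extDeriv_zero {x : E} (h1 : ∑ v ∈ S, φ v x = 1) {ω : Form E 0}
    (hω : Smooth ω) :
    homotopyOp S φ 0 (extDeriv ω) x = ω x - whitney S φ 0 (coneIntegral 0 ω) x := by
  simp only [homotopyOp, whitney, corr, dWhitney, coneOp_extDeriv_zero _ hω, coneIntegral,
    Fin.cons_zero, constOfIsEmpty_apply_default, smul_sub, Finset.sum_sub_distrib]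
  rw [← Finset.sum_smul, h1, one_smul]

/-- The form is a combination with constant coefficients of products of the exact forms `dφ_v`. -/
lemma extDeriv_dWhitney (hφ : ∀ v, Smooth (φ v)) (c : (Fin n → E) → ℝ) (x : E) :
    extDeriv (dWhitney S φ n c) x = 0 := by
  induction n with
  | zero =>
    rw [show dWhitney S φ 0 c = fun _ => constOfIsEmpty ℝ E (Fin 0) (c ![]) from rfl, extDeriv]
    rw [fderiv_fun_const]
    exact _root_.map_zero (alternatizeUncurryFinCLM ℝ E ℝ)
  | succ n ih =>
    rw [show dWhitney S φ (n + 1) c = fun x => ∑ v ∈ S, wedgeL E n (fderiv ℝ (φ v) x)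
      (dWhitney S φ n (fun w => c (Fin.cons v w)) x) from rfl,
      extDeriv_fun_sum_form S fun v _ => smooth_wedge (hφ v) (smooth_dWhitney S φ hφ _)]
    refine Finset.sum_eq_zero fun v _ => ?_
    rw [extDeriv_wedge (hφ v) (smooth_dWhitney S φ hφ _), ih, _root_.map_zero, neg_zero]

lemma extDeriv_whitney (hφ : ∀ v, Smooth (φ v)) (c : (Fin (n + 1) → E) → ℝ) (x : E) :
    extDeriv (whitney S φ n c) x = dWhitney S φ (n + 1) c x := by
  rw [show whitney S φ n c = fun x => ∑ v ∈ S, φ v x •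
    dWhitney S φ n (fun w => c (Fin.cons v w)) x from rfl,
    extDeriv_fun_sum_form S
      (η := fun v x => φ v x • dWhitney S φ n (fun w => c (Fin.cons v w)) x)
      fun v _ => ContDiff.smul (hφ v) (smooth_dWhitney S φ hφ _), dWhitney]
  refine Finset.sum_congr rfl fun v _ => ?_
  rw [extDeriv_fun_smul_form (hφ v) (smooth_dWhitney S φ hφ _), extDeriv_dWhitney hφ, smul_zero,
    zero_add]

/-- The coefficient does not depend on the `j`-th vertex, so summation over that vertex gives the
factor `∑ dφ_v = 0`. -/
lemma dWhitney_comp_succAbove {x : E} (hsum : ∑ v ∈ S, fderiv ℝ (φ v) x = 0)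
    (b : (Fin n → E) → ℝ) (j : Fin (n + 1)) :
    dWhitney S φ (n + 1) (fun w => b (w ∘ j.succAbove)) x = 0 := by
  induction n with
  | zero =>
    have : ∀ v : E, ∀ w : Fin 0 → E,
        (Fin.cons v w : Fin 1 → E) ∘ j.succAbove = ![] := fun v w => Subsingleton.elim _ _
    simp only [dWhitney, this]
    exact sum_wedge_const_eq_zero hsum _
  | succ n ih =>
    rw [dWhitney]
    refine Fin.cases ?_ (fun j => ?_) j
    · simp only [cons_comp_succAbove_zero]
      exact sum_wedge_const_eq_zero hsum _
    · refine Finset.sum_eq_zero fun v _ => ?_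
      simp only [cons_comp_succAbove_succ]
      rw [ih (fun w => b (Fin.cons v w)), _root_.map_zero]

/-- In `(δb) (v, w)` every term except `b w` ignores one entry of `w` and is killed by `dWhitney`.
The remaining term does not depend on `v`, and `∑ φ_v = 1`. -/
lemma whitney_coboundary (hφ : ∀ v, Smooth (φ v)) {U : Set E} (hU : IsOpen U)
    (h1 : ∀ x ∈ U, ∑ v ∈ S, φ v x = 1) (b : (Fin (n + 1) → E) → ℝ) {x : E} (hx : x ∈ U) :
    whitney S φ (n + 1) (coboundary n b) x = extDeriv (whitney S φ n b) x := by
  have hsum := sum_fderiv_eq_zero hφ hU h1 hx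
  have : ∀ v, dWhitney S φ (n + 1) (fun w => coboundary n b (Fin.cons v w)) x =
      dWhitney S φ (n + 1) b x := by
    intro v
    simp only [coboundary_cons]
    rw [dWhitney_sub, dWhitney_sum]
    rw [Finset.sum_eq_zero, sub_zero]
    intro j _
    rw [dWhitney_smul, dWhitney_comp_succAbove hsum (fun w => b (Fin.cons v w)), smul_zero]
  rw [whitney, extDeriv_whitney hφ]
  simp only [this]
  rw [← Finset.sum_smul, h1 x hx, one_smul]

/-- Stokes' formula for the iterated cone operators. -/
lemma coneIntegral_extDeriv [ProperSpace E] {ω : Form E n} (hω : Smooth ω) (w : Fin (n + 2) → E) :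
    coneIntegral (n + 1) (extDeriv ω) w = coboundary n (coneIntegral n ω) w := by
  obtain ⟨v, w, rfl⟩ : ∃ v w', w = Fin.cons v w' := ⟨w 0, Fin.tail w, (Fin.cons_self_tail w).symm⟩
  rw [coboundary_cons, coneIntegral, Fin.cons_zero, Fin.tail_cons]
  induction n generalizing v with
  | zero =>
    simp [coneIntegral, coneOp_extDeriv_zero _ hω]
  | succ n ih =>
    -- Pushing the outermost cone operator through `d` splits off the face opposite to `v`; the
    -- induction hypothesis applied to `coneOp v ω` gives the faces containing `v`.
    have e2 : coneOp v (extDeriv ω) = fun z => ω z - extDeriv (coneOp v ω) z := by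
      funext z
      rw [← extDeriv_coneOp_add v hω z]
      abel
    rw [e2, coneIntegral_sub hω (smooth_extDeriv (smooth_coneOp v hω))]
    congr 1
    obtain ⟨v', w, rfl⟩ : ∃ v w', w = Fin.cons v w' :=
      ⟨w 0, Fin.tail w, (Fin.cons_self_tail w).symm⟩
    rw [coneIntegral, Fin.cons_zero, Fin.tail_cons, ih (smooth_coneOp v hω), ← coboundary_cons]
    simp only [coboundary, coneIntegral, Fin.cons_zero, Fin.tail_cons]

end homotopy

/-! #### Locality and equivariance -/

section locality

variable {S S' : Finset E} {φ φ' : E → E → ℝ} {x : E}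

/-- Vertices with `dφ_v = 0` at `x` contribute nothing, so any finite set containing the active
vertices may be used. This allows one fixed set of vertices on a whole neighbourhood. -/
lemma corr_subset (hS : S ⊆ S') (h : ∀ v ∈ S', v ∉ S → fderiv ℝ (φ v) x = 0)
    (η : Form E n) : corr S φ n η x = corr S' φ n η x := by
  induction n with
  | zero => rfl
  | succ n ih =>
    simp only [corr, ih]
    congr 1
    refine Finset.sum_subset hS fun v hv hv' => ?_
    rw [h v hv hv', _root_.map_zero]
    rfl

lemma homotopyOp_subset (hS : S ⊆ S')
    (h : ∀ v ∈ S', v ∉ S → φ v x = 0 ∧ fderiv ℝ (φ v) x = 0) (ω : Form E (n + 1)) :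
    homotopyOp S φ n ω x = homotopyOp S' φ n ω x := by
  simp only [homotopyOp, corr_subset hS fun v hv hv' => (h v hv hv').2]
  refine Finset.sum_subset hS fun v hv hv' => ?_
  rw [(h v hv hv').1, zero_smul]

lemma dWhitney_subset (hS : S ⊆ S') (h : ∀ v ∈ S', v ∉ S → fderiv ℝ (φ v) x = 0)
    (c : (Fin n → E) → ℝ) : dWhitney S φ n c x = dWhitney S' φ n c x := by
  induction n with
  | zero => rfl
  | succ n ih =>
    simp only [dWhitney, ih]
    refine Finset.sum_subset hS fun v hv hv' => ?_
    rw [h v hv hv', _root_.map_zero]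
    rfl

lemma whitney_subset (hS : S ⊆ S')
    (h : ∀ v ∈ S', v ∉ S → φ v x = 0 ∧ fderiv ℝ (φ v) x = 0) (c : (Fin (n + 1) → E) → ℝ) :
    whitney S φ n c x = whitney S' φ n c x := by
  simp only [whitney, dWhitney_subset hS fun v hv hv' => (h v hv hv').2]
  refine Finset.sum_subset hS fun v hv hv' => ?_
  rw [(h v hv hv').1, zero_smul]

/-- A tuple with an entry outside `A` comes with a factor `dφ_v` that vanishes at `x`. -/
lemma dWhitney_congr {A : Set E} (h : ∀ v ∈ S, v ∉ A → fderiv ℝ (φ v) x = 0)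
    {c c' : (Fin n → E) → ℝ} (hc : ∀ w : Fin n → E, (∀ i, w i ∈ A) → c w = c' w) :
    dWhitney S φ n c x = dWhitney S φ n c' x := by
  induction n with
  | zero => simp only [dWhitney, hc ![] fun i => i.elim0]
  | succ n ih =>
    refine Finset.sum_congr rfl fun v hv => ?_
    by_cases hvA : v ∈ A
    · rw [ih]
      intro w hw
      exact hc _ fun i => by refine Fin.cases ?_ (fun i => ?_) i <;> simp [hvA, hw]
    · rw [h v hv hvA, _root_.map_zero]
      rfl

lemma whitney_congr {A : Set E} (h : ∀ v ∈ S, v ∉ A → φ v x = 0 ∧ fderiv ℝ (φ v) x = 0)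
    {c c' : (Fin (n + 1) → E) → ℝ} (hc : ∀ w : Fin (n + 1) → E, (∀ i, w i ∈ A) → c w = c' w) :
    whitney S φ n c x = whitney S φ n c' x := by
  refine Finset.sum_congr rfl fun v hv => ?_
  by_cases hvA : v ∈ A
  · rw [dWhitney_congr (A := A) fun v hv hv' => (h v hv hv').2]
    intro w hw
    exact hc _ fun i => by refine Fin.cases ?_ (fun i => ?_) i <;> simp [hvA, hw]
  · rw [(h v hv hvA).1, zero_smul, zero_smul]

/-- Cone operators commute with translations, so it suffices that the derivatives of the partition
functions at the two points match. The recursion evaluates these derivatives only at the point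
itself. -/
lemma corr_translate (a : E)
    (h : ∀ v ∈ S, fderiv ℝ (φ (v + a)) (x + a) = fderiv ℝ (φ v) x) (η : Form E n) :
    corr (S.map (addRightEmbedding a)) φ n η (x + a) = corr S φ n (fun z => η (z + a)) x := by
  induction n with
  | zero => rfl
  | succ n ih =>
    simp only [corr, Finset.sum_map, addRightEmbedding_apply, ih]
    congr 1
    refine Finset.sum_congr rfl fun v hv => ?_
    rw [h v hv]
    simp only [coneOp_comp_add]

lemma homotopyOp_translate (a : E)
    (h : ∀ v ∈ S, φ (v + a) (x + a) = φ v x ∧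
      fderiv ℝ (φ (v + a)) (x + a) = fderiv ℝ (φ v) x) (ω : Form E (n + 1)) :
    homotopyOp (S.map (addRightEmbedding a)) φ n ω (x + a) =
      homotopyOp S φ n (fun z => ω (z + a)) x := by
  simp only [homotopyOp, Finset.sum_map, addRightEmbedding_apply,
    corr_translate a fun v hv => (h v hv).2]
  refine Finset.sum_congr rfl fun v hv => ?_
  rw [(h v hv).1]
  simp only [coneOp_comp_add]

lemma dWhitney_translate (a : E)
    (h : ∀ v ∈ S, fderiv ℝ (φ (v + a)) (x + a) = fderiv ℝ (φ v) x) (c : (Fin n → E) → ℝ) :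
    dWhitney (S.map (addRightEmbedding a)) φ n c (x + a) =
      dWhitney S φ n (fun w => c fun i => w i + a) x := by
  induction n with
  | zero =>
    simp only [dWhitney]
    congr 2
    exact Subsingleton.elim _ _
  | succ n ih =>
    simp only [dWhitney, Finset.sum_map, addRightEmbedding_apply, ih]
    refine Finset.sum_congr rfl fun v hv => ?_
    rw [h v hv]
    congr 3
    funext w
    congr 1
    funext i
    refine Fin.cases ?_ (fun i => ?_) i <;> simp

lemma whitney_translate (a : E)
    (h : ∀ v ∈ S, φ (v + a) (x + a) = φ v x ∧
      fderiv ℝ (φ (v + a)) (x + a) = fderiv ℝ (φ v) x) (c : (Fin (n + 1) → E) → ℝ) :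
    whitney (S.map (addRightEmbedding a)) φ n c (x + a) =
      whitney S φ n (fun w => c fun i => w i + a) x := by
  simp only [whitney, Finset.sum_map, addRightEmbedding_apply,
    dWhitney_translate a fun v hv => (h v hv).2]
  refine Finset.sum_congr rfl fun v hv => ?_
  rw [(h v hv).1]
  congr 3
  funext w
  congr 1
  funext i
  refine Fin.cases ?_ (fun i => ?_) i <;> simp

end locality

/-! #### Bounds -/

section operatorBounds

/-- One more derivative of `f` is assumed than of `η`, since `f` enters through `df`. -/
lemma ckBound_wedge (n k : ℕ) (M : ℝ) (hM : 0 ≤ M) :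
    ∃ C, 0 ≤ C ∧ ∀ (B : Set E) (f : E → ℝ) (η : Form E n) (A : ℝ), Smooth f → Smooth η →
      CkBound (k + 1) B M f → CkBound k B A η →
        CkBound k B (C * A) (fun z => wedgeL E n (fderiv ℝ f z) (η z)) := by
  obtain ⟨C, hC, H⟩ := CkBound.exists_bilin (E := E) (F := E →L[ℝ] ℝ) (G := E [⋀^Fin n]→L[ℝ] ℝ)
    (H := E [⋀^Fin (n + 1)]→L[ℝ] ℝ) (wedgeL E n) k hM
  exact ⟨C, hC, fun B f η A hf hη hM hA => H B _ _ A hf.fderiv hη hM.fderiv hA⟩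

lemma ckBound_smul {F : Type*} [NormedAddCommGroup F] [NormedSpace ℝ F] (k : ℕ) {M A : ℝ}
    {B : Set E} {f : E → ℝ} {η : E → F} (hf : Smooth f) (hη : Smooth η)
    (hM : CkBound k B M f) (hA : CkBound k B A η) :
    CkBound k B (2 ^ k * M * A) (fun z => f z • η z) := by
  intro j hj z hz
  have hM0 : 0 ≤ M := (norm_nonneg _).trans (hM 0 (Nat.zero_le _) z hz)
  have hA0 : 0 ≤ A := (norm_nonneg _).trans (hA 0 (Nat.zero_le _) z hz)
  refine (CkBound.bilin (ContinuousLinearMap.lsmul ℝ ℝ : ℝ →L[ℝ] F →L[ℝ] F) hM hA hf hη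
    j hj z hz).trans ?_
  have := ContinuousLinearMap.opNorm_lsmul_le (𝕜 := ℝ) (R := ℝ) (E := F)
  calc _ ≤ 1 * 2 ^ k * M * A := by gcongr
    _ = _ := by ring



/-- The constant depends only on the degree, the order, the radius, the number of functions and
their size. Finite local complexity bounds all of these uniformly over the tiling. -/
lemma ckBound_corr [ProperSpace E] (n k N : ℕ) (ρ M : ℝ) (hM : 0 ≤ M) :
    ∃ C, 0 ≤ C ∧ ∀ (x₀ : E) (S : Finset E) (φ : E → E → ℝ) (η : Form E n) (A : ℝ), 0 ≤ A →
      (∀ v, Smooth (φ v)) → Smooth η → S.card ≤ N → (∀ v ∈ S, v ∈ Metric.ball x₀ ρ) →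
      (∀ v ∈ S, CkBound (k + 1) (Metric.ball x₀ ρ) M (φ v)) →
      CkBound k (Metric.ball x₀ ρ) A η → CkBound k (Metric.ball x₀ ρ) (C * A) (corr S φ n η) := by
  induction n with
  | zero => exact ⟨1, zero_le_one, fun x₀ S φ η A _ _ _ _ _ _ h => by simpa [corr] using h⟩
  | succ n ih =>
    obtain ⟨C₁, h₁, H₁⟩ := ih
    obtain ⟨C₂, h₂, H₂⟩ := ckBound_coneOp (E := E) n k ρ
    obtain ⟨C₃, h₃, H₃⟩ := ckBound_wedge (E := E) n k M hM
    refine ⟨1 + N * (C₃ * (C₁ * C₂)), by positivity, ?_⟩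
    intro x₀ S φ η A hA hφ hη hN hS hM' hb
    have hs := fun v => smooth_wedge (hφ v) (smooth_corr S φ hφ (smooth_coneOp v hη))
    have b1 : ∀ v ∈ S, CkBound k (Metric.ball x₀ ρ) (C₃ * (C₁ * (C₂ * A)))
        (fun z => wedgeL E n (fderiv ℝ (φ v) z) (corr S φ n (coneOp v η) z)) := fun v hv =>
      H₃ _ _ _ _ (hφ v) (smooth_corr S φ hφ (smooth_coneOp v hη)) (hM' v hv)
        (H₁ x₀ S φ _ _ (by positivity) hφ (smooth_coneOp v hη) hN hS hM'
          (H₂ x₀ v η A hη (hS v hv) hb))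
    have b2 := (CkBound.sum S b1 fun v _ => hs v).mono
      (A' := N * (C₃ * (C₁ * (C₂ * A)))) (by gcongr)
    exact (CkBound.sub hb b2 hη (ContDiff.sum fun v _ => hs v)).mono (le_of_eq (by ring))

lemma ckBound_homotopyOp [ProperSpace E] (n k N : ℕ) (ρ M : ℝ) (hM : 0 ≤ M) :
    ∃ C, 0 ≤ C ∧ ∀ (x₀ : E) (S : Finset E) (φ : E → E → ℝ) (ω : Form E (n + 1)) (A : ℝ), 0 ≤ A →
      (∀ v, Smooth (φ v)) → Smooth ω → S.card ≤ N → (∀ v ∈ S, v ∈ Metric.ball x₀ ρ) →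
      (∀ v ∈ S, CkBound (k + 1) (Metric.ball x₀ ρ) M (φ v)) →
      CkBound k (Metric.ball x₀ ρ) A ω →
        CkBound k (Metric.ball x₀ ρ) (C * A) (homotopyOp S φ n ω) := by
  obtain ⟨C₁, h₁, H₁⟩ := ckBound_corr (E := E) n k N ρ M hM
  obtain ⟨C₂, h₂, H₂⟩ := ckBound_coneOp (E := E) n k ρ
  refine ⟨N * (2 ^ k * M * (C₁ * C₂)), by positivity, ?_⟩
  intro x₀ S φ ω A hA hφ hω hN hS hM' hb
  have b1 : ∀ v ∈ S, CkBound k (Metric.ball x₀ ρ) (2 ^ k * M * (C₁ * (C₂ * A)))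
      (fun z => φ v z • corr S φ n (coneOp v ω) z) := fun v hv =>
    ckBound_smul k (hφ v) (smooth_corr S φ hφ (smooth_coneOp v hω))
      ((hM' v hv).mono_order (Nat.le_succ k))
      (H₁ x₀ S φ _ _ (by positivity) hφ (smooth_coneOp v hω) hN hS hM'
        (H₂ x₀ v ω A hω (hS v hv) hb))
  refine (CkBound.sum S b1 fun v _ => ContDiff.smul (hφ v)
    (smooth_corr S φ hφ (smooth_coneOp v hω))).mono ?_
  calc (S.card : ℝ) * (2 ^ k * M * (C₁ * (C₂ * A))) ≤ N * (2 ^ k * M * (C₁ * (C₂ * A))) := by gcongr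
    _ = _ := by ring

lemma ckBound_dWhitney (n k N : ℕ) (M : ℝ) (hM : 0 ≤ M) :
    ∃ C, 0 ≤ C ∧ ∀ (B : Set E) (S : Finset E) (φ : E → E → ℝ) (c : (Fin n → E) → ℝ) (A : ℝ),
      0 ≤ A → (∀ v, Smooth (φ v)) → S.card ≤ N → (∀ v ∈ S, CkBound (k + 1) B M (φ v)) →
      (∀ w : Fin n → E, (∀ i, w i ∈ S) → |c w| ≤ A) → CkBound k B (C * A) (dWhitney S φ n c) := by
  induction n with
  | zero =>
    refine ⟨‖(constOfIsEmptyLIE ℝ E ℝ (Fin 0)).toLinearIsometry.toContinuousLinearMap‖,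
      norm_nonneg _, fun B S φ c A hA _ _ _ hc => ?_⟩
    refine CkBound.clm (F := ℝ) (G := E [⋀^Fin 0]→L[ℝ] ℝ) (f := fun _ : E => c ![])
      (constOfIsEmptyLIE ℝ E ℝ (Fin 0)).toLinearIsometry.toContinuousLinearMap ?_ contDiff_const
    intro j _ z _
    rcases j with _ | j
    · simpa using hc ![] fun i => i.elim0
    · rw [iteratedFDeriv_const_of_ne (by simp)]
      simpa using hA
  | succ n ih =>
    obtain ⟨C₁, h₁, H₁⟩ := ih
    obtain ⟨C₃, h₃, H₃⟩ := ckBound_wedge (E := E) n k M hM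
    refine ⟨N * (C₃ * C₁), by positivity, ?_⟩
    intro B S φ c A hA hφ hN hM' hc
    have b1 : ∀ v ∈ S, CkBound k B (C₃ * (C₁ * A)) (fun z => wedgeL E n (fderiv ℝ (φ v) z)
        (dWhitney S φ n (fun w => c (Fin.cons v w)) z)) := fun v hv =>
      H₃ _ _ _ _ (hφ v) (smooth_dWhitney S φ hφ _) (hM' v hv)
        (H₁ B S φ _ A hA hφ hN hM' fun w hw => hc _ fun i => by
          refine Fin.cases ?_ (fun i => ?_) i <;> simp [hv, hw])
    refine (CkBound.sum S b1 fun v _ => smooth_wedge (hφ v) (smooth_dWhitney S φ hφ _)).mono ?_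
    calc (S.card : ℝ) * (C₃ * (C₁ * A)) ≤ N * (C₃ * (C₁ * A)) := by gcongr
      _ = _ := by ring

lemma ckBound_whitney (n k N : ℕ) (M : ℝ) (hM : 0 ≤ M) :
    ∃ C, 0 ≤ C ∧ ∀ (B : Set E) (S : Finset E) (φ : E → E → ℝ) (c : (Fin (n + 1) → E) → ℝ) (A : ℝ),
      0 ≤ A → (∀ v, Smooth (φ v)) → S.card ≤ N → (∀ v ∈ S, CkBound (k + 1) B M (φ v)) →
      (∀ w : Fin (n + 1) → E, (∀ i, w i ∈ S) → |c w| ≤ A) →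
        CkBound k B (C * A) (whitney S φ n c) := by
  obtain ⟨C₁, h₁, H₁⟩ := ckBound_dWhitney (E := E) n k N M hM
  refine ⟨N * (2 ^ k * M * C₁), by positivity, ?_⟩
  intro B S φ c A hA hφ hN hM' hc
  have b1 : ∀ v ∈ S, CkBound k B (2 ^ k * M * (C₁ * A))
      (fun z => φ v z • dWhitney S φ n (fun w => c (Fin.cons v w)) z) := fun v hv =>
    ckBound_smul k (hφ v) (smooth_dWhitney S φ hφ _) ((hM' v hv).mono_order (Nat.le_succ k))
      (H₁ B S φ _ A hA hφ hN hM' fun w hw => hc _ fun i => by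
        refine Fin.cases ?_ (fun i => ?_) i <;> simp [hv, hw])
  refine (CkBound.sum S b1 fun v _ => ContDiff.smul (hφ v) (smooth_dWhitney S φ hφ _)).mono ?_
  calc (S.card : ℝ) * (2 ^ k * M * (C₁ * A)) ≤ N * (2 ^ k * M * (C₁ * A)) := by gcongr
    _ = _ := by ring

end operatorBounds

end operators

/-! ### Integration over simplices -/

section simplex

/-- The simplex `{s | 0 ≤ s i, ∑ s i ≤ 1}`. -/
def cornerSimplex (n : ℕ) : Set (Fin n → ℝ) := {s | (∀ i, 0 ≤ s i) ∧ ∑ i, s i ≤ 1}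

lemma isClosed_cornerSimplex (n : ℕ) : IsClosed (cornerSimplex n) := by
  have : cornerSimplex n = (⋂ i, {s | 0 ≤ s i}) ∩ {s | ∑ i, s i ≤ 1} := by
    ext s
    simp [cornerSimplex]
  rw [this]
  refine IsClosed.inter (isClosed_iInter fun i => ?_) ?_
  · exact isClosed_le continuous_const (continuous_apply i)
  · exact isClosed_le (continuous_finsetSum _ fun i _ => continuous_apply i) continuous_const

lemma cornerSimplex_subset_Icc (n : ℕ) : cornerSimplex n ⊆ Icc 0 1 := by
  rintro s ⟨h0, h1⟩
  refine ⟨h0, fun i => ?_⟩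
  exact (Finset.single_le_sum (fun j _ => h0 j) (Finset.mem_univ i)).trans h1

lemma isCompact_cornerSimplex (n : ℕ) : IsCompact (cornerSimplex n) :=
  isCompact_Icc.of_isClosed_subset (isClosed_cornerSimplex n) (cornerSimplex_subset_Icc n)

lemma measurableSet_cornerSimplex (n : ℕ) : MeasurableSet (cornerSimplex n) :=
  (isClosed_cornerSimplex n).measurableSet

/-- Replacing the zeroth coordinate by the total sum `t` exhibits the simplex as a family of slices,
each the `t`-multiple of the simplex of one dimension less. -/
lemma cons_mem_cornerSimplex {n : ℕ} (t : ℝ) (b : Fin n → ℝ) :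
    (Fin.cons (t - ∑ i, b i) b : Fin (n + 1) → ℝ) ∈ cornerSimplex (n + 1) ↔
      (∀ i, 0 ≤ b i) ∧ ∑ i, b i ≤ t ∧ t ≤ 1 := by
  simp only [cornerSimplex, mem_ofPred_eq, Fin.forall_fin_succ, Fin.cons_zero, Fin.cons_succ,
    Fin.sum_univ_succ, sub_add_cancel, sub_nonneg]
  tauto

/-- Integration over a simplex as iterated integration over the opposite face and along the rays
from a vertex. -/
lemma integral_cornerSimplex_succ {n : ℕ} {f : (Fin (n + 1) → ℝ) → ℝ} (hf : Continuous f) :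
    ∫ u in cornerSimplex (n + 1), f u =
      ∫ s in cornerSimplex n, ∫ t in (0 : ℝ)..1,
        t ^ n * f (Fin.cons (t - ∑ i, t * s i) (t • s)) := by
  set F := (cornerSimplex (n + 1)).indicator f
  have hcons : Continuous fun p : ℝ × (Fin n → ℝ) =>
      (Fin.cons (p.1 - ∑ i, p.2 i) p.2 : Fin (n + 1) → ℝ) := by
    refine Continuous.finCons ?_ continuous_snd
    exact continuous_fst.sub (continuous_finsetSum _ fun i _ => (continuous_apply i).comp
      continuous_snd)
  have hFint : Integrable F := by
    rw [integrable_indicator_iff (measurableSet_cornerSimplex _)]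
    exact hf.continuousOn.integrableOn_compact (isCompact_cornerSimplex _)
  have hmp := (volume_preserving_piFinSuccAbove (fun _ : Fin (n + 1) => ℝ) 0).symm
  have e1 : ∫ u, F u = ∫ p : ℝ × (Fin n → ℝ), F (Fin.cons p.1 p.2) := by
    rw [← hmp.integral_comp (MeasurableEquiv.measurableEmbedding _)]
    refine integral_congr_ae (Eventually.of_forall fun p => ?_)
    simp [MeasurableEquiv.piFinSuccAbove, Fin.insertNthEquiv]
  have hi1 : Integrable fun p : ℝ × (Fin n → ℝ) => F (Fin.cons p.1 p.2) := by
    have := (hmp.integrable_comp_emb (MeasurableEquiv.measurableEmbedding _)).2 hFint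
    refine this.congr (Eventually.of_forall fun p => ?_)
    simp [MeasurableEquiv.piFinSuccAbove, Fin.insertNthEquiv]
  set C : Set (ℝ × (Fin n → ℝ)) :=
    {p | (Fin.cons (p.1 - ∑ i, p.2 i) p.2 : Fin (n + 1) → ℝ) ∈ cornerSimplex (n + 1)}
  have hC : IsClosed C := (isClosed_cornerSimplex _).preimage hcons
  have hCc : IsCompact C := by
    refine (isCompact_Icc (a := ((0 : ℝ), (0 : Fin n → ℝ))) (b := (1, 1))).of_isClosed_subset hC ?_
    rintro ⟨t, b⟩ hp
    have hp := (cons_mem_cornerSimplex t b).1 hp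
    have hb : ∀ i, b i ≤ 1 := fun i =>
      ((Finset.single_le_sum (fun j _ => hp.1 j) (Finset.mem_univ i)).trans hp.2.1).trans hp.2.2
    exact ⟨⟨(Finset.sum_nonneg fun i _ => hp.1 i).trans hp.2.1, hp.1⟩, ⟨hp.2.2, hb⟩⟩
  have hi2 : Integrable fun p : ℝ × (Fin n → ℝ) => F (Fin.cons (p.1 - ∑ i, p.2 i) p.2) := by
    have : (fun p : ℝ × (Fin n → ℝ) => F (Fin.cons (p.1 - ∑ i, p.2 i) p.2)) =
        C.indicator fun p => f (Fin.cons (p.1 - ∑ i, p.2 i) p.2) := by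
      funext p
      rfl
    rw [this, integrable_indicator_iff hC.measurableSet]
    exact (hf.comp hcons).continuousOn.integrableOn_compact hCc
  -- On the slice of height `t` the substitution `b = t • s` has Jacobian `t ^ n`. It degenerates at
  -- `t = 0`, a null set.
  have inner : ∀ t : ℝ, t ≠ 0 → ∫ b : Fin n → ℝ, F (Fin.cons (t - ∑ i, b i) b) =
      (Ioc (0 : ℝ) 1).indicator (fun t => ∫ s in cornerSimplex n,
        t ^ n * f (Fin.cons (t - ∑ i, t * s i) (t • s))) t := by
    intro t ht
    by_cases h : t ∈ Ioc (0 : ℝ) 1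
    · rw [indicator_of_mem h]
      have hs := Measure.integral_comp_smul (volume : Measure (Fin n → ℝ))
        (fun b => F (Fin.cons (t - ∑ i, b i) b)) t
      have htn : 0 < t ^ n := pow_pos h.1 n
      rw [Module.finrank_fintype_fun_eq_card, Fintype.card_fin, abs_of_pos (inv_pos.2 htn),
        smul_eq_mul, eq_inv_mul_iff_mul_eq₀ htn.ne'] at hs
      rw [← hs, ← integral_const_mul, ← integral_indicator (measurableSet_cornerSimplex n)]
      refine integral_congr_ae (Eventually.of_forall fun s => ?_)
      have key : (Fin.cons (t - ∑ i, (t • s) i) (t • s) : Fin (n + 1) → ℝ) ∈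
          cornerSimplex (n + 1) ↔ s ∈ cornerSimplex n := by
        rw [cons_mem_cornerSimplex]
        simp only [Pi.smul_apply, smul_eq_mul, ← Finset.mul_sum, h.2, and_true,
          mul_nonneg_iff_of_pos_left h.1, mul_le_iff_le_one_right h.1]
        rfl
      dsimp only
      by_cases hs : s ∈ cornerSimplex n
      · rw [indicator_of_mem hs, show F _ = f _ from indicator_of_mem (key.2 hs) f]
        rfl
      · rw [indicator_of_notMem hs, show F _ = 0 from indicator_of_notMem (fun h => hs (key.1 h)) f,
          mul_zero]
    · rw [indicator_of_notMem h]
      have : ∀ b : Fin n → ℝ, F (Fin.cons (t - ∑ i, b i) b) = 0 := by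
        intro b
        refine indicator_of_notMem (fun hb => h ?_) f
        rw [cons_mem_cornerSimplex] at hb
        exact ⟨lt_of_le_of_ne ((Finset.sum_nonneg fun i _ => hb.1 i).trans hb.2.1) ht.symm,
          hb.2.2⟩
      simp [this]
  rw [← integral_indicator (measurableSet_cornerSimplex _), e1, Measure.volume_eq_prod,
    integral_prod_symm _ hi1]
  -- The shear that introduces the total sum as a coordinate is, for fixed `b`, a translation of the
  -- zeroth coordinate.
  have e2 : ∀ b : Fin n → ℝ, ∫ a : ℝ, F (Fin.cons a b) = ∫ t : ℝ, F (Fin.cons (t - ∑ i, b i) b) :=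
    fun b => (integral_sub_right_eq_self (fun a => F (Fin.cons a b)) (∑ i, b i)).symm
  simp only [e2]
  rw [← integral_prod_symm _ hi2, integral_prod _ hi2]
  have h0 : ∀ᵐ t : ℝ, t ≠ 0 := by
    rw [ae_iff]
    simp
  rw [integral_congr_ae (h0.mono fun t ht => inner t ht),
    integral_indicator measurableSet_Ioc, integral_integral_swap]
  · simp only [intervalIntegral.integral_of_le zero_le_one]
  · rw [Measure.prod_restrict]
    have hc : Continuous (Function.uncurry fun (t : ℝ) (s : Fin n → ℝ) =>
        t ^ n * f (Fin.cons (t - ∑ i, t * s i) (t • s))) := by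
      have : Continuous fun p : ℝ × (Fin n → ℝ) =>
          (Fin.cons (p.1 - ∑ i, p.1 * p.2 i) (p.1 • p.2) : Fin (n + 1) → ℝ) := by
        refine Continuous.finCons ?_ (by fun_prop)
        fun_prop
      exact (continuous_fst.pow n).mul (hf.comp this)
    exact (hc.continuousOn.integrableOn_compact
      (isCompact_Icc.prod (isCompact_cornerSimplex n))).mono_set
        (prod_mono Ioc_subset_Icc_self subset_rfl)

variable {d : ℕ}

/-- Evaluation of an alternating form at a tuple, as a continuous linear functional. -/
def evalForm {n : ℕ} (w : Fin n → Space d) : (Space d [⋀^Fin n]→L[ℝ] ℝ) →L[ℝ] ℝ where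
  toFun A := A w
  map_add' _ _ := rfl
  map_smul' _ _ := rfl
  cont := continuous_eval_const w

/-- Adding multiples of one entry to the other entries. -/
lemma map_add_smul_entry {n : ℕ} (A : Space d [⋀^Fin n]→L[ℝ] ℝ) (a : Fin n → Space d) (j : Fin n)
    (c : Fin n → ℝ) (hc : c j = 0) : A (fun i => a i + c i • a j) = A a := by
  have : (fun i => a i + c i • a j) = a + fun i => c i • a j := rfl
  -- In the multilinear expansion every mixed term vanishes: either the entry `j` is kept and
  -- another entry is a multiple of it, or the entry `j` is replaced by `c j • a j = 0`.
  rw [this, A.map_add_univ, Finset.sum_eq_single Finset.univ]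
  · simp
  · intro S _ hS
    obtain ⟨i, hi⟩ : ∃ i, i ∉ S := by
      by_contra h
      push Not at h
      exact hS (Finset.eq_univ_iff_forall.2 h)
    by_cases hj : j ∈ S
    · set P := S.piecewise a fun i => c i • a j
      have hPi : P i = c i • a j := Finset.piecewise_eq_of_notMem _ _ _ hi
      have hPj : P j = a j := Finset.piecewise_eq_of_mem _ _ _ hj
      have hij : i ≠ j := fun h => hi (h ▸ hj)
      have : P = Function.update P i (c i • P j) := by
        rw [hPj, ← hPi, Function.update_eq_self]
      rw [this, A.map_update_smul]
      have h0 := A.toAlternatingMap.map_update_self P hij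
      rw [show A (Function.update P i (P j)) = 0 from h0, smul_zero]
    · refine A.toAlternatingMap.map_coord_zero j ?_
      rw [Finset.piecewise_eq_of_notMem _ _ _ hj, hc, zero_smul]
  · simp

/-- A point of the face opposite to the apex and the edges of that face span the same volume element
as the edges from the apex. This matches the cone integrand with the simplex integrand. -/
lemma map_cons_combination {n : ℕ} (A : Space d [⋀^Fin (n + 1)]→L[ℝ] ℝ) (a : Space d)
    (b : Fin n → Space d) (s : Fin n → ℝ) :
    A (Matrix.vecCons (a + ∑ i, s i • (b i - a)) fun i => b i - a) = A (Matrix.vecCons a b) := by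
  have h1 : A (Matrix.vecCons (a + ∑ i, s i • (b i - a)) fun i => b i - a) =
      A (Matrix.vecCons a fun i => b i - a) := by
    have : ∀ y : Space d, A (Matrix.vecCons y fun i => b i - a) =
        evalForm (fun i => b i - a) (A.curryLeft y) := fun y => rfl
    rw [this, this, map_add, map_add, _root_.map_sum, _root_.map_sum, Finset.sum_eq_zero, add_zero]
    intro i _
    rw [map_smul, map_smul, ← this]
    have : A (Matrix.vecCons (b i - a) fun i => b i - a) = 0 :=
      A.map_eq_zero_of_eq _ (i := 0) (j := i.succ) (by simp) (Fin.succ_ne_zero i).symm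
    rw [this, smul_zero]
  -- The coefficients `0, -1, …, -1` subtract `a` from all entries but the zeroth.
  rw [h1, ← map_add_smul_entry A (Matrix.vecCons a b) 0 (Fin.cons 0 fun _ => -1) rfl]
  congr 1
  funext i
  refine Fin.cases ?_ (fun i => ?_) i
  · simp
  · simp [sub_eq_add_neg]

/-- The simplex is the cone from `v 0` over the opposite face, and the weight `t ^ n` of the radial
integration is exactly that of the cone operator. -/
lemma simplexIntegral_succ {n : ℕ} {ω : Form (Space d) (n + 1)} (hω : Smooth ω)
    (v : Fin (n + 2) → Space d) :
    simplexIntegral ω v = simplexIntegral (coneOp (v 0) ω) (Fin.tail v) := by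
  have hc : Continuous fun s : Fin (n + 1) → ℝ =>
      ω (v 0 + ∑ i, s i • (v i.succ - v 0)) (fun i => v i.succ - v 0) := by
    have h1 : Continuous fun s : Fin (n + 1) → ℝ => v 0 + ∑ i, s i • (v i.succ - v 0) := by fun_prop
    exact (evalForm _).continuous.comp (hω.continuous.comp h1)
  refine (integral_cornerSimplex_succ hc).trans ?_
  refine setIntegral_congr_fun (measurableSet_cornerSimplex n) fun s _ => ?_
  set y : Space d := Fin.tail v 0 + ∑ i, s i • (Fin.tail v i.succ - Fin.tail v 0) with hy
  have hint := intervalIntegrable_coneIntegrand (v 0) hω y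
  have e := (evalForm fun i => Fin.tail v i.succ - Fin.tail v 0).intervalIntegral_comp_comm hint
  refine Eq.trans ?_ e
  refine intervalIntegral.integral_congr fun t _ => ?_
  change _ = t ^ n * ω (v 0 + t • (y - v 0)) (Matrix.vecCons (y - v 0) _)
  have hy0 : y - v 0 = (v 1 - v 0) +
      ∑ i : Fin n, s i • ((v i.succ.succ - v 0) - (v 1 - v 0)) := by
    rw [hy]
    simp only [Fin.tail, Fin.succ_zero_eq_one, sub_sub_sub_cancel_right]
    abel
  have hp : v 0 + ∑ i, (Fin.cons (t - ∑ i, t * s i) (t • s) : Fin (n + 1) → ℝ) i •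
      (v i.succ - v 0) = v 0 + t • (y - v 0) := by
    rw [hy0, Fin.sum_univ_succ]
    simp only [Fin.cons_zero, Fin.cons_succ, Fin.succ_zero_eq_one, Pi.smul_apply, smul_eq_mul,
      smul_add, Finset.smul_sum, smul_sub, sub_smul, Finset.sum_smul, Finset.sum_sub_distrib,
      mul_smul]
    abel
  rw [hp, hy0]
  have h2 : (fun i : Fin n => Fin.tail v i.succ - Fin.tail v 0) =
      fun i => (v i.succ.succ - v 0) - (v 1 - v 0) := by
    funext i
    simp [Fin.tail]
  rw [h2, map_cons_combination]
  congr 2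
  funext i
  refine Fin.cases ?_ (fun i => ?_) i <;> simp

lemma coneIntegral_eq_simplexIntegral {n : ℕ} {ω : Form (Space d) n} (hω : Smooth ω)
    (v : Fin (n + 1) → Space d) : coneIntegral n ω v = simplexIntegral ω v := by
  induction n with
  | zero =>
    -- The parameter domain in dimension zero is a single point of mass one.
    have hset : {s : Fin 0 → ℝ | (∀ i, 0 ≤ s i) ∧ ∑ i, s i ≤ 1} = univ := by
      ext s
      simp
    rw [simplexIntegral, hset, setIntegral_univ, volume_pi,
      Measure.pi_of_empty (fun _ : Fin 0 => volume) 0, integral_dirac, coneIntegral]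
    simp only [Finset.univ_eq_empty, Finset.sum_empty, add_zero]
    congr 1
    exact Subsingleton.elim _ _
  | succ n ih => rw [simplexIntegral_succ hω, coneIntegral, ih (smooth_coneOp _ hω)]

/-! #### Permutations of the vertices -/

/-- The affine involution of the simplex which exchanges the vertex `0` with the `j`-th one. -/
def exchange {n : ℕ} (j : Fin n) (s : Fin n → ℝ) : Fin n → ℝ := Function.update s j (1 - ∑ i, s i)

lemma sum_exchange {n : ℕ} (j : Fin n) (s : Fin n → ℝ) : ∑ i, exchange j s i = 1 - s j := by
  rw [exchange, Finset.sum_update_of_mem (Finset.mem_univ j), ← Finset.erase_eq,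
    ← Finset.add_sum_erase _ _ (Finset.mem_univ j)]
  ring

lemma exchange_exchange {n : ℕ} (j : Fin n) (s : Fin n → ℝ) : exchange j (exchange j s) = s := by
  have h := sum_exchange j s
  rw [exchange, h, exchange, Function.update_idem]
  simp

lemma exchange_preimage {n : ℕ} (j : Fin n) : exchange j ⁻¹' cornerSimplex n = cornerSimplex n := by
  have key : ∀ s ∈ cornerSimplex n, exchange j s ∈ cornerSimplex n := by
    rintro s ⟨h0, h1⟩
    refine ⟨fun i => ?_, ?_⟩
    · rcases eq_or_ne i j with rfl | h
      · simp [exchange, h1]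
      · simp [exchange, h, h0]
    · rw [sum_exchange]
      linarith [h0 j]
  ext s
  exact ⟨fun h => exchange_exchange j s ▸ key _ h, key s⟩

/-- The map is a translation after a linear involution, and an involution has determinant `1` or
`-1`. -/
lemma measurePreserving_exchange {n : ℕ} (j : Fin n) : MeasurePreserving (exchange j) := by
  let L : (Fin n → ℝ) →ₗ[ℝ] (Fin n → ℝ) :=
    { toFun := fun s => Function.update s j (-∑ i, s i)
      map_add' := fun s t => by
        rw [← Function.update_add]
        simp [Finset.sum_add_distrib, add_comm]
      map_smul' := fun a s => by
        rw [RingHom.id_apply, ← Function.update_smul]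
        simp [Finset.mul_sum] }
  have hsum : ∀ s, ∑ i, L s i = -s j := by
    intro s
    change ∑ i, Function.update s j (-∑ i, s i) i = _
    rw [Finset.sum_update_of_mem (Finset.mem_univ j), ← Finset.erase_eq,
      ← Finset.add_sum_erase _ _ (Finset.mem_univ j)]
    ring
  have hL : L ∘ₗ L = LinearMap.id := by
    refine LinearMap.ext fun s => ?_
    change Function.update (L s) j (-∑ i, L s i) = s
    rw [hsum]
    change Function.update (Function.update s j _) j _ = s
    simp
  have hdet : LinearMap.det L * LinearMap.det L = 1 := by
    rw [← LinearMap.det_comp, hL, LinearMap.det_id]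
  have habs : |(LinearMap.det L)⁻¹| = 1 := by
    rcases mul_self_eq_one_iff.1 hdet with h | h <;> simp [h]
  have hne : LinearMap.det L ≠ 0 := fun h => by simp [h] at hdet
  have hmL : MeasurePreserving L := by
    refine ⟨L.continuous_of_finiteDimensional.measurable, ?_⟩
    rw [Measure.map_linearMap_addHaar_eq_smul_addHaar _ hne, habs]
    simp
  have := (measurePreserving_add_right (volume : Measure (Fin n → ℝ)) (Pi.single j 1)).comp hmL
  have he : exchange j = (fun x => x + Pi.single j 1) ∘ L := by
    funext s
    change Function.update s j _ = Function.update s j _ + Pi.single j 1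
    rw [Pi.single, ← Function.update_add]
    simp only [add_zero]
    congr 1
    ring
  rw [he]
  exact this

/-- The substitution `exchange j` identifies the two affine parametrizations. The new edge vectors
arise by adding multiples of the `j`-th edge to the others, which changes nothing, and by reversing
the `j`-th edge, which gives the sign. -/
lemma simplexIntegral_swap_zero {n : ℕ} (ω : Form (Space d) n) (v : Fin (n + 1) → Space d)
    (j : Fin n) :
    simplexIntegral ω (v ∘ Equiv.swap 0 j.succ) = -simplexIntegral ω v := by
  have hemb : MeasurableEmbedding (exchange j) := by
    have hm := (measurePreserving_exchange j).measurable
    exact (MeasurableEquiv.mk ⟨exchange j, exchange j, exchange_exchange j, exchange_exchange j⟩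
      hm hm).measurableEmbedding
  have e := (measurePreserving_exchange j).setIntegral_preimage_emb hemb
    (fun s => ω (v 0 + ∑ i, s i • (v i.succ - v 0)) (fun i => v i.succ - v 0)) (cornerSimplex n)
  rw [exchange_preimage] at e
  change _ = -∫ s in cornerSimplex n, _
  rw [← e, ← integral_neg]
  refine setIntegral_congr_fun (measurableSet_cornerSimplex n) fun s _ => ?_
  have hs : ∀ i : Fin n, i ≠ j → Equiv.swap 0 j.succ i.succ = i.succ := fun i hi =>
    Equiv.swap_apply_of_ne_of_ne (Fin.succ_ne_zero i) (fun h => hi (Fin.succ_injective _ h))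
  dsimp only [Function.comp]
  rw [Equiv.swap_apply_left]
  have hpt : v j.succ + ∑ i : Fin n, s i • (v (Equiv.swap 0 j.succ i.succ) - v j.succ) =
      v 0 + ∑ i, exchange j s i • (v i.succ - v 0) := by
    rw [← Finset.add_sum_erase _ _ (Finset.mem_univ j),
      ← Finset.add_sum_erase (a := j) (s := Finset.univ) (h := Finset.mem_univ j)
        (f := fun i => exchange j s i • (v i.succ - v 0))]
    rw [Equiv.swap_apply_right]
    have h1 : ∑ i ∈ Finset.univ.erase j, s i • (v (Equiv.swap 0 j.succ i.succ) - v j.succ) =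
        ∑ i ∈ Finset.univ.erase j, s i • (v i.succ - v 0) -
          (∑ i ∈ Finset.univ.erase j, s i) • (v j.succ - v 0) := by
      rw [Finset.sum_smul, ← Finset.sum_sub_distrib]
      refine Finset.sum_congr rfl fun i hi => ?_
      rw [hs i (Finset.ne_of_mem_erase hi)]
      module
    have h2 : ∑ i ∈ Finset.univ.erase j, exchange j s i • (v i.succ - v 0) =
        ∑ i ∈ Finset.univ.erase j, s i • (v i.succ - v 0) := by
      refine Finset.sum_congr rfl fun i hi => ?_
      simp [exchange, Finset.ne_of_mem_erase hi]
    have h3 : exchange j s j = 1 - s j - ∑ i ∈ Finset.univ.erase j, s i := by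
      rw [exchange, Function.update_self, ← Finset.add_sum_erase _ _ (Finset.mem_univ j)]
      ring
    rw [h1, h2, h3]
    module
  rw [hpt]
  generalize ω (v 0 + ∑ i, exchange j s i • (v i.succ - v 0)) = A
  have hv : (fun i : Fin n => v (Equiv.swap 0 j.succ i.succ) - v j.succ) =
      Function.update (fun i => (v i.succ - v 0) + (if i = j then (0 : ℝ) else -1) •
        (v j.succ - v 0)) j ((-1 : ℝ) • (v j.succ - v 0)) := by
    funext i
    rcases eq_or_ne i j with rfl | hi
    · simp
    · simp [hi, hs i hi]
  rw [hv, A.map_update_smul, ← map_add_smul_entry A (fun i => v i.succ - v 0) j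
    (fun i => if i = j then (0 : ℝ) else -1) (by simp), neg_one_smul]
  congr 2
  funext i
  rcases eq_or_ne i j with rfl | hi <;> simp [*]

/-- Permuting the coordinates of the parameter space preserves the domain and its measure; the sign
comes from the alternating form alone. -/
lemma simplexIntegral_swap_succ {n : ℕ} (ω : Form (Space d) n) (v : Fin (n + 1) → Space d)
    {i j : Fin n} (hij : i ≠ j) :
    simplexIntegral ω (v ∘ Equiv.swap i.succ j.succ) = -simplexIntegral ω v := by
  set τ := Equiv.swap i j
  have hτ : ∀ k, (Equiv.swap i.succ j.succ) k.succ = (τ k).succ := fun k =>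
    congrFun ((Fin.succ_injective n).swap_comp i j) k
  have h0 : (Equiv.swap i.succ j.succ) 0 = 0 :=
    Equiv.swap_apply_of_ne_of_ne (Fin.succ_ne_zero i).symm (Fin.succ_ne_zero j).symm
  have hmp := volume_measurePreserving_piCongrLeft (fun _ : Fin n => ℝ) τ
  have h : ∀ s k, (MeasurableEquiv.piCongrLeft (fun _ : Fin n => ℝ) τ) s k = s (τ.symm k) := by
    intro s k
    have := MeasurableEquiv.piCongrLeft_apply_apply (β := fun _ : Fin n => ℝ) τ s (τ.symm k)
    rwa [τ.apply_symm_apply] at this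
  have hpre : (MeasurableEquiv.piCongrLeft (fun _ : Fin n => ℝ) τ) ⁻¹' cornerSimplex n =
      cornerSimplex n := by
    ext s
    simp only [mem_preimage, cornerSimplex, mem_ofPred_eq, h, Equiv.sum_comp τ.symm s]
    rw [τ.symm.forall_congr_left]
    simp
  have e := hmp.setIntegral_preimage_emb (MeasurableEquiv.measurableEmbedding _)
    (fun s => ω (v 0 + ∑ i, s i • (v i.succ - v 0)) (fun i => v i.succ - v 0)) (cornerSimplex n)
  rw [hpre] at e
  change _ = -∫ s in cornerSimplex n, _
  rw [← e, ← integral_neg]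
  refine setIntegral_congr_fun (measurableSet_cornerSimplex n) fun s _ => ?_
  dsimp only [Function.comp]
  simp only [h0, hτ]

  have hs : ∑ k, s k • (v (τ k).succ - v 0) =
      ∑ k, (MeasurableEquiv.piCongrLeft (fun _ : Fin n => ℝ) τ) s k • (v k.succ - v 0) := by
    rw [← Equiv.sum_comp τ (fun k =>
      (MeasurableEquiv.piCongrLeft (fun _ : Fin n => ℝ) τ) s k • (v k.succ - v 0))]
    refine Finset.sum_congr rfl fun k _ => ?_
    have hk := h s (τ k)
    rw [τ.symm_apply_apply] at hk
    exact congrArg (· • (v (τ k).succ - v 0)) hk.symm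
  rw [hs]
  exact AlternatingMap.map_swap
    (ω (v 0 + ∑ k, (MeasurableEquiv.piCongrLeft (fun _ : Fin n => ℝ) τ) s k •
      (v k.succ - v 0))).toAlternatingMap (fun i => v i.succ - v 0) hij

end simplex

/-! ### Alternating cochains -/

section alternating

variable {V : Type*} {m n : ℕ}

/-- A function of tuples which changes its sign if two entries are exchanged. -/
def IsAlternating (c : (Fin m → V) → ℝ) : Prop :=
  ∀ (w : Fin m → V) (i j : Fin m), i ≠ j → c (w ∘ Equiv.swap i j) = -c w

lemma IsAlternating.comp_perm {c : (Fin m → V) → ℝ} (hc : IsAlternating c) (w : Fin m → V)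
    (π : Equiv.Perm (Fin m)) : c (w ∘ π) = ((Equiv.Perm.sign π : ℤ) : ℝ) * c w := by
  induction π using Equiv.Perm.swap_induction_on' with
  | one => simp
  | mul_swap f i j hij ih =>
    rw [Equiv.Perm.coe_mul, ← Function.comp_assoc, hc _ i j hij, ih, Equiv.Perm.sign_mul,
      Equiv.Perm.sign_swap hij]
    simp

lemma isAlternating_of_adjacent {c : (Fin (m + 1) → V) → ℝ}
    (h : ∀ (w : Fin (m + 1) → V) (i : Fin m), c (w ∘ Equiv.swap i.castSucc i.succ) = -c w) :
    IsAlternating c := by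
  have key : ∀ (π : Equiv.Perm (Fin (m + 1))) (w : Fin (m + 1) → V),
      c (w ∘ π) = ((Equiv.Perm.sign π : ℤ) : ℝ) * c w := by
    intro π
    have hπ : π ∈ Submonoid.closure
        (Set.range fun i : Fin m => Equiv.swap i.castSucc i.succ) := by
      rw [Equiv.Perm.mclosure_swap_castSucc_succ]
      trivial
    induction hπ using Submonoid.closure_induction with
    | mem x hx =>
      obtain ⟨i, rfl⟩ := hx
      intro w
      rw [h w i, Equiv.Perm.sign_swap Fin.castSucc_lt_succ.ne]
      simp
    | one => intro w; simp
    | mul x y _ _ hx hy =>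
      intro w
      rw [Equiv.Perm.coe_mul, ← Function.comp_assoc, hy, hx, Equiv.Perm.sign_mul]
      push_cast
      ring
  intro w i j hij
  rw [key, Equiv.Perm.sign_swap hij]
  simp

lemma IsAlternating.eq_zero {c : (Fin m → V) → ℝ} (hc : IsAlternating c) {w : Fin m → V}
    (hw : ¬ Function.Injective w) : c w = 0 := by
  simp only [Function.Injective, not_forall] at hw
  obtain ⟨i, j, hij, hne⟩ := hw
  have h : w ∘ Equiv.swap i j = w := by
    funext k
    rcases eq_or_ne k i with rfl | hi
    · simp [hij]
    rcases eq_or_ne k j with rfl | hj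
    · simp [hij]
    · simp [Equiv.swap_apply_of_ne_of_ne hi hj]
  have := hc w i j hne
  rw [h] at this
  linarith

/-- An adjacent transposition turns the enumeration that omits one of the two indices into the one
that omits the other, without reordering the rest. -/
lemma swap_comp_succAbove_castSucc (i : Fin (n + 1)) :
    Equiv.swap i.castSucc i.succ ∘ i.succ.succAbove = i.castSucc.succAbove := by
  funext k
  rcases lt_trichotomy k i with h | rfl | h
  · rw [Function.comp_apply, Fin.succAbove_castSucc_of_lt _ _ h,
      Fin.succAbove_succ_of_le _ _ h.le]
    exact Equiv.swap_apply_of_ne_of_ne (Fin.castSucc_lt_castSucc_iff.2 h).ne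
      (Fin.castSucc_lt_succ_iff.2 h.le).ne
  · rw [Function.comp_apply, Fin.succAbove_castSucc_self, Fin.succAbove_succ_self,
      Equiv.swap_apply_left]
  · rw [Function.comp_apply, Fin.succAbove_castSucc_of_le _ _ h.le,
      Fin.succAbove_succ_of_lt _ _ h]
    exact Equiv.swap_apply_of_ne_of_ne (Fin.castSucc_lt_succ_iff.2 h.le).ne'
      (Fin.succ_lt_succ_iff.2 h).ne'

/-- The coboundary of an alternating cochain is alternating. -/
lemma IsAlternating.coboundary {b : (Fin (n + 1) → V) → ℝ} (hb : IsAlternating b) :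
    IsAlternating (coboundary n b) := by
  refine isAlternating_of_adjacent fun w i => ?_
  set τ := Equiv.swap i.castSucc i.succ
  -- The adjacent transposition exchanges the faces opposite to its two indices, whose signs in the
  -- coboundary are opposite. On any other face it acts as a transposition of two vertices, and the
  -- sign comes from `b`.
  have hval : ∀ j : Fin (n + 2), (-1 : ℝ) ^ ((τ j : Fin (n + 2)) : ℕ) *
      b ((w ∘ τ) ∘ (τ j).succAbove) = -((-1 : ℝ) ^ (j : ℕ) * b (w ∘ j.succAbove)) := by
    intro j
    by_cases h1 : j = i.castSucc
    · subst h1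
      rw [Equiv.swap_apply_left, Function.comp_assoc, swap_comp_succAbove_castSucc]
      simp [pow_succ]
    by_cases h2 : j = i.succ
    · subst h2
      rw [Equiv.swap_apply_right, Function.comp_assoc, ← swap_comp_succAbove_castSucc,
        ← Function.comp_assoc τ]
      have : (τ : Fin (n + 2) → Fin (n + 2)) ∘ τ = id := by
        funext k
        simp [τ]
      rw [this]
      simp [pow_succ]
    · have hj : τ j = j := Equiv.swap_apply_of_ne_of_ne h1 h2
      obtain ⟨p, hp⟩ := Fin.exists_succAbove_eq (Ne.symm h1)
      obtain ⟨q, hq⟩ := Fin.exists_succAbove_eq (Ne.symm h2)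
      have hpq : p ≠ q := by
        rintro rfl
        exact Fin.castSucc_lt_succ.ne (hp.symm.trans hq)
      have hcomm : (τ : Fin (n + 2) → Fin (n + 2)) ∘ j.succAbove =
          j.succAbove ∘ Equiv.swap p q := by
        have := (Fin.succAbove_right_injective (p := j)).swap_comp p q
        rw [hp, hq] at this
        exact this
      rw [hj, Function.comp_assoc, hcomm, ← Function.comp_assoc, hb _ p q hpq]
      ring
  unfold PVTiling.coboundary
  rw [← Equiv.sum_comp τ, ← Finset.sum_neg_distrib]
  exact Finset.sum_congr rfl fun j _ => hval j

/-- The alternating cochain obtained by summing over all orders of a tuple. -/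
def alternation (c : (Fin m → V) → ℝ) (w : Fin m → V) : ℝ :=
  ∑ π : Equiv.Perm (Fin m), ((Equiv.Perm.sign π : ℤ) : ℝ) * c (w ∘ π)

lemma isAlternating_alternation (c : (Fin m → V) → ℝ) : IsAlternating (alternation c) := by
  intro w i j hij
  unfold alternation
  rw [← Equiv.sum_comp (Equiv.mulLeft (Equiv.swap i j)), ← Finset.sum_neg_distrib]
  refine Finset.sum_congr rfl fun π _ => ?_
  rw [Equiv.coe_mulLeft, Equiv.Perm.sign_mul, Equiv.Perm.sign_swap hij, Function.comp_assoc,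
    ← Equiv.Perm.coe_mul, ← mul_assoc, Equiv.swap_mul_self, one_mul]
  simp

lemma IsAlternating.cons {c : (Fin (n + 1) → V) → ℝ} (hc : IsAlternating c) (v : V) :
    IsAlternating fun u : Fin n → V => c (Fin.cons v u) := by
  intro u i j hij
  dsimp only
  rw [← hc (Fin.cons v u) i.succ j.succ (fun h => hij (Fin.succ_injective _ h))]
  congr 1
  funext k
  refine Fin.cases ?_ (fun k => ?_) k
  · rw [Function.comp_apply, Equiv.swap_apply_of_ne_of_ne (Fin.succ_ne_zero i).symm
      (Fin.succ_ne_zero j).symm]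
    simp
  · have := congrFun ((Fin.succ_injective n).swap_comp i j) k
    simp only [Function.comp_apply] at this
    rw [Function.comp_apply, this]
    simp

/-- The coboundary of `c` at `(w 0, u)` is zero: this tuple has `n + 3` entries taken from the at
most `n + 2` values of `w`, so one is repeated. Expanding it shows that on a single simplex every
alternating cochain of top degree is a coboundary, by coning from a vertex. -/
lemma IsAlternating.eq_coboundary_cons {c : (Fin (n + 2) → V) → ℝ} (hc : IsAlternating c)
    (w : Fin (n + 2) → V) {u : Fin (n + 2) → V} (hu : ∀ i, u i ∈ Set.range w) :
    c u = PVTiling.coboundary n (fun x => c (Fin.cons (w 0) x)) u := by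
  have h0 : PVTiling.coboundary (n + 1) c (Fin.cons (w 0) u) = 0 := by
    refine hc.coboundary.eq_zero fun hinj => ?_
    have hr : ∀ i, (Fin.cons (w 0) u : Fin (n + 3) → V) i ∈ Set.range w := by
      intro i
      refine Fin.cases ?_ (fun i => ?_) i
      · simp
      · simpa using hu i
    choose f hf using hr
    have hfi : Function.Injective f := fun a b hab => hinj (by rw [← hf a, ← hf b, hab])
    have := Fintype.card_le_of_injective f hfi
    simp at this
  rw [coboundary_cons] at h0
  unfold PVTiling.coboundary
  linarith

end alternating

/-! ### Alternation and locality of integration over simplices -/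

section whitney

variable {d n : ℕ}

lemma isAlternating_coneIntegral {ω : Form (Space d) n} (hω : Smooth ω) :
    IsAlternating (coneIntegral n ω) := by
  intro w i j hij
  rw [coneIntegral_eq_simplexIntegral hω, coneIntegral_eq_simplexIntegral hω]
  induction i using Fin.cases with
  | zero =>
    induction j using Fin.cases with
    | zero => exact absurd rfl hij
    | succ j => exact simplexIntegral_swap_zero ω w j
  | succ i =>
    induction j using Fin.cases with
    | zero => rw [Equiv.swap_comm]; exact simplexIntegral_swap_zero ω w i
    | succ j => exact simplexIntegral_swap_succ ω w fun h => hij (congrArg _ h)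

variable {E : Type*} [NormedAddCommGroup E] [NormedSpace ℝ E]

/-- Cone operators with apex in a convex set only use the values of the form on that set. -/
lemma coneIntegral_congr {K : Set E} (hK : Convex ℝ K) {ω η : Form E n}
    (h : ∀ x ∈ K, ω x = η x) {w : Fin (n + 1) → E} (hw : ∀ i, w i ∈ K) :
    coneIntegral n ω w = coneIntegral n η w := by
  induction n with
  | zero => simp only [coneIntegral, h _ (hw 0)]
  | succ n ih =>
    refine ih (fun x hx => ?_) (fun i => hw i.succ)
    rw [coneOp_eq, coneOp_eq]
    refine intervalIntegral.integral_congr fun t ht => ?_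
    rw [Set.uIcc_of_le zero_le_one] at ht
    have : w 0 + t • (x - w 0) ∈ K := by
      have := hK.add_smul_sub_mem (hw 0) hx ht
      exact this
    simp only [coneIntegrand, h _ this]

end whitney

/-! ### Integrals of Whitney forms -/

section whitney

variable {d n : ℕ} {S : Finset (Space d)} {φ : Space d → Space d → ℝ}

/-- Integration is a left inverse of the Whitney map on a simplex, provided that at each point of
the simplex only the functions of the vertices of the carrier of that point are nonzero. -/
lemma coneIntegral_whitney (hφ : ∀ v, Smooth (φ v)) {U : Set (Space d)} (hU : IsOpen U)
    (h1 : ∀ x ∈ U, ∑ v ∈ S, φ v x = 1) {c : (Fin (n + 1) → Space d) → ℝ} (hc : IsAlternating c)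
    {w : Fin (n + 1) → Space d} (hw : convexHull ℝ (Set.range w) ⊆ U)
    (hstar : ∀ s ⊆ Set.range w, ∀ x ∈ convexHull ℝ s, ∀ v ∈ S, v ∉ s →
      φ v x = 0 ∧ fderiv ℝ (φ v) x = 0) :
    coneIntegral n (whitney S φ n c) w = c w := by
  induction n with
  | zero =>
    have hmem : w 0 ∈ convexHull ℝ (Set.range w) := subset_convexHull _ _ ⟨0, rfl⟩
    have hterm : ∀ v ∈ S, φ v (w 0) * c (Fin.cons v ![]) = φ v (w 0) * c w := by
      intro v hv
      by_cases hvw : v ∈ Set.range w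
      · obtain ⟨i, rfl⟩ := hvw
        congr 2
        funext j
        rw [Subsingleton.elim (α := Fin 1) j 0, Subsingleton.elim (α := Fin 1) i 0]
        rfl
      · rw [(hstar _ subset_rfl _ hmem v hv hvw).1]
        simp
    have := h1 _ (hw hmem)
    simp only [coneIntegral, whitney, dWhitney]
    rw [ContinuousAlternatingMap.sum_apply]
    simp only [ContinuousAlternatingMap.smul_apply, constOfIsEmpty_apply, smul_eq_mul]
    rw [Finset.sum_congr rfl hterm, ← Finset.sum_mul, this, one_mul]
  | succ n ih =>
    set b : (Fin (n + 1) → Space d) → ℝ := fun x => c (Fin.cons (w 0) x)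
    have hb : IsAlternating b := hc.cons (w 0)
    -- On the simplex only tuples of its own vertices contribute, and there `c` is the coboundary of
    -- `b`; hence the Whitney form of `c` is exact on the simplex and Stokes' formula reduces the
    -- degree.
    have hW : ∀ x ∈ convexHull ℝ (Set.range w),
        whitney S φ (n + 1) c x = extDeriv (whitney S φ n b) x := by
      intro x hx
      rw [← whitney_coboundary hφ hU h1 b (hw hx)]
      exact whitney_congr (A := Set.range w)
        (fun v hv hvw => hstar _ subset_rfl x hx v hv hvw)
        fun u hu => hc.eq_coboundary_cons w hu
    rw [coneIntegral_congr (convex_convexHull ℝ _) hW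
      (fun i => subset_convexHull _ _ ⟨i, rfl⟩), coneIntegral_extDeriv (smooth_whitney S φ hφ b),
      hc.eq_coboundary_cons w fun i => ⟨i, rfl⟩]
    -- Every face inherits the vanishing condition on the partition functions, since that is assumed
    -- for all subsets of the vertex set.
    refine Finset.sum_congr rfl fun j _ => ?_
    have hsub : Set.range (w ∘ j.succAbove) ⊆ Set.range w := Set.range_comp_subset_range _ _
    rw [ih hb ((convexHull_mono hsub).trans hw)
      fun s hs x hx v hv hvs => hstar s (hs.trans hsub) x hx v hv hvs]

end whitney

/-! ### Simplices and face-to-face tilings -/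

section cells

variable {d : ℕ}

/-- The simplex with a given vertex set. -/
abbrev cell (t : Finset (Space d)) : Set (Space d) := convexHull ℝ (t : Set (Space d))

lemma isCompact_cell (t : Finset (Space d)) : IsCompact (cell t) :=
  t.finite_toSet.isCompact_convexHull ℝ

lemma isClosed_cell (t : Finset (Space d)) : IsClosed (cell t) := (isCompact_cell t).isClosed

lemma mem_shift {t : Finset (Space d)} {x z : Space d} : z ∈ shift t x ↔ z - x ∈ t := by
  rw [← Finset.mem_coe, coe_shift]
  simp [← sub_eq_add_neg]

lemma mem_cell_shift {t : Finset (Space d)} {x z : Space d} :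
    z ∈ cell (shift t x) ↔ z - x ∈ cell t := by
  rw [cell, coe_shift, convexHull_image_add]
  simp [← sub_eq_add_neg]

lemma mem_interior_cell_shift {t : Finset (Space d)} {x z : Space d} :
    z ∈ interior (cell (shift t x)) ↔ z - x ∈ interior (cell t) := by
  have h := (Homeomorph.addRight x).image_interior (convexHull ℝ (t : Set (Space d)))
  rw [cell, coe_shift, convexHull_image_add]
  change z ∈ interior (Homeomorph.addRight x '' _) ↔ _
  rw [← h]
  simp [← sub_eq_add_neg]

lemma mem_translate {K : Set (Finset (Space d))} {x : Space d} {t : Finset (Space d)} :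
    t ∈ translate K x ↔ shift t x ∈ K := Iff.rfl

lemma shift_sub_mem_translate {K : Set (Finset (Space d))} {t : Finset (Space d)} (ht : t ∈ K)
    (x : Space d) : shift t (-x) ∈ translate K x := by
  rw [mem_translate, shift_shift, neg_add_cancel, shift_zero]
  exact ht

section simplex

variable {t : Finset (Space d)} (hc : t.card = d + 1)
  (hi : AffineIndependent ℝ (fun v : t => (v : Space d)))

include hc hi

lemma affineSpan_eq_top : affineSpan ℝ (t : Set (Space d)) = ⊤ := by
  have h := hi.affineSpan_eq_top_iff_card_eq_finrank_add_one.2 (by simp [hc])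
  simpa using h

lemma interior_cell_nonempty : (interior (cell t)).Nonempty :=
  interior_convexHull_nonempty_iff_affineSpan_eq_top.2 (affineSpan_eq_top hc hi)

lemma closure_interior_cell : closure (interior (cell t)) = cell t := by
  rw [(convex_convexHull ℝ _).closure_interior_eq_closure_of_nonempty_interior
    (interior_cell_nonempty hc hi), (isClosed_cell t).closure_eq]

/-- The barycentric coordinate of `v` vanishes on the opposite face and is positive in the interior.
-/
lemma notMem_interior_of_mem_face {v x : Space d} (hv : v ∈ t)
    (hx : x ∈ convexHull ℝ ((t : Set (Space d)) \ {v})) : x ∉ interior (cell t) := by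
  let b : AffineBasis t ℝ (Space d) := ⟨fun v => v, hi, by simpa using affineSpan_eq_top hc hi⟩
  have hr : Set.range b = (t : Set (Space d)) := by
    change Set.range (fun v : t => (v : Space d)) = _
    simp
  have hface : convexHull ℝ ((t : Set (Space d)) \ {v}) ⊆ {y | b.coord ⟨v, hv⟩ y = 0} := by
    refine convexHull_min ?_ ?_
    · rintro y ⟨hy, hne⟩
      exact b.coord_apply_ne (i := ⟨v, hv⟩) (j := ⟨y, hy⟩) fun h => hne (congrArg Subtype.val h).symm
    · exact (convex_singleton (0 : ℝ)).affine_preimage (b.coord ⟨v, hv⟩)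
  intro hint
  rw [cell, ← hr, b.interior_convexHull] at hint
  exact (hint ⟨v, hv⟩).ne' (hface hx)

end simplex

/-- The extreme points of the common hull lie in both vertex sets and span it. By affine
independence no vertex of `t` lies in the hull of the others, so each is extreme. -/
lemma eq_of_subset_cell {t s : Finset (Space d)}
    (hi : AffineIndependent ℝ (fun v : t => (v : Space d))) (h : cell t = cell s) : t ⊆ s := by
  classical
  set X := (cell t).extremePoints ℝ
  have hXt : X ⊆ t := extremePoints_convexHull_subset
  have hXs : X ⊆ s := by
    have : X = (cell s).extremePoints ℝ := by rw [← h]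
    rw [this]
    exact extremePoints_convexHull_subset
  have hX : convexHull ℝ X = cell t := by
    have h1 := closure_convexHull_extremePoints (isCompact_cell t) (convex_convexHull ℝ _)
    have h2 := ((t.finite_toSet.subset hXt).isClosed_convexHull (𝕜 := ℝ)).closure_eq
    exact h2.symm.trans h1
  intro v hv
  refine hXs ?_
  by_contra hvX
  have hsub : X ⊆ ((t.erase v : Finset (Space d)) : Set (Space d)) := by
    intro y hy
    rw [Finset.mem_coe, Finset.mem_erase]
    exact ⟨fun e => hvX (e ▸ hy), hXt hy⟩
  have hmem : v ∈ convexHull ℝ ((t.erase v : Finset (Space d)) : Set (Space d)) := by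
    refine convexHull_mono hsub ?_
    rw [hX]
    exact subset_convexHull _ _ hv
  have hmem' : v ∈ convexHull ℝ (({v} : Finset (Space d)) : Set (Space d)) :=
    subset_convexHull _ _ (by simp)
  have := hi.convexHull_inter (t₁ := {v}) (t₂ := t.erase v) (by simpa using hv)
    (Finset.erase_subset _ _)
  have h3 : v ∈ convexHull ℝ ((({v} : Finset (Space d)) : Set (Space d)) ∩ (t.erase v : Finset _)) := by
    rw [this]
    exact ⟨hmem', hmem⟩
  have h4 : ((({v} : Finset (Space d)) : Set (Space d)) ∩ (t.erase v : Finset (Space d))) = ∅ := by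
    ext y
    simp
  rw [h4] at h3
  simp at h3

lemma isPreconnected_interior_cell (t : Finset (Space d)) : IsPreconnected (interior (cell t)) :=
  (convex_convexHull ℝ _).interior.isPreconnected

/-- A connected set which meets the interior of a closed set but not its frontier is contained in
the interior. -/
lemma subset_interior_of_disjoint_frontier {A B : Set (Space d)} (hA : IsPreconnected A)
    (hd : ∀ x ∈ A, x ∉ frontier B) (hne : (A ∩ B).Nonempty) : A ⊆ interior B := by
  intro x hx
  by_contra hxi
  have hor : ∀ y ∈ A, y ∈ interior B ∨ y ∈ (closure B)ᶜ := fun y hy =>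
    or_iff_not_imp_left.2 fun h1 h2 => hd y hy ⟨h2, h1⟩
  obtain ⟨y, hyA, hyB⟩ := hne
  obtain ⟨z, -, hz1, hz2⟩ := hA _ _ isOpen_interior isClosed_closure.isOpen_compl hor
    ⟨y, hyA, (hor y hyA).resolve_right fun h => h (subset_closure hyB)⟩
    ⟨x, hx, (hor x hx).resolve_left hxi⟩
  exact hz2 (subset_closure (interior_subset hz1))

end cells

namespace IsFaceToFaceTiling

variable {d : ℕ} {K L : Set (Finset (Space d))} (hK : IsFaceToFaceTiling K)

include hK

lemma exists_mem_cell (x : Space d) : ∃ t ∈ K, x ∈ cell t := by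
  have : x ∈ ⋃ t ∈ K, convexHull ℝ (t : Set (Space d)) := hK.cover ▸ mem_univ x
  simpa using this

lemma mem_inter {s t : Finset (Space d)} (hs : s ∈ K) (ht : t ∈ K) {x : Space d}
    (hxs : x ∈ cell s) (hxt : x ∈ cell t) :
    x ∈ convexHull ℝ ((s : Set (Space d)) ∩ (t : Set (Space d))) :=
  hK.face_to_face s hs t ht ▸ ⟨hxs, hxt⟩

lemma exists_common_vertex {s t : Finset (Space d)} (hs : s ∈ K) (ht : t ∈ K) {x : Space d}
    (hxs : x ∈ cell s) (hxt : x ∈ cell t) : ∃ v ∈ s, v ∈ t := by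
  have h := convexHull_nonempty_iff.1 ⟨x, hK.mem_inter hs ht hxs hxt⟩
  obtain ⟨v, hv⟩ := h
  exact ⟨v, hv.1, hv.2⟩

/-- A common point lies in the hull of the common vertices. An interior point of `t` lies in no
proper face, so all vertices of `t` are common. -/
lemma eq_of_mem_interior {s t : Finset (Space d)} (hs : s ∈ K) (ht : t ∈ K) {x : Space d}
    (hxs : x ∈ cell s) (hxt : x ∈ interior (cell t)) : s = t := by
  have hsub : t ⊆ s := by
    intro v hv
    by_contra hvs
    refine notMem_interior_of_mem_face (hK.card_eq t ht) (hK.affineIndependent t ht) hv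
      (convexHull_mono ?_ (hK.mem_inter hs ht hxs (interior_subset hxt))) hxt
    rintro y ⟨hy1, hy2⟩
    exact ⟨hy2, fun h => hvs (h ▸ hy1)⟩
  exact (Finset.eq_of_subset_of_card_le hsub (by rw [hK.card_eq s hs, hK.card_eq t ht])).symm

lemma notMem_boundaryPoints {t : Finset (Space d)} (ht : t ∈ K) {x : Space d}
    (hx : x ∈ interior (cell t)) : x ∉ boundaryPoints K := by
  intro hb
  simp only [boundaryPoints, mem_iUnion, exists_prop] at hb
  obtain ⟨s, hs, hxs⟩ := hb
  have := hK.eq_of_mem_interior hs ht ((isClosed_cell s).frontier_subset hxs) hx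
  exact (this ▸ hxs).2 hx

/-- Tilings which coincide on a ball have the same tiles inside the ball. -/
lemma mem_of_agree (hL : IsFaceToFaceTiling L) {r : ℝ} (h : Agree r K L) {t : Finset (Space d)}
    (ht : t ∈ K) (hr : cell t ⊆ Metric.ball 0 r) : t ∈ L := by
  obtain ⟨p, hp⟩ := interior_cell_nonempty (hK.card_eq t ht) (hK.affineIndependent t ht)
  obtain ⟨l, hl, hpl⟩ := hL.exists_mem_cell p
  -- In the ball both tilings have the same boundary points, and these avoid the interiors of tiles.
  -- A connected interior therefore cannot cross the frontier of a tile of the other tiling.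
  have h1 : interior (cell t) ⊆ interior (cell l) := by
    refine subset_interior_of_disjoint_frontier (isPreconnected_interior_cell t) ?_ ⟨p, hp, hpl⟩
    intro x hx hxl
    have hxL : x ∈ boundaryPoints L ∩ Metric.ball 0 r :=
      ⟨mem_biUnion hl hxl, hr (interior_subset hx)⟩
    rw [← h] at hxL
    exact hK.notMem_boundaryPoints ht hx hxL.1
  have h2 : interior (cell l) ⊆ interior (cell t) := by
    refine subset_interior_of_disjoint_frontier (isPreconnected_interior_cell l) ?_
      ⟨p, h1 hp, interior_subset hp⟩
    intro x hx hxt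
    have hxK : x ∈ boundaryPoints K ∩ Metric.ball 0 r :=
      ⟨mem_biUnion ht hxt, hr ((isClosed_cell t).frontier_subset hxt)⟩
    rw [h] at hxK
    exact hL.notMem_boundaryPoints hl hx hxK.1
  have heq : cell t = cell l := by
    rw [← closure_interior_cell (hK.card_eq t ht) (hK.affineIndependent t ht),
      ← closure_interior_cell (hL.card_eq l hl) (hL.affineIndependent l hl), h1.antisymm h2]
  have htl : t = l := (eq_of_subset_cell (hK.affineIndependent t ht) heq).antisymm
    (eq_of_subset_cell (hL.affineIndependent l hl) heq.symm)
  exact htl ▸ hl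

/-- A point of a face of a tile lies in no opposite face of a vertex which is needed to span it. -/
lemma mem_convexHull_diff {s t t' : Finset (Space d)} (ht : t ∈ K) (ht' : t' ∈ K) (hs : s ⊆ t)
    {v x : Space d} (hx : x ∈ convexHull ℝ (s : Set (Space d)))
    (hx' : x ∈ convexHull ℝ ((t' : Set (Space d)) \ {v})) :
    x ∈ convexHull ℝ ((s : Set (Space d)) \ {v}) := by
  classical
  have h1 := hK.mem_inter ht ht' (convexHull_mono hs hx) (convexHull_mono sdiff_subset hx')
  -- Affine independence of `t'` puts the point in the hull of common vertices other than `v`, hence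
  -- in a face of `t` omitting `v`. Affine independence of `t` then intersects this face with `s`.
  have h2 : x ∈ convexHull ℝ (((t ∩ t' : Finset (Space d)) : Set (Space d)) ∩
      (t'.erase v : Finset (Space d))) := by
    rw [(hK.affineIndependent t' ht').convexHull_inter Finset.inter_subset_right
      (Finset.erase_subset _ _)]
    refine ⟨by simpa using h1, by simpa using hx'⟩
  have h3 : x ∈ convexHull ℝ ((t.erase v : Finset (Space d)) : Set (Space d)) := by
    refine convexHull_mono ?_ h2
    rintro y ⟨hy1, hy2⟩
    simp only [Finset.coe_inter, mem_inter_iff, Finset.mem_coe, Finset.mem_erase] at hy1 hy2 ⊢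
    exact ⟨hy2.1, hy1.1⟩
  have h4 : x ∈ convexHull ℝ ((s : Set (Space d)) ∩ (t.erase v : Finset (Space d))) := by
    rw [(hK.affineIndependent t ht).convexHull_inter hs (Finset.erase_subset _ _)]
    exact ⟨hx, h3⟩
  refine convexHull_mono ?_ h4
  rintro y ⟨hy1, hy2⟩
  simp only [Finset.mem_coe, Finset.mem_erase] at hy2
  exact ⟨hy1, hy2.1⟩

/-- Every point of a tile has a vertex such that the point lies in no opposite face of it. -/
lemma exists_vertex_forall_notMem {t : Finset (Space d)} (ht : t ∈ K) {x : Space d}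
    (hx : x ∈ cell t) :
    ∃ v ∈ t, ∀ t' ∈ K, x ∉ convexHull ℝ ((t' : Set (Space d)) \ {v}) := by
  classical
  -- Take the smallest face containing `x`, its carrier. Any vertex `v` of it works, since otherwise
  -- `x` would already lie in the carrier without `v`.
  obtain ⟨s, hs, hmin⟩ := (t.powerset.filter fun s : Finset (Space d) => x ∈ cell s
    ).exists_min_image Finset.card ⟨t, by simp [hx]⟩
  simp only [Finset.mem_filter, Finset.mem_powerset] at hs hmin
  obtain ⟨v, hv⟩ := convexHull_nonempty_iff.1 ⟨x, hs.2⟩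
  refine ⟨v, hs.1 hv, fun t' ht' hx' => ?_⟩
  have h := hK.mem_convexHull_diff ht ht' hs.1 hs.2 hx'
  have h' := hmin (s.erase v) ⟨(Finset.erase_subset _ _).trans hs.1,
    by rw [cell, Finset.coe_erase]; exact h⟩
  exact absurd h' (not_le.2 (Finset.card_erase_lt_of_mem hv))

end IsFaceToFaceTiling

/-! ### Finite local complexity -/

namespace SimplicialTiling

variable {d : ℕ} (T : SimplicialTiling d)

/-- The set of the vertices of the tiles. -/
def verts : Set (Space d) := {v | ∃ t ∈ T.tiles, v ∈ t}

lemma exists_mesh : ∃ D : ℝ, 0 < D ∧ ∀ t ∈ T.tiles, ∀ x ∈ cell t, ∀ y ∈ cell t, dist x y ≤ D := by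
  obtain ⟨F, hF, hT⟩ := T.finite_prototiles
  have h : ∀ᶠ D : ℝ in atTop, ∀ s ∈ F, ∀ x ∈ cell s, ∀ y ∈ cell s, dist x y ≤ D := by
    rw [eventually_all_finite hF]
    intro s _
    filter_upwards [eventually_ge_atTop (Metric.diam (cell s))] with D hD x hx y hy
    exact (Metric.dist_le_diam_of_mem (isCompact_cell s).isBounded hx hy).trans hD
  obtain ⟨D, hD, hD0⟩ := (h.and (eventually_gt_atTop 0)).exists
  refine ⟨D, hD0, fun t ht x hx y hy => ?_⟩
  obtain ⟨s, hs, a, rfl⟩ := hT t ht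
  have := hD s hs _ (mem_cell_shift.1 hx) _ (mem_cell_shift.1 hy)
  simpa using this

/-- A bound for the diameters of the tiles. -/
def mesh : ℝ := T.exists_mesh.choose

lemma mesh_pos : 0 < T.mesh := T.exists_mesh.choose_spec.1

lemma dist_le_mesh {t : Finset (Space d)} (ht : t ∈ T.tiles) {x y : Space d} (hx : x ∈ cell t)
    (hy : y ∈ cell t) : dist x y ≤ T.mesh :=
  T.exists_mesh.choose_spec.2 t ht x hx y hy

/-- For one prototile, the translation vectors of the tiles meeting the ball lie in a compact set,
and tiles whose vectors are too close would overlap in their interiors. -/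
lemma finite_tiles_meeting (x : Space d) (r : ℝ) :
    {t ∈ T.tiles | (cell t ∩ Metric.closedBall x r).Nonempty}.Finite := by
  obtain ⟨F, hF, hT⟩ := T.finite_prototiles
  have key : ∀ s ∈ F, {t ∈ T.tiles | (cell t ∩ Metric.closedBall x r).Nonempty ∧
      ∃ y, t = shift s y}.Finite := by
    intro s _
    by_cases hne : ∃ y, shift s y ∈ T.tiles
    swap
    · convert Set.finite_empty
      ext t
      simp only [mem_ofPred_eq, mem_empty_iff_false, iff_false]
      rintro ⟨ht, -, y, rfl⟩
      exact hne ⟨y, ht⟩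
    obtain ⟨y₀, hy₀⟩ := hne
    obtain ⟨p, hp⟩ := interior_cell_nonempty (T.isTiling.card_eq _ hy₀)
      (T.isTiling.affineIndependent _ hy₀)
    rw [mem_interior_cell_shift] at hp
    set q := p - y₀
    obtain ⟨ρ, hρ, hball⟩ := Metric.isOpen_iff.1 isOpen_interior q hp
    have hcomp : IsCompact
        ((fun p : Space d × Space d => p.1 - p.2) '' (Metric.closedBall x r ×ˢ cell s)) :=
      ((isCompact_closedBall x r).prod (isCompact_cell s)).image continuous_sub
    obtain ⟨C, -, hC, hcov⟩ := hcomp.finite_cover_balls (half_pos hρ)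
    refine (hC.biUnion (t := fun c => {t ∈ T.tiles | ∃ y ∈ Metric.ball c (ρ / 2), t = shift s y})
      fun c _ => Set.Subsingleton.finite ?_).subset ?_
    -- Two vectors in a ball of radius `ρ / 2` differ by less than `ρ`, so the marked interior point
    -- of one tile also lies in the other.
    · rintro _ ⟨ht, y, hy, rfl⟩ _ ⟨ht', y', hy', rfl⟩
      refine T.isTiling.eq_of_mem_interior (x := q + y') ht ht' ?_ ?_
      · rw [mem_cell_shift]
        refine interior_subset (hball ?_)
        have := dist_triangle_right y' y c
        rw [Metric.mem_ball] at hy hy' ⊢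
        calc dist (q + y' - y) q = dist y' y := by
              rw [dist_eq_norm, dist_eq_norm]; congr 1; abel
          _ < ρ := by linarith
      · rw [mem_interior_cell_shift]
        simpa using hp
    · rintro t ⟨ht, ⟨z, hz, hzr⟩, y, rfl⟩
      have hy : y ∈ (fun p : Space d × Space d => p.1 - p.2) ''
          (Metric.closedBall x r ×ˢ cell s) := ⟨(z, z - y), ⟨hzr, mem_cell_shift.1 hz⟩, by simp⟩
      have := hcov hy
      simp only [mem_iUnion, exists_prop] at this ⊢
      obtain ⟨c, hc, hyc⟩ := this
      exact ⟨c, hc, ht, y, hyc, rfl⟩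
  refine (hF.biUnion key).subset ?_
  rintro t ⟨ht, hm⟩
  obtain ⟨s, hs, y, rfl⟩ := hT t ht
  exact mem_biUnion hs ⟨ht, hm, y, rfl⟩

lemma isClosed_biUnion_of_subset_cell {I : Set (Finset (Space d))} (hI : I ⊆ T.tiles)
    (A : Finset (Space d) → Set (Space d)) (hA : ∀ t, A t ⊆ cell t) (hc : ∀ t, IsClosed (A t)) :
    IsClosed (⋃ t ∈ I, A t) := by
  rw [biUnion_eq_iUnion]
  refine LocallyFinite.isClosed_iUnion ?_ fun t => hc t
  intro x
  refine ⟨Metric.closedBall x 1, Metric.closedBall_mem_nhds x one_pos, ?_⟩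
  refine Set.Finite.of_finite_image ((T.finite_tiles_meeting x 1).subset ?_)
    (f := Subtype.val) Subtype.val_injective.injOn
  rintro _ ⟨t, ⟨y, hy, hyx⟩, rfl⟩
  exact ⟨hI t.2, y, hA _ hy, hyx⟩

/-- The tiles, seen from one of their vertices. -/
lemma finite_star : {s | ∃ t ∈ T.tiles, ∃ v ∈ t, s = shift t (-v)}.Finite := by
  obtain ⟨F, hF, hT⟩ := T.finite_prototiles
  refine (hF.biUnion (t := fun s => (fun u => shift s (-u)) '' (s : Set (Space d)))
    fun s _ => s.finite_toSet.image _).subset ?_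
  rintro _ ⟨t, ht, v, hv, rfl⟩
  obtain ⟨s, hs, y, rfl⟩ := hT t ht
  refine mem_biUnion hs ⟨v - y, mem_shift.1 hv, ?_⟩
  simp only [shift_shift]
  congr 1
  abel

/-- `t` is reached from the vertex `v` by a chain of `k + 1` tiles with common vertices. -/
def Linked : ℕ → Space d → Finset (Space d) → Prop
  | 0, v, t => t ∈ T.tiles ∧ v ∈ t
  | k + 1, v, t => t ∈ T.tiles ∧ ∃ u, Linked k v u ∧ ∃ w ∈ u, w ∈ t

lemma Linked.mem {k : ℕ} {v : Space d} {t : Finset (Space d)} (h : T.Linked k v t) :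
    t ∈ T.tiles := by
  cases k <;> exact h.1

/-- Each further link attaches one of finitely many tiles, seen from a vertex, at one of finitely
many vertices already reached. -/
lemma finite_linked (k : ℕ) : {s | ∃ v t, T.Linked k v t ∧ s = shift t (-v)}.Finite := by
  induction k with
  | zero =>
    refine T.finite_star.subset ?_
    rintro _ ⟨v, t, ⟨ht, hv⟩, rfl⟩
    exact ⟨t, ht, v, hv, rfl⟩
  | succ k ih =>
    have hW : (⋃ u ∈ {s | ∃ v t, T.Linked k v t ∧ s = shift t (-v)}, (u : Set (Space d))).Finite :=
      ih.biUnion fun u _ => u.finite_toSet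
    refine ((T.finite_star.prod hW).image fun p => shift p.1 p.2).subset ?_
    rintro _ ⟨v, t, ⟨ht, u, hu, w, hwu, hwt⟩, rfl⟩
    refine ⟨(shift t (-w), w - v), ⟨⟨t, ht, w, hwt, rfl⟩, mem_biUnion ⟨v, u, hu, rfl⟩ ?_⟩, ?_⟩
    · rw [Finset.mem_coe, mem_shift]
      simpa using hwu
    · simp only [shift_shift]
      congr 1
      abel

/-- A neighbourhood of uniform size of each tile is covered by the tiles which meet it. -/
lemma exists_uniform_collar : ∃ ε : ℝ, 0 < ε ∧ ∀ t ∈ T.tiles, ∀ x ∈ cell t, ∀ y, dist x y < ε →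
    ∃ u ∈ T.tiles, (∃ w ∈ t, w ∈ u) ∧ y ∈ cell u := by
  -- The width of the collar of a tile depends only on the tile and its neighbours as seen from one
  -- of its vertices. `Q` is a finite set containing all such pairs.
  set Q := {s | ∃ v t, T.Linked 0 v t ∧ s = shift t (-v)} ×ˢ
    𝒫 {s | ∃ v t, T.Linked 1 v t ∧ s = shift t (-v)}
  have hQ : Q.Finite := (T.finite_linked 0).prod (T.finite_linked 1).finite_subsets
  set P : Finset (Space d) × Set (Finset (Space d)) → ℝ → Prop := fun q ε =>
    ∀ x ∈ cell q.1, ∀ y, dist x y < ε → ∃ u ∈ q.2, y ∈ cell u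
  have hloc : ∀ t ∈ T.tiles, ∃ ε : ℝ, 0 < ε ∧ ∀ x ∈ cell t, ∀ y, dist x y < ε →
      ∃ u ∈ T.tiles, (∃ w ∈ t, w ∈ u) ∧ y ∈ cell u := by
    intro t ht
    set A := ⋃ u ∈ {u ∈ T.tiles | ¬ ∃ w ∈ t, w ∈ u}, cell u
    have hA : IsClosed A := T.isClosed_biUnion_of_subset_cell (fun u hu => hu.1) cell
      (fun _ => subset_rfl) isClosed_cell
    have hd : cell t ⊆ Aᶜ := by
      intro x hx hxA
      simp only [A, mem_iUnion, exists_prop] at hxA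
      obtain ⟨u, ⟨hu, hn⟩, hxu⟩ := hxA
      exact hn (T.isTiling.exists_common_vertex ht hu hx hxu)
    obtain ⟨ε, hε, hsub⟩ := (isCompact_cell t).exists_thickening_subset_open hA.isOpen_compl hd
    refine ⟨ε, hε, fun x hx y hxy => ?_⟩
    have hy : y ∈ Aᶜ := hsub (Metric.mem_thickening_iff.2 ⟨x, hx, by rwa [dist_comm]⟩)
    obtain ⟨u, hu, hyu⟩ := T.isTiling.exists_mem_cell y
    refine ⟨u, hu, ?_, hyu⟩
    by_contra hn
    exact hy (mem_biUnion (show u ∈ {u ∈ T.tiles | ¬ ∃ w ∈ t, w ∈ u} from ⟨hu, hn⟩) hyu)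
  -- Any pair that admits some width admits all smaller ones, so one positive width serves the whole
  -- finite set.
  have hev : ∀ᶠ ε : ℝ in 𝓝[>] 0, ∀ q ∈ Q, (∃ ε' > 0, P q ε') → P q ε := by
    rw [eventually_all_finite hQ]
    intro q _
    by_cases h : ∃ ε' > 0, P q ε'
    · obtain ⟨ε', hε', hP⟩ := h
      filter_upwards [Ioo_mem_nhdsGT hε'] with ε hε _ x hx y hxy
      exact hP x hx y (hxy.trans hε.2)
    · exact Eventually.of_forall fun _ h' => absurd h' h
  obtain ⟨ε, hεQ, hε⟩ := (hev.and self_mem_nhdsWithin).exists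
  refine ⟨ε, hε, fun t ht x hx y hxy => ?_⟩
  obtain ⟨v, hv⟩ := Finset.card_pos.1 (by rw [T.isTiling.card_eq t ht]; omega : 0 < t.card)
  set B := {s | ∃ u ∈ T.tiles, (∃ w ∈ t, w ∈ u) ∧ s = shift u (-v)}
  have hmem : (shift t (-v), B) ∈ Q := by
    refine ⟨⟨v, t, ⟨ht, hv⟩, rfl⟩, ?_⟩
    rintro _ ⟨u, hu, ⟨w, hwt, hwu⟩, rfl⟩
    exact ⟨v, u, ⟨hu, t, ⟨ht, hv⟩, w, hwt, hwu⟩, rfl⟩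
  have hPex : ∃ ε' > 0, P (shift t (-v), B) ε' := by
    obtain ⟨ε', hε', h⟩ := hloc t ht
    refine ⟨ε', hε', fun x hx y hxy => ?_⟩
    rw [mem_cell_shift, sub_neg_eq_add] at hx
    obtain ⟨u, hu, hw, hyu⟩ := h (x + v) hx (y + v) (by simpa using hxy)
    exact ⟨shift u (-v), ⟨u, hu, hw, rfl⟩, by rwa [mem_cell_shift, sub_neg_eq_add]⟩
  obtain ⟨_, ⟨u, hu, hw, rfl⟩, hyu⟩ := hεQ _ hmem hPex (x - v)
    (by rw [mem_cell_shift]; simpa using hx) (y - v) (by simpa using hxy)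
  exact ⟨u, hu, hw, by simpa [mem_cell_shift] using hyu⟩

/-- Walk from `v` to `x` in steps shorter than the uniform collar width. Each step costs at most one
link, so the number of links is bounded in terms of `r`. -/
lemma exists_linked_of_dist_lt (r : ℝ) : ∃ k : ℕ, ∀ v ∈ T.verts, ∀ t ∈ T.tiles, ∀ x ∈ cell t,
    dist v x ≤ r → T.Linked k v t := by
  obtain ⟨ε, hε, h⟩ := T.exists_uniform_collar
  have key : ∀ k : ℕ, ∀ v ∈ T.verts, ∀ x, dist v x < k * ε + ε →
      ∃ u, T.Linked (k + 1) v u ∧ x ∈ cell u := by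
    intro k
    induction k with
    | zero =>
      rintro v ⟨t, ht, hv⟩ x hx
      obtain ⟨u, hu, ⟨w, hwt, hwu⟩, hxu⟩ := h t ht v (subset_convexHull _ _ hv) x (by simpa using hx)
      exact ⟨u, ⟨hu, t, ⟨ht, hv⟩, w, hwt, hwu⟩, hxu⟩
    | succ k ih =>
      intro v hv x hx
      obtain ⟨y, hvy, hyx⟩ : ∃ y, dist v y < k * ε + ε ∧ dist y x < ε := by
        have := exists_dist_lt_lt (x := v) (z := x) (δ := k * ε + ε) (ε := ε) (by positivity) hε
          (by push_cast at hx; linarith)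
        exact this
      obtain ⟨u, hu, hyu⟩ := ih v hv y hvy
      obtain ⟨u', hu', ⟨w, hw, hw'⟩, hxu'⟩ := h u (hu.mem T) y hyu x hyx
      exact ⟨u', ⟨hu', u, hu, w, hw, hw'⟩, hxu'⟩
  obtain ⟨k, hk⟩ := exists_nat_gt (r / ε)
  -- The walk ends in some tile `u` containing `x`; one more link leads from `u` to `t`.
  refine ⟨k + 2, fun v hv t ht x hx hvx => ?_⟩
  have hr : r < k * ε := (div_lt_iff₀ hε).1 hk
  obtain ⟨u, hu, hxu⟩ := key k v hv x (by linarith)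
  obtain ⟨w, hw⟩ := T.isTiling.exists_common_vertex (hu.mem T) ht hxu hx
  exact ⟨ht, u, hu, w, hw⟩

/-- Finite local complexity: up to translation there are only finitely many tiles at a bounded
distance from a vertex. -/
lemma finite_seen (r : ℝ) : {s | ∃ v ∈ T.verts, s ∈ translate T.tiles v ∧
    (cell s ∩ Metric.closedBall 0 r).Nonempty}.Finite := by
  obtain ⟨k, hk⟩ := T.exists_linked_of_dist_lt r
  refine (T.finite_linked k).subset ?_
  rintro s ⟨v, hv, hs, x, hx, hxr⟩
  refine ⟨v, shift s v, hk v hv _ hs (x + v) (by simpa [mem_cell_shift] using hx) ?_, ?_⟩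
  · simpa [dist_eq_norm] using hxr
  · simp [shift_shift, shift_zero]

end SimplicialTiling

/-! ### Tilings with the same tiles near the origin -/

section sameTiles

variable {d : ℕ} {K L M : Set (Finset (Space d))} {r s : ℝ}

/-- The two collections contain the same of the simplices which meet the ball of radius `r`. -/
def SameTiles (r : ℝ) (K L : Set (Finset (Space d))) : Prop :=
  ∀ t : Finset (Space d), (cell t ∩ Metric.closedBall 0 r).Nonempty → (t ∈ K ↔ t ∈ L)

lemma SameTiles.refl (r : ℝ) (K : Set (Finset (Space d))) : SameTiles r K K := fun _ _ => Iff.rfl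

lemma SameTiles.symm (h : SameTiles r K L) : SameTiles r L K := fun t ht => (h t ht).symm

lemma SameTiles.trans (h : SameTiles r K L) (h' : SameTiles r L M) : SameTiles r K M :=
  fun t ht => (h t ht).trans (h' t ht)

lemma SameTiles.mono (h : SameTiles r K L) (hs : s ≤ r) : SameTiles s K L :=
  fun t ht => h t (ht.mono (inter_subset_inter_right _ (Metric.closedBall_subset_closedBall hs)))

lemma SameTiles.translate (h : SameTiles r K L) {x : Space d} (hx : s + ‖x‖ ≤ r) :
    SameTiles s (translate K x) (translate L x) := by
  rintro t ⟨z, hz, hzs⟩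
  refine h _ ⟨z + x, by simpa [mem_cell_shift] using hz, ?_⟩
  rw [mem_closedBall_zero_iff] at hzs ⊢
  linarith [norm_add_le z x]

lemma SameTiles.agree (h : SameTiles r K L) : Agree r K L := by
  have key : ∀ {K L : Set (Finset (Space d))}, SameTiles r K L →
      boundaryPoints K ∩ Metric.ball 0 r ⊆ boundaryPoints L ∩ Metric.ball 0 r := by
    rintro K L h x ⟨hx, hxr⟩
    simp only [boundaryPoints, mem_iUnion, exists_prop] at hx
    obtain ⟨t, ht, hxt⟩ := hx
    refine ⟨mem_biUnion ((h t ⟨x, (isClosed_cell t).frontier_subset hxt, ?_⟩).1 ht) hxt, hxr⟩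
    exact Metric.ball_subset_closedBall hxr
  exact (key h).antisymm (key h.symm)

lemma Agree.mono (h : Agree r K L) (hs : s ≤ r) : Agree s K L := by
  have := congrArg (· ∩ Metric.ball (0 : Space d) s) h
  simpa only [Agree, Set.inter_assoc, Set.inter_eq_right.2 (Metric.ball_subset_ball hs)] using this

lemma Agree.symm (h : Agree r K L) : Agree r L K := Eq.symm h

end sameTiles

namespace SimplicialTiling

variable {d : ℕ} (T : SimplicialTiling d) {K L : Set (Finset (Space d))} {r s : ℝ}

lemma tilingDist_lt_ofReal {R : ℝ} (hR : 0 < R) (h : tilingDist K L < ENNReal.ofReal (1 / (R + 1))) :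
    ∃ a ∈ Metric.ball (0 : Space d) (1 / R), ∃ b ∈ Metric.ball (0 : Space d) (1 / R),
      Agree R (translate K a) (translate L b) := by
  simp only [tilingDist, iInf_lt_iff] at h
  obtain ⟨r, ⟨hr, a, ha, b, hb, hab⟩, hlt⟩ := h
  rw [ENNReal.ofReal_lt_ofReal_iff (by positivity)] at hlt
  have hrR : R < r := by
    have := (one_div_lt_one_div (by positivity) (by positivity)).1 hlt
    linarith
  have hsub : Metric.ball (0 : Space d) (1 / r) ⊆ Metric.ball 0 (1 / R) :=
    Metric.ball_subset_ball (one_div_le_one_div_of_le hR hrR.le)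
  exact ⟨a, hsub ha, b, hsub hb, hab.mono hrR.le⟩

/-- Close tilings coincide on a large ball up to a small translation. -/
lemma agree_of_tilingDist_lt {R : ℝ} (hR : 0 < R)
    (h : tilingDist K L < ENNReal.ofReal (1 / (R + 1))) :
    ∃ a : Space d, ‖a‖ < 2 / R ∧ Agree (R - 1 / R) K (translate L a) := by
  obtain ⟨a, ha, b, hb, hab⟩ := tilingDist_lt_ofReal hR h
  rw [mem_ball_zero_iff] at ha hb
  refine ⟨b - a, ?_, ?_⟩
  · have := norm_sub_le b a
    rw [show (2 : ℝ) / R = 1 / R + 1 / R by ring]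
    linarith
  · have := hab.translate (-a)
    rw [translate_translate, translate_translate, add_neg_cancel, translate_zero, norm_neg,
      ← sub_eq_add_neg] at this
    exact this.mono (by linarith)

lemma exists_agree (hK : K ∈ T.hull) (R : ℝ) : ∃ x, Agree R K (translate T.tiles x) := by
  set R' := max R 0 + 1
  have hR' : 1 ≤ R' := by simp [R']
  obtain ⟨x, hx⟩ := hK.2 (ENNReal.ofReal (1 / (R' + 1))) (ENNReal.ofReal_pos.2 (by positivity))
  obtain ⟨a, -, ha⟩ := agree_of_tilingDist_lt (by linarith) hx
  rw [translate_translate] at ha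
  refine ⟨x + a, ha.mono ?_⟩
  have : 1 / R' ≤ 1 := by rw [div_le_one (by linarith)]; exact hR'
  have : R ≤ max R 0 := le_max_left _ _
  simp only [R'] at *
  linarith

lemma exists_mem_translate (hK : K ∈ T.hull) {t : Finset (Space d)} (ht : t ∈ K) :
    ∃ x, t ∈ translate T.tiles x := by
  obtain ⟨R, hR⟩ := (isCompact_cell t).isBounded.subset_ball 0
  obtain ⟨x, hx⟩ := T.exists_agree hK R
  exact ⟨x, hK.1.mem_of_agree (T.isTiling.translate x) hx ht hR⟩

lemma dist_le_mesh_of_mem_hull (hK : K ∈ T.hull) {t : Finset (Space d)} (ht : t ∈ K)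
    {x y : Space d} (hx : x ∈ cell t) (hy : y ∈ cell t) : dist x y ≤ T.mesh := by
  obtain ⟨a, ha⟩ := T.exists_mem_translate hK ht
  have := T.dist_le_mesh ha (x := x + a) (y := y + a) (by simpa [mem_cell_shift] using hx)
    (by simpa [mem_cell_shift] using hy)
  simpa using this

/-- A tile meeting the `r`-ball lies in the open ball of radius `r + T.mesh + 1`, where equal
boundary points force equal tiles. -/
lemma sameTiles_of_agree (hK : K ∈ T.hull) (hL : L ∈ T.hull) (h : Agree (r + T.mesh + 1) K L) :
    SameTiles r K L := by
  have key : ∀ {K L : Set (Finset (Space d))}, K ∈ T.hull → L ∈ T.hull →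
      Agree (r + T.mesh + 1) K L → ∀ t, (cell t ∩ Metric.closedBall 0 r).Nonempty → t ∈ K → t ∈ L := by
    rintro K L hK hL h t ⟨z, hz, hzr⟩ ht
    refine hK.1.mem_of_agree hL.1 h ht fun y hy => ?_
    have := T.dist_le_mesh_of_mem_hull hK ht hy hz
    rw [Metric.mem_closedBall] at hzr
    rw [Metric.mem_ball]
    linarith [dist_triangle y z 0]
  exact fun t ht => ⟨key hK hL h t ht, key hL hK h.symm t ht⟩

lemma exists_sameTiles (hK : K ∈ T.hull) (r : ℝ) : ∃ x, SameTiles r K (translate T.tiles x) := by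
  obtain ⟨x, hx⟩ := T.exists_agree hK (r + T.mesh + 1)
  exact ⟨x, T.sameTiles_of_agree hK (T.translate_mem_hull T.tiles_mem_hull x) hx⟩

/-- The tiling looks the same from `x` and from `y` up to distance `r`. -/
abbrev Similar (r : ℝ) (x y : Space d) : Prop :=
  SameTiles r (translate T.tiles x) (translate T.tiles y)

variable {T}

lemma Similar.add {x y a : Space d} (h : T.Similar r x y) (ha : s + ‖a‖ ≤ r) :
    T.Similar s (x + a) (y + a) := by
  have := SameTiles.translate h ha
  rwa [translate_translate, translate_translate] at this

lemma Similar.shift_mem {x y : Space d} (h : T.Similar r x y) {t : Finset (Space d)}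
    (ht : t ∈ T.tiles) {z : Space d} (hz : z ∈ cell t) (hzx : dist z x ≤ r) :
    shift t (y - x) ∈ T.tiles := by
  have := (h (shift t (-x)) ⟨z - x, by simpa [mem_cell_shift] using hz,
    by simpa [dist_eq_norm] using hzx⟩).1 (shift_sub_mem_translate ht x)
  rw [mem_translate, shift_shift] at this
  rwa [sub_eq_neg_add]

lemma similar_of_agree {x y : Space d}
    (h : Agree (r + T.mesh + 1) (translate T.tiles x) (translate T.tiles y)) : T.Similar r x y :=
  T.sameTiles_of_agree (T.translate_mem_hull T.tiles_mem_hull x)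
    (T.translate_mem_hull T.tiles_mem_hull y) h

variable (T)

/-- Agreement of boundary points and equality of tiles differ only by a change of the radius, so for
equivariance with some range the more convenient relation may be used. -/
lemma exists_isPatternEquivariant_iff {F : Type*} (f : Space d → F) :
    (∃ R : ℝ, 0 < R ∧ T.IsPatternEquivariant f R) ↔
      ∃ R : ℝ, ∀ x y, T.Similar R x y → f x = f y := by
  constructor
  · rintro ⟨R, -, h⟩
    exact ⟨R, fun x y hxy => h x y hxy.agree⟩
  · rintro ⟨R, h⟩
    refine ⟨max R 0 + T.mesh + 1, by have := T.mesh_pos; positivity, fun x y hxy => h x y ?_⟩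
    exact (similar_of_agree hxy).mono (le_max_left _ _)

/-- There are only finitely many vertices up to similarity. -/
lemma exists_finite_representatives (r : ℝ) : ∃ V : Set (Space d), V.Finite ∧ V ⊆ T.verts ∧
    ∀ v ∈ T.verts, ∃ v₀ ∈ V, T.Similar r v v₀ := by
  -- The patch around a vertex is a subset of one fixed finite set, so only finitely many patches
  -- occur.
  set f : Space d → Set (Finset (Space d)) := fun v =>
    {s ∈ translate T.tiles v | (cell s ∩ Metric.closedBall 0 r).Nonempty}
  have hfin : (f '' T.verts).Finite := by
    refine (T.finite_seen r).finite_subsets.subset ?_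
    rintro _ ⟨v, hv, rfl⟩ s ⟨hs, hsr⟩
    exact ⟨v, hv, hs, hsr⟩
  choose! g hg using fun A (hA : A ∈ f '' T.verts) => hA
  refine ⟨g '' (f '' T.verts), hfin.image g, ?_, fun v hv => ?_⟩
  · rintro _ ⟨A, hA, rfl⟩
    exact (hg A hA).1
  · have hA : f v ∈ f '' T.verts := ⟨v, hv, rfl⟩
    refine ⟨g (f v), ⟨f v, hA, rfl⟩, fun s hs => ?_⟩
    have := Set.ext_iff.1 (hg (f v) hA).2 s
    simp only [f, mem_ofPred_eq, hs, and_true] at this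
    exact this.symm

lemma finite_verts_inter (x : Space d) (r : ℝ) : {v ∈ T.verts | dist v x ≤ r}.Finite := by
  refine ((T.finite_tiles_meeting x r).biUnion fun t _ => t.finite_toSet).subset ?_
  rintro v ⟨⟨t, ht, hv⟩, hvx⟩
  exact mem_biUnion (show t ∈ {t ∈ T.tiles | _} from ⟨ht, v, subset_convexHull _ _ hv, hvx⟩) hv

/-- The vertices at distance at most `r` from `x`. -/
def vertsIn (x : Space d) (r : ℝ) : Finset (Space d) := (T.finite_verts_inter x r).toFinset

lemma mem_vertsIn {x v : Space d} {r : ℝ} : v ∈ T.vertsIn x r ↔ v ∈ T.verts ∧ dist v x ≤ r := by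
  simp [vertsIn]

variable {T}

lemma Similar.mem_verts {x y v : Space d} (h : T.Similar r x y) (hv : v ∈ T.verts)
    (hvx : dist v x ≤ r) : v + (y - x) ∈ T.verts := by
  obtain ⟨t, ht, hvt⟩ := hv
  exact ⟨_, h.shift_mem ht (subset_convexHull _ _ hvt) hvx, by simpa [mem_shift] using hvt⟩

lemma Similar.vertsIn_eq {x y : Space d} (h : T.Similar r x y) :
    T.vertsIn y r = (T.vertsIn x r).map (addRightEmbedding (y - x)) := by
  ext v
  simp only [mem_vertsIn, Finset.mem_map, addRightEmbedding_apply]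
  constructor
  · rintro ⟨hv, hd⟩
    refine ⟨v + (x - y), ⟨Similar.mem_verts h.symm hv hd, ?_⟩, by abel⟩
    rw [dist_eq_norm] at hd ⊢
    rwa [show v + (x - y) - x = v - y by abel]
  · rintro ⟨u, ⟨hu, hd⟩, rfl⟩
    refine ⟨h.mem_verts hu hd, ?_⟩
    rw [dist_eq_norm] at hd ⊢
    rwa [show u + (y - x) - y = u - x by abel]

variable (T)

lemma exists_vertex_near (x : Space d) : ∃ v ∈ T.verts, dist v x ≤ T.mesh := by
  obtain ⟨t, ht, hx⟩ := T.isTiling.exists_mem_cell x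
  obtain ⟨v, hv⟩ := convexHull_nonempty_iff.1 ⟨x, hx⟩
  exact ⟨v, ⟨t, ht, hv⟩, T.dist_le_mesh ht (subset_convexHull _ _ hv) hx⟩

/-- A ball around any point lies in a slightly larger ball around a nearby vertex, and there are
only finitely many vertices up to similarity. -/
lemma exists_card_vertsIn_le (r : ℝ) : ∃ N : ℕ, ∀ x, (T.vertsIn x r).card ≤ N := by
  obtain ⟨V, hV, -, hrep⟩ := T.exists_finite_representatives (r + T.mesh)
  refine ⟨hV.toFinset.sup fun v => (T.vertsIn v (r + T.mesh)).card, fun x => ?_⟩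
  obtain ⟨v, hv, hvx⟩ := T.exists_vertex_near x
  obtain ⟨v₀, hv₀, h⟩ := hrep v hv
  calc (T.vertsIn x r).card ≤ (T.vertsIn v (r + T.mesh)).card := by
        refine Finset.card_le_card fun u hu => ?_
        rw [mem_vertsIn] at hu ⊢
        refine ⟨hu.1, ?_⟩
        have := dist_triangle u x v
        rw [dist_comm v x] at hvx
        linarith [hu.2]
    _ = (T.vertsIn v₀ (r + T.mesh)).card := by rw [Similar.vertsIn_eq h, Finset.card_map]
    _ ≤ _ := Finset.le_sup (f := fun v => (T.vertsIn v (r + T.mesh)).card)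
        (hV.mem_toFinset.2 hv₀)

end SimplicialTiling

/-! ### A pattern equivariant partition of unity -/

namespace SimplicialTiling

variable {d : ℕ} (T : SimplicialTiling d)

/-- The tiles which contain the vertex `v`, seen from `v`. -/
def star (v : Space d) : Set (Finset (Space d)) := {s | s ∈ translate T.tiles v ∧ (0 : Space d) ∈ s}

/-- The open star of the origin in a collection of simplices with vertex `0`. -/
def openStar (A : Set (Finset (Space d))) : Set (Space d) :=
  (⋃ a ∈ A, cell a) \ ⋃ a ∈ A, convexHull ℝ ((a : Set (Space d)) \ {0})

lemma mem_convexHull_shift_diff {t : Finset (Space d)} {v x : Space d} :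
    x ∈ convexHull ℝ ((shift t (-v) : Set (Space d)) \ {0}) ↔
      x + v ∈ convexHull ℝ ((t : Set (Space d)) \ {v}) := by
  have : (shift t (-v) : Set (Space d)) \ {0} = (· + -v) '' ((t : Set (Space d)) \ {v}) := by
    rw [image_sdiff (add_left_injective (-v)), coe_shift]
    simp
  rw [this, convexHull_image_add]
  simp

/-- The condition may range over all tiles: for a tile without `v` the excluded set is the whole
tile, which forces the tiles containing the point to contain `v`. -/
lemma mem_openStar_star {v x : Space d} :
    x ∈ openStar (T.star v) ↔
      ∀ t ∈ T.tiles, x + v ∉ convexHull ℝ ((t : Set (Space d)) \ {v}) := by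
  have hback : ∀ {t : Finset (Space d)}, t ∈ T.tiles → v ∈ t → shift t (-v) ∈ T.star v :=
    fun ht hv => ⟨shift_sub_mem_translate ht v, by simpa [mem_shift] using hv⟩
  simp only [openStar, Set.mem_sdiff, mem_iUnion, exists_prop, not_exists, not_and]
  constructor
  · rintro ⟨⟨a, ⟨ha, ha0⟩, hxa⟩, hn⟩ t ht hx
    have h := T.isTiling.mem_convexHull_diff (s := shift a v) ha ht subset_rfl
      (by simpa [mem_cell_shift] using hxa) hx
    refine hn a ⟨ha, ha0⟩ ?_
    have e : a = shift (shift a v) (-v) := by simp [shift_shift, shift_zero]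
    rw [e, mem_convexHull_shift_diff]
    exact h
  · intro h
    obtain ⟨t, ht, hxt⟩ := T.isTiling.exists_mem_cell (x + v)
    have hv : v ∈ t := by
      by_contra hv
      refine h t ht ?_
      rwa [sdiff_singleton_eq_self (by simpa using hv)]
    refine ⟨⟨_, hback ht hv, by simpa [mem_cell_shift] using hxt⟩, ?_⟩
    rintro a ⟨ha, -⟩ hxa
    refine h _ ha ?_
    have e : a = shift (shift a v) (-v) := by simp [shift_shift, shift_zero]
    rwa [e, mem_convexHull_shift_diff] at hxa

lemma isOpen_openStar_star (v : Space d) : IsOpen (openStar (T.star v)) := by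
  have hc : IsClosed (⋃ t ∈ T.tiles, convexHull ℝ ((t : Set (Space d)) \ {v})) :=
    T.isClosed_biUnion_of_subset_cell subset_rfl _ (fun t => convexHull_mono sdiff_subset)
      fun t => (t.finite_toSet.subset sdiff_subset).isClosed_convexHull ℝ
  have : openStar (T.star v) =
      (· + v) ⁻¹' (⋃ t ∈ T.tiles, convexHull ℝ ((t : Set (Space d)) \ {v}))ᶜ := by
    ext x
    simp [T.mem_openStar_star]
  rw [this]
  exact hc.isOpen_compl.preimage (by fun_prop)

open Classical in
/-- A smooth nonnegative function on the open star. -/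
def starBump (A : Set (Finset (Space d))) : Space d → ℝ :=
  if h : IsOpen (openStar A) then (h.exists_contDiff_support_eq (n := ⊤)).choose else 0

/-- The bump function of the vertex `v`. -/
def bump (v x : Space d) : ℝ := starBump (T.star v) (x - v)

lemma starBump_spec (v : Space d) : Function.support (starBump (T.star v)) = openStar (T.star v) ∧
    Smooth (starBump (T.star v)) ∧ Set.range (starBump (T.star v)) ⊆ Set.Icc 0 1 := by
  rw [starBump, dif_pos (T.isOpen_openStar_star v)]
  exact ((T.isOpen_openStar_star v).exists_contDiff_support_eq (n := ⊤)).choose_spec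

lemma smooth_bump (v : Space d) : Smooth (T.bump v) := by
  have := (T.starBump_spec v).2.1
  exact this.comp (contDiff_id.sub contDiff_const)

lemma bump_nonneg (v x : Space d) : 0 ≤ T.bump v x :=
  ((T.starBump_spec v).2.2 ⟨x - v, rfl⟩).1

lemma bump_ne_zero_iff {v x : Space d} :
    T.bump v x ≠ 0 ↔ ∀ t ∈ T.tiles, x ∉ convexHull ℝ ((t : Set (Space d)) \ {v}) := by
  have h := Set.ext_iff.1 (T.starBump_spec v).1 (x - v)
  rw [mem_openStar_star, sub_add_cancel] at h
  exact h

lemma mem_of_bump_ne_zero {v x : Space d} (h : T.bump v x ≠ 0) {t : Finset (Space d)}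
    (ht : t ∈ T.tiles) (hx : x ∈ cell t) : v ∈ t := by
  by_contra hv
  refine (T.bump_ne_zero_iff.1 h) t ht ?_
  rwa [sdiff_singleton_eq_self (by simpa using hv)]

lemma mem_vertsIn_of_mem {t : Finset (Space d)} (ht : t ∈ T.tiles) {v x : Space d} (hv : v ∈ t)
    (hx : x ∈ cell t) : v ∈ T.vertsIn x T.mesh :=
  T.mem_vertsIn.2 ⟨⟨t, ht, hv⟩, T.dist_le_mesh ht (subset_convexHull _ _ hv) hx⟩

lemma mem_vertsIn_of_bump_ne_zero {v x : Space d} (h : T.bump v x ≠ 0) :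
    v ∈ T.vertsIn x T.mesh := by
  obtain ⟨t, ht, hx⟩ := T.isTiling.exists_mem_cell x
  exact T.mem_vertsIn_of_mem ht (T.mem_of_bump_ne_zero h ht hx) hx

/-- The bump function is chosen for the collection `T.star v` and not for `v`, so vertices with
equal stars receive translates of one function. -/
lemma bump_eq_of_similar {v v' : Space d} (h : T.Similar 0 v v') (z : Space d) :
    T.bump v' (z + v') = T.bump v (z + v) := by
  have : T.star v = T.star v' := by
    ext s
    simp only [star, mem_ofPred_eq, and_congr_left_iff]
    intro hs
    exact h s ⟨0, subset_convexHull _ _ hs, by simp⟩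
  simp only [bump, this, add_sub_cancel_right]

/-- The sum of the bump functions. -/
def bumpSum (x : Space d) : ℝ := ∑ᶠ v, T.bump v x

lemma bumpSum_eq {x : Space d} {S : Finset (Space d)} (hS : ∀ v, T.bump v x ≠ 0 → v ∈ S) :
    T.bumpSum x = ∑ v ∈ S, T.bump v x :=
  finsum_eq_sum_of_support_subset _ fun v hv => hS v hv

lemma vertsIn_subset {x z : Space d} {r s : ℝ} (h : r + dist z x ≤ s) :
    T.vertsIn z r ⊆ T.vertsIn x s := by
  intro v hv
  rw [mem_vertsIn] at hv ⊢
  exact ⟨hv.1, (dist_triangle v z x).trans (by linarith [hv.2])⟩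

lemma smooth_bumpSum : Smooth T.bumpSum := by
  rw [Smooth, contDiff_iff_contDiffAt]
  intro x
  have h : T.bumpSum =ᶠ[𝓝 x] fun z => ∑ v ∈ T.vertsIn x (T.mesh + 1), T.bump v z := by
    filter_upwards [Metric.ball_mem_nhds x one_pos] with z hz
    refine T.bumpSum_eq fun v hv => ?_
    exact T.vertsIn_subset (by linarith [Metric.mem_ball.1 hz]) (T.mem_vertsIn_of_bump_ne_zero hv)
  refine ContDiffAt.congr_of_eventuallyEq ?_ h
  exact (ContDiff.sum fun v _ => T.smooth_bump v).contDiffAt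

/-- At each point the bump function of any vertex of the carrier is positive. -/
lemma bumpSum_pos (x : Space d) : 0 < T.bumpSum x := by
  obtain ⟨t, ht, hx⟩ := T.isTiling.exists_mem_cell x
  obtain ⟨v, hv, h⟩ := T.isTiling.exists_vertex_forall_notMem ht hx
  rw [T.bumpSum_eq fun v => T.mem_vertsIn_of_bump_ne_zero]
  refine Finset.sum_pos' (fun v _ => T.bump_nonneg v x) ⟨v, T.mem_vertsIn_of_mem ht hv hx, ?_⟩
  exact lt_of_le_of_ne (T.bump_nonneg v x) (T.bump_ne_zero_iff.2 h).symm

lemma bumpSum_eq_of_similar {x y : Space d} (h : T.Similar T.mesh x y) :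
    T.bumpSum y = T.bumpSum x := by
  rw [T.bumpSum_eq fun v => T.mem_vertsIn_of_bump_ne_zero,
    T.bumpSum_eq fun v => T.mem_vertsIn_of_bump_ne_zero, h.vertsIn_eq, Finset.sum_map]
  refine Finset.sum_congr rfl fun v hv => ?_
  have hd := (T.mem_vertsIn.1 hv).2
  have h0 : T.Similar 0 (x + (v - x)) (y + (v - x)) :=
    h.add (by rw [dist_eq_norm] at hd; linarith)
  rw [show x + (v - x) = v by abel, show y + (v - x) = v + (y - x) by abel] at h0
  have := T.bump_eq_of_similar h0 (x - v)
  rwa [show x - v + (v + (y - x)) = y by abel, sub_add_cancel] at this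

/-- The functions of a smooth partition of unity subordinate to the open stars of the vertices. -/
def part (v x : Space d) : ℝ := T.bump v x / T.bumpSum x

lemma smooth_part (v : Space d) : Smooth (T.part v) :=
  ContDiff.div (T.smooth_bump v) T.smooth_bumpSum fun x => (T.bumpSum_pos x).ne'

lemma part_nonneg (v x : Space d) : 0 ≤ T.part v x :=
  div_nonneg (T.bump_nonneg v x) (T.bumpSum_pos x).le

/-- A zero of a nonnegative function is a minimum, so the derivative vanishes as well. Thus `φ_v`
and `dφ_v` vanish pointwise on faces without `v`, even though such a face may touch the boundary of
the open star. -/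
lemma part_eq_zero {v x : Space d} (h : T.bump v x = 0) :
    T.part v x = 0 ∧ fderiv ℝ (T.part v) x = 0 := by
  have h0 : T.part v x = 0 := by simp [part, h]
  refine ⟨h0, IsLocalMin.fderiv_eq_zero (Eventually.of_forall fun z => ?_)⟩
  rw [h0]
  exact T.part_nonneg v z

lemma part_eq_zero_of_face {t : Finset (Space d)} (ht : t ∈ T.tiles) {s : Set (Space d)}
    (hs : s ⊆ t) {v x : Space d} (hx : x ∈ convexHull ℝ s) (hv : v ∉ s) :
    T.part v x = 0 ∧ fderiv ℝ (T.part v) x = 0 := by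
  refine T.part_eq_zero (by_contra fun h => T.bump_ne_zero_iff.1 h t ht (convexHull_mono ?_ hx))
  exact fun y hy => ⟨hs hy, fun e => hv (e ▸ hy)⟩

lemma part_eq_zero_of_notMem {v x : Space d} (h : v ∉ T.vertsIn x T.mesh) :
    T.part v x = 0 ∧ fderiv ℝ (T.part v) x = 0 :=
  T.part_eq_zero (by_contra fun h' => h (T.mem_vertsIn_of_bump_ne_zero h'))

lemma sum_part {x : Space d} {S : Finset (Space d)} (hS : T.vertsIn x T.mesh ⊆ S) :
    ∑ v ∈ S, T.part v x = 1 := by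
  simp only [part]
  rw [← Finset.sum_div, ← T.bumpSum_eq fun v hv => hS (T.mem_vertsIn_of_bump_ne_zero hv),
    div_self (T.bumpSum_pos x).ne']

lemma part_eq_of_similar {x y : Space d} (h : T.Similar T.mesh x y) (v : Space d) :
    T.part (v + (y - x)) y = T.part v x := by
  by_cases hv : v ∈ T.vertsIn x T.mesh
  · have hd := (T.mem_vertsIn.1 hv).2
    have h0 : T.Similar 0 (x + (v - x)) (y + (v - x)) :=
      h.add (by rw [dist_eq_norm] at hd; linarith)
    rw [show x + (v - x) = v by abel, show y + (v - x) = v + (y - x) by abel] at h0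
    have := T.bump_eq_of_similar h0 (x - v)
    rw [show x - v + (v + (y - x)) = y by abel, sub_add_cancel] at this
    rw [part, part, this, T.bumpSum_eq_of_similar h]
  · have hv' : v + (y - x) ∉ T.vertsIn y T.mesh := by
      rw [h.vertsIn_eq]
      simpa using hv
    rw [(T.part_eq_zero_of_notMem hv).1, (T.part_eq_zero_of_notMem hv').1]

/-- The extra unit of radius makes the values agree on a neighbourhood, and hence the derivatives.
-/
lemma part_fderiv_eq_of_similar {x y : Space d} (h : T.Similar (T.mesh + 1) x y) (v : Space d) :
    T.part (v + (y - x)) y = T.part v x ∧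
      fderiv ℝ (T.part (v + (y - x))) y = fderiv ℝ (T.part v) x := by
  refine ⟨T.part_eq_of_similar (SameTiles.mono h (by linarith)) v, ?_⟩
  have he : (fun z => T.part (v + (y - x)) (z + (y - x))) =ᶠ[𝓝 x] T.part v := by
    filter_upwards [Metric.ball_mem_nhds x one_pos] with z hz
    have hz' : ‖z - x‖ ≤ 1 := by
      rw [← dist_eq_norm]
      exact (Metric.mem_ball.1 hz).le
    have h' : T.Similar T.mesh (x + (z - x)) (y + (z - x)) := h.add (by linarith)
    have := T.part_eq_of_similar h' v
    rwa [show y + (z - x) - (x + (z - x)) = y - x by abel, show x + (z - x) = z by abel,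
      show y + (z - x) = z + (y - x) by abel] at this
  have := he.fderiv_eq (𝕜 := ℝ)
  rw [fderiv_comp_add_right] at this
  rwa [show x + (y - x) = y by abel] at this

lemma exists_ckBound_of_hasCompactSupport {f : Space d → ℝ} (hf : Smooth f)
    (hc : HasCompactSupport f) (k : ℕ) : ∃ M, 0 ≤ M ∧ CkBound k univ M f := by
  have h : ∀ j : ℕ, ∃ M, ∀ x, ‖iteratedFDeriv ℝ j f x‖ ≤ M := fun j =>
    (hf.continuous_iteratedFDeriv (m := j) (by exact_mod_cast le_top)
      ).bounded_above_of_compact_support (hc.iteratedFDeriv (𝕜 := ℝ) j)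
  choose M hM using h
  refine ⟨∑ j ∈ Finset.range (k + 1), |M j|, Finset.sum_nonneg fun j _ => abs_nonneg _,
    fun j hj x _ => ?_⟩
  refine (hM j x).trans ((le_abs_self _).trans ?_)
  exact Finset.single_le_sum (f := fun j => |M j|) (fun _ _ => abs_nonneg _)
    (Finset.mem_range.2 (by omega))

lemma hasCompactSupport_part (v : Space d) : HasCompactSupport (T.part v) := by
  refine HasCompactSupport.of_support_subset_isCompact (isCompact_closedBall v T.mesh) ?_
  intro x hx
  by_contra hxv
  refine hx (T.part_eq_zero_of_notMem fun h => hxv ?_).1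
  rw [Metric.mem_closedBall, dist_comm]
  exact (T.mem_vertsIn.1 h).2

/-- The functions of the partition of unity have uniformly bounded derivatives. -/
lemma exists_ckBound_part (k : ℕ) : ∃ M, 0 ≤ M ∧ ∀ v, CkBound k univ M (T.part v) := by
  -- The function of `v` is supported within `T.mesh` of `v`, and its value at a point is determined
  -- by the tiles within `T.mesh` of that point.
  obtain ⟨V, hV, -, hrep⟩ := T.exists_finite_representatives (2 * T.mesh)
  choose M hM0 hM using fun v =>
    exists_ckBound_of_hasCompactSupport (T.smooth_part v) (T.hasCompactSupport_part v) k
  refine ⟨∑ v ∈ hV.toFinset, M v, Finset.sum_nonneg fun v _ => hM0 v, fun v j hj x _ => ?_⟩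
  by_cases hv : v ∈ T.verts
  · obtain ⟨v₀, hv₀, h⟩ := hrep v hv
    have e : T.part v = fun z => T.part v₀ (z + (v₀ - v)) := by
      funext z
      by_cases hz : dist v z ≤ T.mesh
      · have h' : T.Similar T.mesh (v + (z - v)) (v₀ + (z - v)) :=
          h.add (by rw [dist_eq_norm'] at hz; linarith)
        have := T.part_eq_of_similar h' v
        rw [show v + (v₀ + (z - v) - (v + (z - v))) = v₀ by abel,
          show v + (z - v) = z by abel] at this
        rw [← this]
        congr 1
        abel
      · rw [(T.part_eq_zero_of_notMem fun h => hz (T.mem_vertsIn.1 h).2).1,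
          (T.part_eq_zero_of_notMem fun h => hz ?_).1]
        have := (T.mem_vertsIn.1 h).2
        rw [dist_eq_norm] at this ⊢
        rwa [show v₀ - (z + (v₀ - v)) = v - z by abel] at this
    rw [e, iteratedFDeriv_comp_add_right]
    refine (hM v₀ j hj _ (mem_univ _)).trans ?_
    exact Finset.single_le_sum (f := M) (fun v _ => hM0 v) (hV.mem_toFinset.2 hv₀)
  · have e : T.part v = fun _ => 0 := by
      funext z
      exact (T.part_eq_zero_of_notMem fun h => hv (T.mem_vertsIn.1 h).1).1
    rw [e, iteratedFDeriv_fun_zero]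
    simpa using Finset.sum_nonneg fun v _ => hM0 v

end SimplicialTiling

/-! ### The global operators -/

namespace SimplicialTiling

variable {d : ℕ} (T : SimplicialTiling d) {n : ℕ}

/-- The homotopy operator on forms given by the partition of unity of the tiling. -/
def homotopy (n : ℕ) (ω : Form (Space d) (n + 1)) : Form (Space d) n :=
  fun x => homotopyOp (T.vertsIn x T.mesh) T.part n ω x

/-- The Whitney form of a cochain. -/
def whitneyForm (n : ℕ) (c : (Fin (n + 1) → Space d) → ℝ) : Form (Space d) n :=
  fun x => whitney (T.vertsIn x T.mesh) T.part n c x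

lemma homotopy_eq {x : Space d} {S : Finset (Space d)} (hS : T.vertsIn x T.mesh ⊆ S)
    (ω : Form (Space d) (n + 1)) : T.homotopy n ω x = homotopyOp S T.part n ω x :=
  homotopyOp_subset hS (fun _ _ hv => T.part_eq_zero_of_notMem hv) ω

lemma whitneyForm_eq {x : Space d} {S : Finset (Space d)} (hS : T.vertsIn x T.mesh ⊆ S)
    (c : (Fin (n + 1) → Space d) → ℝ) : T.whitneyForm n c x = whitney S T.part n c x :=
  whitney_subset hS (fun _ _ hv => T.part_eq_zero_of_notMem hv) c

lemma vertsIn_subset_of_mem_ball {x z : Space d} (hz : z ∈ Metric.ball x 1) :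
    T.vertsIn z T.mesh ⊆ T.vertsIn x (T.mesh + 1) :=
  T.vertsIn_subset (by linarith [Metric.mem_ball.1 hz])

/-- The set of vertices in the definition varies with the point. On a unit ball it can be replaced
by one larger finite set, so that the formulas for fixed sets can be differentiated. -/
lemma homotopy_eventuallyEq (x : Space d) (ω : Form (Space d) (n + 1)) :
    T.homotopy n ω =ᶠ[𝓝 x] homotopyOp (T.vertsIn x (T.mesh + 1)) T.part n ω := by
  filter_upwards [Metric.ball_mem_nhds x one_pos] with z hz
  exact T.homotopy_eq (T.vertsIn_subset_of_mem_ball hz) ω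

lemma whitneyForm_eventuallyEq (x : Space d) (c : (Fin (n + 1) → Space d) → ℝ) :
    T.whitneyForm n c =ᶠ[𝓝 x] whitney (T.vertsIn x (T.mesh + 1)) T.part n c := by
  filter_upwards [Metric.ball_mem_nhds x one_pos] with z hz
  exact T.whitneyForm_eq (T.vertsIn_subset_of_mem_ball hz) c

lemma smooth_homotopy {ω : Form (Space d) (n + 1)} (hω : Smooth ω) : Smooth (T.homotopy n ω) := by
  rw [Smooth, contDiff_iff_contDiffAt]
  exact fun x => ContDiffAt.congr_of_eventuallyEq
    (smooth_homotopyOp _ _ T.smooth_part hω).contDiffAt (T.homotopy_eventuallyEq x ω)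

lemma smooth_whitneyForm (c : (Fin (n + 1) → Space d) → ℝ) : Smooth (T.whitneyForm n c) := by
  rw [Smooth, contDiff_iff_contDiffAt]
  exact fun x => ContDiffAt.congr_of_eventuallyEq
    (smooth_whitney _ _ T.smooth_part c).contDiffAt (T.whitneyForm_eventuallyEq x c)

lemma extDeriv_congr {ω η : Form (Space d) n} {x : Space d} (h : ω =ᶠ[𝓝 x] η) :
    extDeriv ω x = extDeriv η x := by
  rw [extDeriv, extDeriv, h.fderiv_eq]

lemma sum_part_vertsIn {x z : Space d} (hz : z ∈ Metric.ball x 1) :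
    ∑ v ∈ T.vertsIn x (T.mesh + 1), T.part v z = 1 :=
  T.sum_part (T.vertsIn_subset_of_mem_ball hz)

lemma extDeriv_homotopy_add {ω : Form (Space d) (n + 1)} (hω : Smooth ω) (x : Space d) :
    extDeriv (T.homotopy n ω) x + T.homotopy (n + 1) (extDeriv ω) x =
      ω x - T.whitneyForm (n + 1) (coneIntegral (n + 1) ω) x := by
  have hx := Metric.mem_ball_self (x := x) one_pos
  rw [extDeriv_congr (T.homotopy_eventuallyEq x ω), T.homotopy_eq (T.vertsIn_subset_of_mem_ball hx),
    T.whitneyForm_eq (T.vertsIn_subset_of_mem_ball hx)]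
  exact extDeriv_homotopyOp_add T.smooth_part Metric.isOpen_ball
    (fun z hz => T.sum_part_vertsIn hz) hω hx

lemma homotopy_extDeriv_zero {ω : Form (Space d) 0} (hω : Smooth ω) (x : Space d) :
    T.homotopy 0 (extDeriv ω) x = ω x - T.whitneyForm 0 (coneIntegral 0 ω) x :=
  homotopyOp_extDeriv_zero (T.sum_part subset_rfl) hω

lemma whitneyForm_coboundary (b : (Fin (n + 1) → Space d) → ℝ) (x : Space d) :
    T.whitneyForm (n + 1) (coboundary n b) x = extDeriv (T.whitneyForm n b) x := by
  have hx := Metric.mem_ball_self (x := x) one_pos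
  rw [extDeriv_congr (T.whitneyForm_eventuallyEq x b),
    T.whitneyForm_eq (T.vertsIn_subset_of_mem_ball hx)]
  exact whitney_coboundary T.smooth_part Metric.isOpen_ball
    (fun z hz => T.sum_part_vertsIn hz) b hx

/-- The Whitney form only depends on the values of the cochain on the tuples of vertices of the
tiles. -/
lemma whitneyForm_congr {c c' : (Fin (n + 1) → Space d) → ℝ}
    (h : ∀ t ∈ T.tiles, ∀ w : Fin (n + 1) → Space d, (∀ i, w i ∈ t) → c w = c' w) :
    T.whitneyForm n c = T.whitneyForm n c' := by
  funext x
  obtain ⟨t, ht, hx⟩ := T.isTiling.exists_mem_cell x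
  exact whitney_congr (A := t) (fun v _ hv => T.part_eq_zero_of_face ht subset_rfl hx hv)
    fun w hw => h t ht w hw

lemma extDeriv_whitneyForm_eq_zero {c : (Fin (n + 1) → Space d) → ℝ}
    (h : ∀ t ∈ T.tiles, ∀ w : Fin (n + 2) → Space d, (∀ i, w i ∈ t) → coboundary n c w = 0)
    (x : Space d) : extDeriv (T.whitneyForm n c) x = 0 := by
  rw [← T.whitneyForm_coboundary, T.whitneyForm_congr (c' := fun _ => 0) h]
  have := whitney_sub (S := T.vertsIn x T.mesh) (φ := T.part) (n := n + 1) (fun _ => (0 : ℝ))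
    (fun _ => 0) x
  simpa [whitneyForm] using this

/-- Integration is a left inverse of the Whitney map. -/
lemma coneIntegral_whitneyForm {c : (Fin (n + 1) → Space d) → ℝ} (hc : IsAlternating c)
    {t : Finset (Space d)} (ht : t ∈ T.tiles) {w : Fin (n + 1) → Space d} (hw : ∀ i, w i ∈ t) :
    coneIntegral n (T.whitneyForm n c) w = c w := by
  set x := w 0
  have hsub : Set.range w ⊆ (t : Set (Space d)) := by
    rintro _ ⟨i, rfl⟩
    exact hw i
  have hball : convexHull ℝ (Set.range w) ⊆ Metric.ball x (T.mesh + 1) := by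
    intro z hz
    rw [Metric.mem_ball]
    exact lt_of_le_of_lt (T.dist_le_mesh ht (convexHull_mono hsub hz)
      (subset_convexHull _ _ (hw 0))) (lt_add_one _)
  have hS : ∀ z ∈ Metric.ball x (T.mesh + 1),
      T.vertsIn z T.mesh ⊆ T.vertsIn x (T.mesh + (T.mesh + 1)) := fun z hz =>
    T.vertsIn_subset (by linarith [Metric.mem_ball.1 hz])
  rw [coneIntegral_congr (convex_ball x (T.mesh + 1)) (fun z hz => T.whitneyForm_eq (hS z hz) c)
    fun i => hball (subset_convexHull _ _ ⟨i, rfl⟩)]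
  exact coneIntegral_whitney T.smooth_part Metric.isOpen_ball
    (fun z hz => T.sum_part (hS z hz)) hc hball
    fun s hs z hz v _ hv => T.part_eq_zero_of_face ht (hs.trans hsub) hz hv

/-! ### Quantitative pattern equivariance -/

/-- The derivatives of order at most `k` at points with similar neighbourhoods of radius `R` differ
by at most `ε`. -/
def PEBound {F : Type*} [NormedAddCommGroup F] [NormedSpace ℝ F] (k : ℕ) (ε R : ℝ)
    (f : Space d → F) : Prop :=
  ∀ x y, T.Similar R x y → CkBound k {x} ε fun z => f (z + (y - x)) - f z

section PEBound

variable {T} {F : Type*} [NormedAddCommGroup F] [NormedSpace ℝ F] {k : ℕ} {ε ε' R R' : ℝ}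
  {f : Space d → F}

lemma PEBound.mono (h : T.PEBound k ε R f) (hε : ε ≤ ε') (hR : R ≤ R') : T.PEBound k ε' R' f :=
  fun x y hxy => (h x y (SameTiles.mono hxy hR)).mono hε

lemma PEBound.ckBound_ball (h : T.PEBound k ε R f) {x y : Space d} {ρ : ℝ}
    (hxy : T.Similar (R + ρ) x y) :
    CkBound k (Metric.ball x ρ) ε fun z => f (z + (y - x)) - f z := by
  intro j hj z hz
  have hz' : ‖z - x‖ ≤ ρ := by
    rw [← dist_eq_norm]
    exact (Metric.mem_ball.1 hz).le
  have hs : T.Similar R (x + (z - x)) (y + (z - x)) := hxy.add (by linarith)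
  have := h _ _ hs j hj z (by simp)
  rwa [show y + (z - x) - (x + (z - x)) = y - x by abel] at this

/-- Equality of values at all similar points gives equality near `x` once the radius is enlarged by
one, hence equality of all derivatives. -/
lemma pebound_zero (h : ∀ x y, T.Similar R x y → f x = f y) : T.PEBound k 0 (R + 1) f := by
  intro x y hxy
  have h0 : CkBound k (Metric.ball x 1) 0 fun _ : Space d => (0 : F) := by
    intro j _ z _
    rw [iteratedFDeriv_fun_zero]
    simp
  refine (h0.congr Metric.isOpen_ball fun z hz => ?_).mono_set
    (singleton_subset_iff.2 (Metric.mem_ball_self one_pos))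
  have hz' : ‖z - x‖ ≤ 1 := by
    rw [← dist_eq_norm]
    exact (Metric.mem_ball.1 hz).le
  have hs : T.Similar R (x + (z - x)) (y + (z - x)) := hxy.add (by linarith)
  have := h _ _ hs
  rw [show x + (z - x) = z by abel, show y + (z - x) = z + (y - x) by abel] at this
  rw [this, sub_self]

lemma PEBound.norm_sub_le (h : T.PEBound k ε R f) {x y : Space d} (hxy : T.Similar R x y) :
    ‖f y - f x‖ ≤ ε := by
  have := h x y hxy 0 (Nat.zero_le _) x rfl
  rw [norm_iteratedFDeriv_zero] at this
  rwa [show x + (y - x) = y by abel] at this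

end PEBound

lemma mem_strongForms_iff {ω : smoothForms d n} :
    ω ∈ T.strongForms n ↔ ∃ R, 0 ≤ R ∧ ∀ k, T.PEBound k 0 R ω.1 := by
  change (∃ R : ℝ, 0 < R ∧ T.IsPatternEquivariant ω.1 R) ↔ _
  rw [T.exists_isPatternEquivariant_iff]
  constructor
  · rintro ⟨R, h⟩
    exact ⟨max R 0 + 1, by positivity, fun k => pebound_zero fun x y hxy =>
      h x y (SameTiles.mono hxy (le_max_left _ _))⟩
  · rintro ⟨R, -, h⟩
    refine ⟨R, fun x y hxy => ?_⟩
    have := (h 0).norm_sub_le hxy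
    rw [norm_le_zero_iff, sub_eq_zero] at this
    exact this.symm

lemma exists_ckBound_clm {E F G : Type*} [NormedAddCommGroup E] [NormedSpace ℝ E]
    [NormedAddCommGroup F] [NormedSpace ℝ F] [NormedAddCommGroup G] [NormedSpace ℝ G]
    (L : F →L[ℝ] G) : ∃ C, 0 ≤ C ∧ ∀ (k : ℕ) (B : Set E) (A : ℝ) (f : E → F), Smooth f →
      CkBound k B A f → CkBound k B (C * A) fun z => L (f z) :=
  ⟨‖L‖, norm_nonneg _, fun _ _ _ _ sf hf => hf.clm L sf⟩

lemma exists_pebound_extDeriv (n k : ℕ) : ∃ C, 0 ≤ C ∧ ∀ (ω : Form (Space d) n) (ε R : ℝ),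
    Smooth ω → T.PEBound (k + 1) ε R ω → T.PEBound k (C * ε) R (extDeriv ω) := by
  obtain ⟨C, hC0, hC⟩ := exists_ckBound_clm (E := Space d)
    (F := Space d →L[ℝ] Space d [⋀^Fin n]→L[ℝ] ℝ) (G := Space d [⋀^Fin (n + 1)]→L[ℝ] ℝ)
    (alternatizeUncurryFinCLM ℝ (Space d) ℝ)
  refine ⟨C, hC0, fun ω ε R hω h x y hxy => ?_⟩
  have hs : Smooth fun z => ω (z + (y - x)) := hω.comp_add _
  have hd : Smooth fun z => ω (z + (y - x)) - ω z := hs.sub hω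
  have h1 := hC k {x} ε _ hd.fderiv (h x y hxy).fderiv
  convert h1 using 1
  funext z
  have e := extDeriv_fun_sub_form hs hω z
  have e2 : extDeriv (fun z => ω (z + (y - x))) z = extDeriv ω (z + (y - x)) := by
    rw [extDeriv, extDeriv, fderiv_comp_add_right]
  rw [e2] at e
  exact e.symm

/-- With `a = y - x`, translating by `a` identifies the vertices and partition functions near `x`
with those near `y`. By linearity the difference of the two outputs is the operator applied to `ω (z
+ a) - ω z`, which is small on a ball containing the vertices involved; the operator is bounded
uniformly. The radius `T.mesh + 2` puts the vertices at distance at most `T.mesh + 1` strictly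
inside that ball. -/
lemma exists_pebound_homotopy (n k : ℕ) : ∃ C, 0 ≤ C ∧
    ∀ (ω : Form (Space d) (n + 1)) (ε R : ℝ), Smooth ω → 0 ≤ ε → 0 ≤ R →
      T.PEBound k ε R ω → T.PEBound k (C * ε) (R + (T.mesh + 2)) (T.homotopy n ω) := by
  obtain ⟨N, hN⟩ := T.exists_card_vertsIn_le (T.mesh + 1)
  obtain ⟨M, hM0, hM⟩ := T.exists_ckBound_part (k + 1)
  obtain ⟨C, hC0, hC⟩ := ckBound_homotopyOp (E := Space d) n k N (T.mesh + 2) M hM0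
  refine ⟨C, hC0, fun ω ε R hω hε hR h x y hxy => ?_⟩
  set a := y - x
  set S := T.vertsIn x (T.mesh + 1)
  have hs : Smooth fun z => ω (z + a) := hω.comp_add _
  have hb := hC x S T.part (fun z => ω (z + a) - ω z) ε hε T.smooth_part (hs.sub hω) (hN x)
    (fun v hv => by
      rw [Metric.mem_ball]
      linarith [(T.mem_vertsIn.1 hv).2])
    (fun v _ => (hM v).mono_set (subset_univ _)) (h.ckBound_ball hxy)
  have hsub : Metric.ball x 1 ⊆ Metric.ball x (T.mesh + 2) :=
    Metric.ball_subset_ball (by linarith [T.mesh_pos])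
  refine ((hb.mono_set hsub).congr Metric.isOpen_ball fun z hz => ?_).mono_set
    (singleton_subset_iff.2 (Metric.mem_ball_self one_pos))
  have hz' : ‖z - x‖ ≤ 1 := by
    rw [← dist_eq_norm]
    exact (Metric.mem_ball.1 hz).le
  have hza : z + a ∈ Metric.ball y 1 := by
    rw [Metric.mem_ball, dist_eq_norm] at hz ⊢
    rwa [show z + a - y = z - x by simp only [a]; abel]
  have hzs : T.Similar (T.mesh + 1) (x + (z - x)) (y + (z - x)) := hxy.add (by linarith)
  rw [show x + (z - x) = z by abel, show y + (z - x) = z + a by simp only [a]; abel] at hzs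
  have hS : T.vertsIn y (T.mesh + 1) = S.map (addRightEmbedding a) :=
    Similar.vertsIn_eq (SameTiles.mono hxy (by linarith))
  rw [T.homotopy_eq (T.vertsIn_subset_of_mem_ball hza), hS,
    homotopyOp_translate a (fun v _ => by simpa using T.part_fderiv_eq_of_similar hzs v) ω,
    T.homotopy_eq (T.vertsIn_subset_of_mem_ball hz), ← homotopyOp_sub S T.part hs hω]

/-- The values of the cochain on tuples near points with similar neighbourhoods of radius `R` differ
by at most `ε`. -/
def CochainBound (ε R : ℝ) (c : (Fin n → Space d) → ℝ) : Prop :=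
  ∀ x y, T.Similar R x y → ∀ w : Fin n → Space d, (∀ i, w i ∈ T.vertsIn x (T.mesh + 1)) →
    |c (fun i => w i + (y - x)) - c w| ≤ ε

/-- As for the homotopy operator: the difference of the forms near similar points is the Whitney
form of the difference of the cochains. -/
lemma exists_pebound_whitneyForm (n k : ℕ) : ∃ C, 0 ≤ C ∧
    ∀ (c : (Fin (n + 1) → Space d) → ℝ) (ε R : ℝ), 0 ≤ ε → 0 ≤ R →
      T.CochainBound ε R c → T.PEBound k (C * ε) (R + (T.mesh + 2)) (T.whitneyForm n c) := by
  obtain ⟨N, hN⟩ := T.exists_card_vertsIn_le (T.mesh + 1)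
  obtain ⟨M, hM0, hM⟩ := T.exists_ckBound_part (k + 1)
  obtain ⟨C, hC0, hC⟩ := ckBound_whitney (E := Space d) n k N M hM0
  refine ⟨C, hC0, fun c ε R hε hR h x y hxy => ?_⟩
  set a := y - x
  set S := T.vertsIn x (T.mesh + 1)
  have hb := hC (Metric.ball x 1) S T.part (fun w => c (fun i => w i + a) - c w) ε hε T.smooth_part
    (hN x) (fun v _ => (hM v).mono_set (subset_univ _))
    (h x y (SameTiles.mono hxy (by linarith [T.mesh_pos])))
  refine (hb.congr Metric.isOpen_ball fun z hz => ?_).mono_set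
    (singleton_subset_iff.2 (Metric.mem_ball_self one_pos))
  have hz' : ‖z - x‖ ≤ 1 := by
    rw [← dist_eq_norm]
    exact (Metric.mem_ball.1 hz).le
  have hza : z + a ∈ Metric.ball y 1 := by
    rw [Metric.mem_ball, dist_eq_norm] at hz ⊢
    rwa [show z + a - y = z - x by simp only [a]; abel]
  have hzs : T.Similar (T.mesh + 1) (x + (z - x)) (y + (z - x)) := hxy.add (by linarith)
  rw [show x + (z - x) = z by abel, show y + (z - x) = z + a by simp only [a]; abel] at hzs
  have hS : T.vertsIn y (T.mesh + 1) = S.map (addRightEmbedding a) :=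
    Similar.vertsIn_eq (SameTiles.mono hxy (by linarith))
  rw [T.whitneyForm_eq (T.vertsIn_subset_of_mem_ball hza), hS,
    whitney_translate a (fun v _ => by simpa using T.part_fderiv_eq_of_similar hzs v) c,
    T.whitneyForm_eq (T.vertsIn_subset_of_mem_ball hz), ← whitney_sub]

end SimplicialTiling

/-! ### Weakly pattern equivariant forms -/

namespace SimplicialTiling

variable {d : ℕ} (T : SimplicialTiling d) {n : ℕ}

/-- A choice of representatives of the points up to similarity. -/
lemma exists_representative (R : ℝ) : ∃ rep : Space d → Space d,
    (∀ v, T.Similar R v (rep v)) ∧ ∀ v v', T.Similar R v v' → rep v = rep v' := by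
  let s : Setoid (Space d) := ⟨T.Similar R, fun _ => SameTiles.refl _ _, SameTiles.symm,
    SameTiles.trans⟩
  refine ⟨fun v => (Quotient.mk s v).out, fun v => ?_, fun v v' h => ?_⟩
  · exact SameTiles.symm (Quotient.exact (Quotient.out_eq (Quotient.mk s v)))
  · have : Quotient.mk s v = Quotient.mk s v' := Quotient.sound h
    simp only [this]

/-- The strongly pattern equivariant approximation of a form, which near the vertex `v` is the
translate of the form near the representative of `v`. -/
def patchForm (rep : Space d → Space d) (ω : Form (Space d) n) : Form (Space d) n :=
  fun x => ∑ v ∈ T.vertsIn x T.mesh, T.part v x • ω (x + (rep v - v))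

lemma patchForm_eq (rep : Space d → Space d) (ω : Form (Space d) n) {x : Space d}
    {S : Finset (Space d)} (hS : T.vertsIn x T.mesh ⊆ S) :
    T.patchForm rep ω x = ∑ v ∈ S, T.part v x • ω (x + (rep v - v)) :=
  Finset.sum_subset hS fun v _ hv => by rw [(T.part_eq_zero_of_notMem hv).1, zero_smul]

lemma smooth_patchForm (rep : Space d → Space d) {ω : Form (Space d) n} (hω : Smooth ω) :
    Smooth (T.patchForm rep ω) := by
  rw [Smooth, contDiff_iff_contDiffAt]
  intro x
  have h : T.patchForm rep ω =ᶠ[𝓝 x] fun z => ∑ v ∈ T.vertsIn x (T.mesh + 1),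
      T.part v z • ω (z + (rep v - v)) := by
    filter_upwards [Metric.ball_mem_nhds x one_pos] with z hz
    exact T.patchForm_eq rep ω (T.vertsIn_subset_of_mem_ball hz)
  refine ContDiffAt.congr_of_eventuallyEq (ContDiff.contDiffAt ?_) h
  exact ContDiff.sum fun v _ => (T.smooth_part v).smul (hω.comp_add _)

lemma patchForm_similar {R : ℝ} (hR : 0 ≤ R) {rep : Space d → Space d}
    (hrep : ∀ v v', T.Similar R v v' → rep v = rep v') (ω : Form (Space d) n) {x y : Space d}
    (h : T.Similar (R + T.mesh) x y) : T.patchForm rep ω x = T.patchForm rep ω y := by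
  have hm : T.Similar T.mesh x y := SameTiles.mono h (by linarith)
  rw [patchForm, patchForm, hm.vertsIn_eq, Finset.sum_map]
  refine Finset.sum_congr rfl fun v hv => ?_
  have hd := (T.mem_vertsIn.1 hv).2
  rw [dist_eq_norm] at hd
  have hv' : T.Similar R (x + (v - x)) (y + (v - x)) := h.add (by linarith)
  rw [show x + (v - x) = v by abel, show y + (v - x) = v + (y - x) by abel] at hv'
  rw [addRightEmbedding_apply, T.part_eq_of_similar hm, hrep _ _ hv']
  congr 2
  abel

/-- A uniform limit of strong forms satisfies the estimate by the triangle inequality. Conversely,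
replacing the form near each vertex by its translate from a representative vertex gives a strong
form, and the estimate says that this changes the derivatives only slightly. -/
lemma mem_weakForms_iff {ω : smoothForms d n} :
    ω ∈ T.weakForms n ↔ ∀ (k : ℕ) (ε : ℝ), 0 < ε → ∃ R, 0 ≤ R ∧ T.PEBound k ε R ω.1 := by
  have hω : Smooth ω.1 := ω.2
  constructor
  · intro h k ε hε
    obtain ⟨η, hη, hb⟩ := h k (ε / 2) (half_pos hε)
    obtain ⟨R, hR, hηR⟩ := T.mem_strongForms_iff.1 hη
    refine ⟨R, hR, fun x y hxy => ?_⟩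
    set a := y - x
    have sη : Smooth η.1 := η.2
    set f : Form (Space d) n := (ω - η : smoothForms d n).1
    have sf : Smooth f := (ω - η : smoothForms d n).2
    have hf : CkBound k {x} (ε / 2) f := fun j hj z _ => hb j hj z
    have hfa : CkBound k {x} (ε / 2) fun z => f (z + a) := by
      intro j hj z _
      rw [iteratedFDeriv_comp_add_right]
      exact hb j hj _
    have h2 := (hfa.sub hf (sf.comp_add a) sf).add (hηR k x y hxy)
      (ContDiff.sub (sf.comp_add a) sf) (ContDiff.sub (sη.comp_add a) sη)
    rw [add_halves, add_zero] at h2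
    convert h2 using 1
    funext z
    change ω.1 (z + a) - ω.1 z = ((ω.1 (z + a) - η.1 (z + a)) - (ω.1 z - η.1 z)) +
      (η.1 (z + a) - η.1 z)
    abel
  · intro h k ε hε
    obtain ⟨N, hN⟩ := T.exists_card_vertsIn_le (T.mesh + 1)
    obtain ⟨M, hM0, hM⟩ := T.exists_ckBound_part k
    -- Number of patches times the Leibniz constant times the bound for the partition of unity; the
    -- summand `1` makes it positive.
    set C := N * (2 ^ k * M) + 1
    have hC : 0 < C := by positivity
    obtain ⟨R, hR, hωR⟩ := h k (ε / C) (by positivity)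
    -- The summands near `x` involve vertices at distance at most `T.mesh + 1`, so similarity at the
    -- vertex with this excess radius gives similarity of radius `R` at `x`.
    obtain ⟨rep, hrep1, hrep2⟩ := T.exists_representative (R + (T.mesh + 1))
    have sη := T.smooth_patchForm rep hω
    refine ⟨⟨T.patchForm rep ω.1, sη⟩, ?_, ?_⟩
    · rw [mem_strongForms_iff]
      refine ⟨R + (T.mesh + 1) + T.mesh + 1, by have := T.mesh_pos; positivity, fun k' => ?_⟩
      exact pebound_zero fun x y hxy => T.patchForm_similar (by have := T.mesh_pos; positivity)
        hrep2 ω.1 hxy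
    · intro j hj x
      set S := T.vertsIn x (T.mesh + 1)
      have hterm : ∀ v ∈ S, CkBound k {x} (2 ^ k * M * (ε / C))
          (fun z => T.part v z • (ω.1 (z + (rep v - v)) - ω.1 z)) := by
        intro v hv
        have hd := (T.mem_vertsIn.1 hv).2
        rw [dist_eq_norm'] at hd
        have hs : T.Similar R (v + (x - v)) (rep v + (x - v)) := (hrep1 v).add (by linarith)
        have hb := hωR _ _ hs
        rw [show rep v + (x - v) - (v + (x - v)) = rep v - v by abel,
          show v + (x - v) = x by abel] at hb
        exact ckBound_smul k (T.smooth_part v) (ContDiff.sub (hω.comp_add _) hω)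
          ((hM v).mono_set (subset_univ _)) hb
      have hsm : ∀ v ∈ S, Smooth fun z => T.part v z • (ω.1 (z + (rep v - v)) - ω.1 z) :=
        fun v _ => (T.smooth_part v).smul (ContDiff.sub (hω.comp_add _) hω)
      have hsum := CkBound.sum S hterm hsm j hj x rfl
      have heq : (-(ω.1 - T.patchForm rep ω.1)) =ᶠ[𝓝 x]
          fun z => ∑ v ∈ S, T.part v z • (ω.1 (z + (rep v - v)) - ω.1 z) := by
        filter_upwards [Metric.ball_mem_nhds x one_pos] with z hz
        simp only [smul_sub, Finset.sum_sub_distrib]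
        rw [← Finset.sum_smul, T.sum_part_vertsIn hz, one_smul,
          ← T.patchForm_eq rep ω.1 (T.vertsIn_subset_of_mem_ball hz), neg_sub,
          Pi.sub_apply]
      rw [← (heq.iteratedFDeriv ℝ j).self_of_nhds, iteratedFDeriv_neg_apply, norm_neg] at hsum
      refine hsum.trans ?_
      have hN' : (S.card : ℝ) ≤ N := by exact_mod_cast hN x
      calc (S.card : ℝ) * (2 ^ k * M * (ε / C)) ≤ N * (2 ^ k * M * (ε / C)) :=
            mul_le_mul_of_nonneg_right hN' (by positivity)
        _ = (C - 1) * (ε / C) := by simp only [C]; ring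
        _ ≤ C * (ε / C) := mul_le_mul_of_nonneg_right (by linarith) (by positivity)
        _ = ε := by field_simp

lemma strongForms_le_weakForms : T.strongForms n ≤ T.weakForms n := by
  intro ω h
  rw [mem_weakForms_iff]
  obtain ⟨R, hR, h⟩ := T.mem_strongForms_iff.1 h
  exact fun k ε hε => ⟨R, hR, (h k).mono hε.le le_rfl⟩

/-- An operator which controls the pattern equivariance preserves the weakly pattern equivariant
forms. -/
lemma exists_pebound_of_operator {C ρ : ℝ} (hC : 0 ≤ C) {P Q : ℝ → ℝ → Prop}
    (hPQ : ∀ ε R, 0 ≤ ε → 0 ≤ R → P ε R → Q (C * ε) (R + ρ)) (hρ : 0 ≤ ρ)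
    (hQ : ∀ ε ε' R, ε ≤ ε' → Q ε R → Q ε' R)
    (h : ∀ ε, 0 < ε → ∃ R, 0 ≤ R ∧ P ε R) {ε : ℝ} (hε : 0 < ε) : ∃ R, 0 ≤ R ∧ Q ε R := by
  obtain ⟨R, hR, hP⟩ := h (ε / (C + 1)) (by positivity)
  refine ⟨R + ρ, by positivity, hQ _ _ _ ?_ (hPQ _ _ (by positivity) hR hP)⟩
  rw [mul_div_assoc', div_le_iff₀ (by positivity)]
  nlinarith

lemma extD_mem_weakForms {ω : smoothForms d n} (h : ω ∈ T.weakForms n) :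
    extD d n ω ∈ T.weakForms (n + 1) := by
  rw [mem_weakForms_iff] at h ⊢
  intro k ε hε
  obtain ⟨C, hC0, hC⟩ := T.exists_pebound_extDeriv n k
  exact exists_pebound_of_operator hC0 (P := fun ε R => T.PEBound (k + 1) ε R ω.1)
    (Q := fun ε R => T.PEBound k ε R (extDeriv ω.1))
    (fun ε R _ _ hP => by rw [add_zero]; exact hC ω.1 ε R ω.2 hP) le_rfl
    (fun ε ε' R hεε' hQ => PEBound.mono hQ hεε' le_rfl) (h (k + 1)) hε

lemma homotopy_mem_strongForms {ω : smoothForms d (n + 1)} (h : ω ∈ T.strongForms (n + 1)) :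
    (⟨T.homotopy n ω.1, T.smooth_homotopy ω.2⟩ : smoothForms d n) ∈ T.strongForms n := by
  rw [mem_strongForms_iff] at h ⊢
  obtain ⟨R, hR, h⟩ := h
  refine ⟨R + (T.mesh + 2), by have := T.mesh_pos; positivity, fun k => ?_⟩
  obtain ⟨C, -, hC⟩ := T.exists_pebound_homotopy n k
  simpa using hC ω.1 0 R ω.2 le_rfl hR (h k)

lemma homotopy_mem_weakForms {ω : smoothForms d (n + 1)} (h : ω ∈ T.weakForms (n + 1)) :
    (⟨T.homotopy n ω.1, T.smooth_homotopy ω.2⟩ : smoothForms d n) ∈ T.weakForms n := by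
  rw [mem_weakForms_iff] at h ⊢
  intro k ε hε
  obtain ⟨C, hC0, hC⟩ := T.exists_pebound_homotopy n k
  exact exists_pebound_of_operator hC0 (P := fun ε R => T.PEBound k ε R ω.1)
    (Q := fun ε R => T.PEBound k ε R (T.homotopy n ω.1))
    (fun ε R hε hR hP => hC ω.1 ε R ω.2 hε hR hP) (by have := T.mesh_pos; positivity)
    (fun ε ε' R hεε' hQ => PEBound.mono hQ hεε' le_rfl) (h k) hε

/-- The Whitney form as a smooth form. -/
def whitneySmooth (n : ℕ) (c : (Fin (n + 1) → Space d) → ℝ) : smoothForms d n :=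
  ⟨T.whitneyForm n c, T.smooth_whitneyForm c⟩

lemma whitneySmooth_mem_strongForms {c : (Fin (n + 1) → Space d) → ℝ}
    (h : ∃ R, 0 ≤ R ∧ T.CochainBound 0 R c) : T.whitneySmooth n c ∈ T.strongForms n := by
  rw [mem_strongForms_iff]
  obtain ⟨R, hR, h⟩ := h
  refine ⟨R + (T.mesh + 2), by have := T.mesh_pos; positivity, fun k => ?_⟩
  obtain ⟨C, -, hC⟩ := T.exists_pebound_whitneyForm n k
  have := hC c 0 R le_rfl hR h
  rwa [mul_zero] at this

lemma whitneySmooth_mem_weakForms {c : (Fin (n + 1) → Space d) → ℝ}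
    (h : ∀ ε, 0 < ε → ∃ R, 0 ≤ R ∧ T.CochainBound ε R c) :
    T.whitneySmooth n c ∈ T.weakForms n := by
  rw [mem_weakForms_iff]
  intro k ε hε
  obtain ⟨C, hC0, hC⟩ := T.exists_pebound_whitneyForm n k
  exact exists_pebound_of_operator hC0 (P := fun ε R => T.CochainBound ε R c)
    (Q := fun ε R => T.PEBound k ε R (T.whitneyForm n c))
    (fun ε R hε hR hP => hC c ε R hε hR hP) (by have := T.mesh_pos; positivity)
    (fun ε ε' R hεε' hQ => PEBound.mono hQ hεε' le_rfl) h hε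

end SimplicialTiling

/-! ### Simplices of the tilings of the hull -/

namespace SimplicialTiling

variable {d : ℕ} {T : SimplicialTiling d} {n : ℕ} {K L : Set (Finset (Space d))}

namespace Simplex

/-- The simplex `c + x`, if its tile belongs to `L`. -/
def move (c : T.Simplex K n) (x : Space d) (h : shift c.tile (c.offset + x) ∈ L) :
    T.Simplex L n :=
  { c with offset := c.offset + x, shift_mem := h }

lemma vertex_move (c : T.Simplex K n) (x : Space d) (h : shift c.tile (c.offset + x) ∈ L)
    (i : Fin (n + 1)) : (c.move x h).vertex i = c.vertex i + x := by
  simp [move, vertex, add_assoc]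

lemma puncture_move (c : T.Simplex K n) (x : Space d) (h : shift c.tile (c.offset + x) ∈ L) :
    (c.move x h).puncture = c.puncture + x := by
  simp [move, puncture, add_assoc]

lemma vertex_face (c : T.Simplex K (n + 1)) (i : Fin (n + 2)) :
    (c.face i).vertex = c.vertex ∘ i.succAbove := rfl

lemma range_subset (c : T.Simplex K n) :
    (Set.range fun i => T.vert c.tile (c.emb i)) ⊆ (c.tile : Set (Space d)) := by
  rw [← T.range_vert _ c.tile_mem]
  rintro _ ⟨i, rfl⟩
  exact ⟨_, rfl⟩

lemma range_vertex (c : T.Simplex K n) :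
    Set.range c.vertex = (· + c.offset) '' Set.range fun i => T.vert c.tile (c.emb i) := by
  rw [← Set.range_comp]
  rfl

lemma vertex_mem (c : T.Simplex K n) (i : Fin (n + 1)) : c.vertex i ∈ shift c.tile c.offset := by
  rw [mem_shift]
  simpa [vertex] using c.range_subset ⟨i, rfl⟩

lemma range_vertex_subset (c : T.Simplex K n) :
    Set.range c.vertex ⊆ (shift c.tile c.offset : Set (Space d)) := by
  rintro _ ⟨i, rfl⟩
  exact c.vertex_mem i

lemma puncture_mem (c : T.Simplex K n) : c.puncture ∈ cell (shift c.tile c.offset) := by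
  rw [mem_cell_shift]
  simpa [puncture] using convexHull_mono c.range_subset
    (T.punc_mem c.tile c.tile_mem _ c.range_subset (Set.range_nonempty _))

lemma vertex_injective (c : T.Simplex K n) : Function.Injective c.vertex := by
  have hinj : Function.Injective (T.vert c.tile) := by
    have hr := T.range_vert _ c.tile_mem
    have hcard : Nat.card (Set.range (T.vert c.tile)) = d + 1 := by
      rw [hr]
      simpa using T.isTiling.card_eq _ c.tile_mem
    rw [← Set.injOn_univ, ← Set.ncard_image_iff Set.finite_univ, Set.image_univ, Set.ncard_univ]
    rw [Set.ncard_def, Set.encard] at *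
    simpa [Nat.card] using hcard
  intro i j hij
  exact c.emb.injective (hinj (add_right_cancel hij))

/-! The following lemmas concern the simplices of the tiling itself. -/

lemma puncture_eq (c : T.Simplex T.tiles n) : c.puncture = T.punc (Set.range c.vertex) := by
  rw [range_vertex, T.punc_shift c.tile c.tile_mem _ c.range_subset (Set.range_nonempty _)
    _ c.shift_mem c.offset]
  · rfl
  · rw [← range_vertex]
    exact c.range_vertex_subset

lemma vertex_eq (c : T.Simplex T.tiles n) (i : Fin (n + 1)) :
    c.vertex i = T.vert (shift c.tile c.offset) (c.emb i) :=
  (T.vert_shift c.tile c.tile_mem c.offset c.shift_mem _).symm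

lemma puncture_eq_of_range_eq {c c' : T.Simplex T.tiles n}
    (h : Set.range c.vertex = Set.range c'.vertex) : c.puncture = c'.puncture := by
  rw [puncture_eq, puncture_eq, h]

/-- A simplex of the tiling is determined by its puncture. -/
lemma vertex_eq_of_puncture_eq_tiles {c c' : T.Simplex T.tiles n}
    (h : c.puncture = c'.puncture) : c.vertex = c'.vertex := by
  have hr : Set.range c.vertex = Set.range c'.vertex := by
    refine T.punc_inj _ c.shift_mem _ c.range_vertex_subset (Set.range_nonempty _) _ c'.shift_mem _
      c'.range_vertex_subset (Set.range_nonempty _) ?_ ?_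
    · rw [Set.ncard_range_of_injective c.vertex_injective,
        Set.ncard_range_of_injective c'.vertex_injective]
    · rw [← puncture_eq, ← puncture_eq, h]
  have hmem : ∀ i, ∃ j, c'.vertex j = c.vertex i := fun i => by
    have : c.vertex i ∈ Set.range c'.vertex := by
      rw [← hr]
      exact ⟨i, rfl⟩
    exact this
  choose f hf using hmem
  -- Equal vertex sets are matched by a bijection, which respects the order because tiles induce the
  -- same order on common vertices; the only such bijection is the identity.
  have hmono : StrictMono f := by
    intro i j hij
    have := T.vert_compat _ c.shift_mem _ c'.shift_mem (c.emb i) (c.emb j) (c'.emb (f i))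
      (c'.emb (f j)) (by rw [← vertex_eq, ← vertex_eq, hf]) (by rw [← vertex_eq, ← vertex_eq, hf])
    simpa using this.1 (by simpa using hij)
  have hid : f = id := by
    have hs : Function.Surjective f := Finite.surjective_of_injective hmono.injective
    have e := Subsingleton.elim (hmono.orderIsoOfSurjective f hs) (OrderIso.refl _)
    funext i
    exact congrArg (fun g : Fin (n + 1) ≃o Fin (n + 1) => g i) e
  funext i
  rw [← hf i, hid, id]

end Simplex

/-- A simplex of a tiling of the hull is determined by its puncture. -/
lemma Simplex.vertex_eq_of_puncture_eq (hK : K ∈ T.hull) {c c' : T.Simplex K n}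
    (h : c.puncture = c'.puncture) : c.vertex = c'.vertex := by
  -- A ball reaching the puncture contains a point of both tiles, so both simplices can be moved
  -- into a translate of the original tiling.
  obtain ⟨x, hx⟩ := T.exists_sameTiles hK ‖c.puncture‖
  have h1 := (hx _ ⟨c.puncture, c.puncture_mem, by simp⟩).1 c.shift_mem
  have h2 := (hx _ ⟨c'.puncture, c'.puncture_mem, by simp [h]⟩).1 c'.shift_mem
  rw [mem_translate, shift_shift] at h1 h2
  have := Simplex.vertex_eq_of_puncture_eq_tiles (c := c.move x h1) (c' := c'.move x h2)
    (by rw [Simplex.puncture_move, Simplex.puncture_move, h])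
  funext i
  have hi := congrFun this i
  rw [Simplex.vertex_move, Simplex.vertex_move] at hi
  exact add_right_cancel hi

/-- Simplices with the same vertices have the same puncture. -/
lemma Simplex.puncture_eq_of_vertex_eq (hK : K ∈ T.hull) {c c' : T.Simplex K n}
    (h : c.vertex = c'.vertex) : c.puncture = c'.puncture := by
  obtain ⟨x, hx⟩ := T.exists_sameTiles hK (max ‖c.puncture‖ ‖c'.puncture‖)
  have h1 := (hx _ ⟨c.puncture, c.puncture_mem, by simp⟩).1 c.shift_mem
  have h2 := (hx _ ⟨c'.puncture, c'.puncture_mem, by simp⟩).1 c'.shift_mem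
  rw [mem_translate, shift_shift] at h1 h2
  have := Simplex.puncture_eq_of_range_eq (c := c.move x h1) (c' := c'.move x h2) (by
    congr 1
    funext i
    rw [Simplex.vertex_move, Simplex.vertex_move, h])
  rw [Simplex.puncture_move, Simplex.puncture_move] at this
  exact add_right_cancel this

lemma Similar.shift_mem_simplex {r : ℝ} {x y : Space d} (h : T.Similar r x y)
    (c : T.Simplex T.tiles n) {z : Space d} (hz : z ∈ cell (shift c.tile c.offset))
    (hzx : dist z x ≤ r) : shift c.tile (c.offset + (y - x)) ∈ T.tiles := by
  have := h.shift_mem c.shift_mem hz hzx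
  rwa [shift_shift] at this

variable (T) in
/-- Distinct punctures of simplices of the same dimension are uniformly separated. -/
lemma exists_puncture_separation (n : ℕ) : ∃ δ : ℝ, 0 < δ ∧ ∀ c c' : T.Simplex T.tiles n,
    dist c.puncture c'.puncture < δ → c.puncture = c'.puncture := by
  obtain ⟨V, hV, -, hrep⟩ := T.exists_finite_representatives (T.mesh + 1)
  set P : Space d → Set (Space d) := fun v =>
    {p | ∃ c : T.Simplex T.tiles n, p = c.puncture ∧ dist p v ≤ T.mesh + 1}
  have hP : ∀ v, (P v).Finite := by
    intro v
    refine ((T.finite_tiles_meeting v (T.mesh + 1)).biUnion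
      (t := fun t => T.punc '' 𝒫 (t : Set (Space d)))
      fun t _ => t.finite_toSet.finite_subsets.image _).subset ?_
    rintro _ ⟨c, rfl, hd⟩
    refine mem_biUnion (show shift c.tile c.offset ∈ {t ∈ T.tiles | _} from
      ⟨c.shift_mem, c.puncture, c.puncture_mem, hd⟩) ⟨_, c.range_vertex_subset, ?_⟩
    rw [c.puncture_eq]
  -- Finitely many punctures near finitely many representative vertices have a positive minimal
  -- distance.
  have hev : ∀ᶠ δ : ℝ in 𝓝[>] 0, ∀ v ∈ V, ∀ p ∈ P v, ∀ p' ∈ P v, dist p p' < δ → p = p' := by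
    rw [eventually_all_finite hV]
    intro v _
    rw [eventually_all_finite (hP v)]
    intro p _
    rw [eventually_all_finite (hP v)]
    intro p' _
    rcases eq_or_ne p p' with h | h
    · exact Eventually.of_forall fun _ _ => h
    · filter_upwards [Ioo_mem_nhdsGT (dist_pos.2 h)] with δ hδ hlt
      exact absurd hlt (not_lt.2 hδ.2.le)
  obtain ⟨δ, hδ, hδ0, hδ1⟩ := (hev.and (Ioo_mem_nhdsGT (zero_lt_one' ℝ))).exists
  refine ⟨δ, hδ0, fun c c' hcc' => ?_⟩
  set v := c.vertex 0
  have hd : dist c.puncture v ≤ T.mesh :=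
    T.dist_le_mesh c.shift_mem c.puncture_mem (subset_convexHull _ _ (c.vertex_mem 0))
  have hd' : dist c'.puncture v ≤ T.mesh + 1 := by
    rw [dist_comm] at hcc'
    linarith [dist_triangle c'.puncture c.puncture v]
  obtain ⟨v₀, hv₀, h⟩ := hrep v ⟨_, c.shift_mem, c.vertex_mem 0⟩
  have h1 := h.shift_mem_simplex c c.puncture_mem (by linarith)
  have h2 := h.shift_mem_simplex c' c'.puncture_mem hd'
  have e : ∀ p : Space d, dist (p + (v₀ - v)) v₀ = dist p v := fun p => by
    rw [dist_eq_norm, dist_eq_norm]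
    congr 1
    abel
  have := hδ v₀ hv₀ (c.move _ h1).puncture ⟨_, rfl, by rw [Simplex.puncture_move, e]; linarith⟩
    (c'.move _ h2).puncture ⟨_, rfl, by rw [Simplex.puncture_move, e]; exact hd'⟩
    (by rwa [Simplex.puncture_move, Simplex.puncture_move, dist_add_right])
  rw [Simplex.puncture_move, Simplex.puncture_move] at this
  exact add_right_cancel this

variable (T) in
lemma exists_puncture_separation_hull (n : ℕ) : ∃ δ : ℝ, 0 < δ ∧ ∀ K ∈ T.hull,
    ∀ c c' : T.Simplex K n, dist c.puncture c'.puncture < δ → c.puncture = c'.puncture := by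
  obtain ⟨δ, hδ, hsep⟩ := T.exists_puncture_separation n
  refine ⟨δ, hδ, fun K hK c c' hcc' => ?_⟩
  obtain ⟨x, hx⟩ := T.exists_sameTiles hK (max ‖c.puncture‖ ‖c'.puncture‖)
  have h1 := (hx _ ⟨c.puncture, c.puncture_mem, by simp⟩).1 c.shift_mem
  have h2 := (hx _ ⟨c'.puncture, c'.puncture_mem, by simp⟩).1 c'.shift_mem
  rw [mem_translate, shift_shift] at h1 h2
  have := hsep (c.move x h1) (c'.move x h2)
    (by rwa [Simplex.puncture_move, Simplex.puncture_move, dist_add_right])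
  rw [Simplex.puncture_move, Simplex.puncture_move] at this
  exact add_right_cancel this

lemma puncture_simplexAt (ξ : T.Xi n) : (T.simplexAt ξ).puncture = 0 := ξ.2.2.choose_spec

lemma shift_mem_of_sameTiles {r : ℝ} (hr : 0 ≤ r) (h : SameTiles r K L) {c : T.Simplex K n}
    (hc : c.puncture = 0) : shift c.tile c.offset ∈ L :=
  (h _ ⟨0, by rw [← hc]; exact c.puncture_mem, by simpa using hr⟩).1 c.shift_mem

variable (T) in
/-- The topology of the transversals: close points have the same tiles near the origin. -/
lemma exists_sameTiles_of_tilingDist_lt (n : ℕ) (R : ℝ) : ∃ ε : ℝ≥0∞, 0 < ε ∧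
    ∀ ξ η : T.Xi n, tilingDist ξ.1 η.1 < ε → SameTiles R ξ.1 η.1 := by
  obtain ⟨δ, hδ, hsep⟩ := T.exists_puncture_separation_hull n
  -- The first terms leave enough room to pass from boundary points to tiles after the loss of `1 /
  -- Q ≤ 1`. The term `2 / δ` makes the translation, shorter than `2 / Q`, shorter than `δ`.
  set Q := max R 0 + T.mesh + 2 + 2 / δ
  have hm := T.mesh_pos
  have h2 : 0 < 2 / δ := by positivity
  have hQ2 : 2 ≤ Q := by
    have := le_max_right R 0
    simp only [Q]; linarith
  have hinv : 1 / Q ≤ 1 := by rw [div_le_one (by linarith)]; linarith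
  refine ⟨ENNReal.ofReal (1 / (Q + 1)), ENNReal.ofReal_pos.2 (by positivity), fun ξ η h => ?_⟩
  obtain ⟨a, ha, hag⟩ := agree_of_tilingDist_lt (by linarith) h
  have hs : SameTiles (max R 0) ξ.1 (translate η.1 a) :=
    T.sameTiles_of_agree ξ.2.1 (T.translate_mem_hull η.2.1 a)
      (hag.mono (by simp only [Q] at hinv ⊢; linarith))
  have haδ : ‖a‖ < δ := by
    refine ha.trans_le ?_
    rw [div_le_iff₀ (by linarith), mul_comm, ← div_le_iff₀ hδ]
    have := le_max_right R 0
    simp only [Q]; linarith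
  have h1 := shift_mem_of_sameTiles (le_max_right _ _) hs (puncture_simplexAt ξ)
  rw [mem_translate, shift_shift] at h1
  -- The simplex of `ξ` at the origin reappears in `η` with puncture `a`. Since `η` has a puncture
  -- at the origin, separation of punctures forces `a` to vanish.
  have ha0 : a = 0 := by
    have p1 : ((T.simplexAt ξ).move a h1).puncture = a := by
      rw [Simplex.puncture_move, puncture_simplexAt, zero_add]
    have := hsep _ η.2.1 ((T.simplexAt ξ).move a h1) (T.simplexAt η) (by
      rw [p1, puncture_simplexAt]
      simpa using haδ)
    rwa [p1, puncture_simplexAt] at this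
  rw [ha0, translate_zero] at hs
  exact hs.mono (le_max_left _ _)

lemma tilingDist_le_of_sameTiles {R : ℝ} (hR : 0 < R) (h : SameTiles R K L) :
    tilingDist K L ≤ ENNReal.ofReal (1 / (R + 1)) :=
  iInf₂_le R ⟨hR, 0, by simpa using hR, 0, by simpa using hR, by
    rw [translate_zero, translate_zero]
    exact h.agree⟩

lemma exists_sameTiles_imp_tilingDist_lt {ε : ℝ≥0∞} (hε : 0 < ε) : ∃ R : ℝ, 0 < R ∧
    ∀ K L : Set (Finset (Space d)), SameTiles R K L → tilingDist K L < ε := by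
  obtain ⟨R, hR0, hR⟩ : ∃ R : ℝ, 0 < R ∧ ENNReal.ofReal (1 / (R + 1)) < ε := by
    rcases eq_or_ne ε ⊤ with rfl | hε'
    · exact ⟨1, one_pos, ENNReal.ofReal_lt_top⟩
    · have hpos : 0 < ε.toReal := ENNReal.toReal_pos hε.ne' hε'
      refine ⟨1 / ε.toReal, by positivity, ?_⟩
      rw [ENNReal.ofReal_lt_iff_lt_toReal (by positivity) hε', div_lt_iff₀ (by positivity)]
      field_simp
      linarith
  exact ⟨R, hR0, fun K L h => (tilingDist_le_of_sameTiles hR0 h).trans_lt hR⟩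

/-- The sets of points with the same tiles on a given ball are open, because having the same tiles
is an equivalence relation; they form neighbourhood bases. -/
lemma mem_nhds_Xi_iff {ξ : T.Xi n} {U : Set (T.Xi n)} :
    U ∈ 𝓝 ξ ↔ ∃ R, ∀ η : T.Xi n, SameTiles R ξ.1 η.1 → η ∈ U := by
  rw [mem_nhds_iff]
  constructor
  · rintro ⟨V, hVU, hV, hξ⟩
    obtain ⟨ε, hε, h⟩ := hV ξ hξ
    obtain ⟨R, -, hR⟩ := exists_sameTiles_imp_tilingDist_lt hε
    exact ⟨R, fun η hη => hVU (h η (hR _ _ hη))⟩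
  · rintro ⟨R, hR⟩
    refine ⟨{η | SameTiles R ξ.1 η.1}, hR, ?_, SameTiles.refl _ _⟩
    intro η hη
    obtain ⟨ε, hε, h⟩ := T.exists_sameTiles_of_tilingDist_lt n R
    exact ⟨ε, hε, fun ζ hζ => SameTiles.trans hη (h η ζ hζ)⟩

lemma continuous_Xi_iff {f : T.Xi n → ℝ} : Continuous f ↔
    ∀ ξ : T.Xi n, ∀ ε > 0, ∃ R, ∀ η : T.Xi n, SameTiles R ξ.1 η.1 → |f η - f ξ| ≤ ε := by
  rw [continuous_iff_continuousAt]
  refine forall_congr' fun ξ => ?_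
  rw [ContinuousAt, Metric.nhds_basis_closedBall.tendsto_right_iff]
  refine forall₂_congr fun ε _ => ?_
  exact mem_nhds_Xi_iff

lemma isLocallyConstant_Xi_iff {f : T.Xi n → ℝ} : IsLocallyConstant f ↔
    ∀ ξ : T.Xi n, ∃ R, ∀ η : T.Xi n, SameTiles R ξ.1 η.1 → f η = f ξ := by
  rw [IsLocallyConstant.iff_eventually_eq]
  exact forall_congr' fun ξ => mem_nhds_Xi_iff

/-- The points of the orbit of the tiling are dense in the transversals. -/
lemma exists_orbitPoint_sameTiles (ξ : T.Xi n) (R : ℝ) :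
    ∃ σ : T.Simplex T.tiles n, SameTiles R ξ.1 (T.orbitPoint σ).1 := by
  obtain ⟨x, hx⟩ := T.exists_sameTiles ξ.2.1 (max R 0)
  have h1 := shift_mem_of_sameTiles (le_max_right _ _) hx (puncture_simplexAt ξ)
  rw [mem_translate, shift_shift] at h1
  refine ⟨(T.simplexAt ξ).move x h1, ?_⟩
  change SameTiles R ξ.1 (translate T.tiles ((T.simplexAt ξ).move x h1).puncture)
  rw [Simplex.puncture_move, puncture_simplexAt, zero_add]
  exact hx.mono (le_max_left _ _)

end SimplicialTiling

/-! ### Functions on the transversals and pattern equivariant cochains -/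

namespace SimplicialTiling

variable {d : ℕ} (T : SimplicialTiling d) {n : ℕ}

/-- The values of the cochain on simplices whose punctures have similar neighbourhoods of radius `R`
differ by at most `ε`. -/
def OrbitBound (ε R : ℝ) (c : T.Simplex T.tiles n → ℝ) : Prop :=
  ∀ σ τ : T.Simplex T.tiles n, T.Similar R σ.puncture τ.puncture → |c σ - c τ| ≤ ε

variable {T}

lemma OrbitBound.mono {ε ε' R R' : ℝ} {c : T.Simplex T.tiles n → ℝ} (h : T.OrbitBound ε R c)
    (hε : ε ≤ ε') (hR : R ≤ R') : T.OrbitBound ε' R' c :=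
  fun σ τ hστ => (h σ τ (SameTiles.mono hστ hR)).trans hε

/-- A pattern equivariant cochain extends to a function on the transversal. -/
lemma exists_extension {c : T.Simplex T.tiles n → ℝ}
    (hc : ∀ ε, 0 < ε → ∃ R, T.OrbitBound ε R c) : ∃ f : T.Xi n → ℝ, ∀ ε R, T.OrbitBound ε R c →
      ∀ (ξ : T.Xi n) (σ : T.Simplex T.tiles n), SameTiles R ξ.1 (T.orbitPoint σ).1 →
        |f ξ - c σ| ≤ ε := by
  -- The value is the limit along orbit points that share larger and larger balls with `ξ`. The
  -- estimate is kept for all `ε` and `R` at once, so the same extension serves continuous and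
  -- locally constant functions.
  have key : ∀ ξ : T.Xi n, ∃ y : ℝ, ∀ ε R, T.OrbitBound ε R c →
      ∀ σ : T.Simplex T.tiles n, SameTiles R ξ.1 (T.orbitPoint σ).1 → |y - c σ| ≤ ε := by
    intro ξ
    choose σ hσ using fun k : ℕ => exists_orbitPoint_sameTiles ξ k
    have hlarge : ∀ {ε R}, T.OrbitBound ε R c → ∀ {τ : T.Simplex T.tiles n},
        SameTiles R ξ.1 (T.orbitPoint τ).1 → ∀ᶠ k in atTop, |c (σ k) - c τ| ≤ ε := by
      intro ε R h τ hτ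
      filter_upwards [eventually_ge_atTop ⌈R⌉₊] with k hk
      have hk' : R ≤ k := (Nat.le_ceil R).trans (by exact_mod_cast hk)
      exact h _ _ (SameTiles.trans ((hσ k).mono hk').symm hτ)
    have hcau : CauchySeq fun k => c (σ k) := by
      rw [Metric.cauchySeq_iff']
      intro ε hε
      obtain ⟨R, hR⟩ := hc (ε / 2) (half_pos hε)
      obtain ⟨k, hk⟩ := exists_nat_ge R
      refine ⟨k, fun m hm => ?_⟩
      have hm' : (k : ℝ) ≤ m := by exact_mod_cast hm
      have h1 : |c (σ m) - c (σ k)| ≤ ε / 2 :=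
        hR _ _ (SameTiles.trans ((hσ m).mono (hk.trans hm')).symm ((hσ k).mono hk))
      rw [Real.dist_eq]
      linarith
    obtain ⟨y, hy⟩ := cauchySeq_tendsto_of_complete hcau
    refine ⟨y, fun ε R h τ hτ => ?_⟩
    exact le_of_tendsto ((hy.sub_const (c τ)).abs) (hlarge h hτ)
  choose f hf using key
  exact ⟨f, fun ε R h ξ σ hσ => hf ξ ε R h σ hσ⟩

section extension

variable {c : T.Simplex T.tiles n → ℝ} {f : T.Xi n → ℝ}
  (hf : ∀ ε R, T.OrbitBound ε R c → ∀ (ξ : T.Xi n) (σ : T.Simplex T.tiles n),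
    SameTiles R ξ.1 (T.orbitPoint σ).1 → |f ξ - c σ| ≤ ε)

include hf

lemma extension_abs_sub_le {ε R : ℝ} (h : T.OrbitBound ε R c) {ξ η : T.Xi n}
    (hξη : SameTiles R ξ.1 η.1) : |f η - f ξ| ≤ ε + ε := by
  obtain ⟨σ, hσ⟩ := exists_orbitPoint_sameTiles ξ R
  have h1 := hf ε R h ξ σ hσ
  have h2 := hf ε R h η σ (hξη.symm.trans hσ)
  rw [abs_sub_comm] at h1
  have := abs_sub_le (f η) (c σ) (f ξ)
  linarith

lemma extension_orbitPoint (hc : ∀ ε, 0 < ε → ∃ R, T.OrbitBound ε R c)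
    (σ : T.Simplex T.tiles n) : f (T.orbitPoint σ) = c σ := by
  rw [← sub_eq_zero, ← abs_nonpos_iff]
  refine le_of_forall_pos_le_add fun ε hε => ?_
  obtain ⟨R, hR⟩ := hc ε hε
  simpa using hf ε R hR _ σ (SameTiles.refl _ _)

lemma continuous_extension (hc : ∀ ε, 0 < ε → ∃ R, T.OrbitBound ε R c) : Continuous f := by
  rw [continuous_Xi_iff]
  intro ξ ε hε
  obtain ⟨R, hR⟩ := hc (ε / 2) (half_pos hε)
  exact ⟨R, fun η hη => (extension_abs_sub_le hf hR hη).trans (by linarith)⟩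

lemma isLocallyConstant_extension (hc : ∃ R, T.OrbitBound 0 R c) : IsLocallyConstant f := by
  rw [isLocallyConstant_Xi_iff]
  obtain ⟨R, hR⟩ := hc
  refine fun ξ => ⟨R, fun η hη => ?_⟩
  have := extension_abs_sub_le hf hR hη
  rwa [add_zero, abs_nonpos_iff, sub_eq_zero] at this

end extension

/-- Continuous functions on the transversal are determined by the orbit of the tiling. -/
lemma eq_of_eq_orbitPoint {f g : T.Xi n → ℝ} (hf : Continuous f) (hg : Continuous g)
    (h : ∀ σ : T.Simplex T.tiles n, f (T.orbitPoint σ) = g (T.orbitPoint σ)) : f = g := by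
  funext ξ
  rw [← sub_eq_zero, ← abs_nonpos_iff]
  refine le_of_forall_pos_le_add fun ε hε => ?_
  obtain ⟨R, hR⟩ := continuous_Xi_iff.1 hf ξ (ε / 2) (half_pos hε)
  obtain ⟨R', hR'⟩ := continuous_Xi_iff.1 hg ξ (ε / 2) (half_pos hε)
  obtain ⟨σ, hσ⟩ := exists_orbitPoint_sameTiles ξ (max R R')
  have h1 := hR _ (hσ.mono (le_max_left _ _))
  have h2 := hR' _ (hσ.mono (le_max_right _ _))
  rw [h σ, abs_sub_comm] at h1
  have := abs_sub_le (f ξ) (g (T.orbitPoint σ)) (g ξ)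
  linarith

variable (T) in
/-- Finite local complexity, seen from the punctures. -/
lemma finite_seen_puncture (n : ℕ) (r : ℝ) : {t | ∃ σ : T.Simplex T.tiles n,
    t ∈ (T.orbitPoint σ).1 ∧ (cell t ∩ Metric.closedBall 0 r).Nonempty}.Finite := by
  obtain ⟨V, hV, -, hrep⟩ := T.exists_finite_representatives (T.mesh + max r 0)
  have hfin : ∀ v, {t | ∃ σ : T.Simplex T.tiles n, dist σ.puncture v ≤ T.mesh ∧
      t ∈ (T.orbitPoint σ).1 ∧ (cell t ∩ Metric.closedBall 0 r).Nonempty}.Finite := by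
    intro v
    have hP : {p | ∃ σ : T.Simplex T.tiles n, p = σ.puncture ∧ dist p v ≤ T.mesh}.Finite := by
      refine ((T.finite_tiles_meeting v T.mesh).biUnion
        (t := fun t => T.punc '' 𝒫 (t : Set (Space d)))
        fun t _ => t.finite_toSet.finite_subsets.image _).subset ?_
      rintro _ ⟨c, rfl, hd⟩
      refine mem_biUnion (show shift c.tile c.offset ∈ {t ∈ T.tiles | _} from
        ⟨c.shift_mem, c.puncture, c.puncture_mem, hd⟩) ⟨_, c.range_vertex_subset, ?_⟩
      rw [c.puncture_eq]
    refine (hP.biUnion (t := fun p => (fun t => shift t (-p)) ''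
      {t ∈ T.tiles | (cell t ∩ Metric.closedBall p r).Nonempty})
      fun p _ => (T.finite_tiles_meeting p r).image _).subset ?_
    rintro t ⟨σ, hσ, ht, z, hz, hzr⟩
    refine mem_biUnion (show σ.puncture ∈ {p | ∃ σ : T.Simplex T.tiles n, p = σ.puncture ∧ _} from
      ⟨σ, rfl, hσ⟩) ⟨shift t σ.puncture, ⟨ht, z + σ.puncture, by simpa [mem_cell_shift] using hz,
        by simpa [dist_eq_norm] using hzr⟩, by simp [shift_shift, shift_zero]⟩
  refine (hV.biUnion fun v _ => hfin v).subset ?_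
  rintro t ⟨σ, ht, hm⟩
  have hd : dist σ.puncture (σ.vertex 0) ≤ T.mesh :=
    T.dist_le_mesh σ.shift_mem σ.puncture_mem (subset_convexHull _ _ (σ.vertex_mem 0))
  obtain ⟨v, hv, h⟩ := hrep (σ.vertex 0) ⟨_, σ.shift_mem, σ.vertex_mem 0⟩
  have h1 := h.shift_mem_simplex σ σ.puncture_mem (hd.trans (by simp))
  refine mem_biUnion hv ⟨σ.move _ h1, ?_, ?_, hm⟩
  · rw [Simplex.puncture_move]
    rw [dist_eq_norm] at hd ⊢
    rwa [show σ.puncture + (v - σ.vertex 0) - v = σ.puncture - σ.vertex 0 by abel]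
  · have hs : T.Similar (max r 0) (σ.vertex 0 + (σ.puncture - σ.vertex 0))
        (v + (σ.puncture - σ.vertex 0)) := h.add (by rw [dist_eq_norm] at hd; linarith)
    rw [show σ.vertex 0 + (σ.puncture - σ.vertex 0) = σ.puncture by abel,
      show v + (σ.puncture - σ.vertex 0) = σ.puncture + (v - σ.vertex 0) by abel] at hs
    change t ∈ translate T.tiles (σ.move _ h1).puncture
    rw [Simplex.puncture_move]
    exact (SameTiles.mono hs (le_max_left _ _) t hm).1 ht

/-- Every sequence of points of the orbit has a limit along an ultrafilter. -/
lemma exists_limit (𝒰 : Ultrafilter ℕ) (σ : ℕ → T.Simplex T.tiles n) :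
    ∃ ξ : T.Xi n, ∀ r, ∀ᶠ k in 𝒰, SameTiles r ξ.1 (T.orbitPoint (σ k)).1 := by
  -- A tile belongs to the limit if the ultrafilter sees it in the sequence. Only finitely many
  -- tiles can meet a given ball, so the ultrafilter decides all of them simultaneously.
  set K : Set (Finset (Space d)) := {t | ∀ᶠ k in 𝒰, t ∈ (T.orbitPoint (σ k)).1}
  have hK : ∀ r, ∀ᶠ k in 𝒰, SameTiles r K (T.orbitPoint (σ k)).1 := by
    intro r
    have h1 : ∀ᶠ k in 𝒰, ∀ t ∈ {t | ∃ σ : T.Simplex T.tiles n, t ∈ (T.orbitPoint σ).1 ∧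
        (cell t ∩ Metric.closedBall 0 r).Nonempty}, (t ∈ K ↔ t ∈ (T.orbitPoint (σ k)).1) := by
      rw [eventually_all_finite (T.finite_seen_puncture n r)]
      intro t _
      by_cases ht : t ∈ K
      · have ht' : ∀ᶠ k in 𝒰, t ∈ (T.orbitPoint (σ k)).1 := ht
        filter_upwards [ht'] with k hk
        exact iff_of_true ht hk
      · have ht' : ∀ᶠ k in 𝒰, t ∉ (T.orbitPoint (σ k)).1 := Ultrafilter.eventually_not.2 ht
        filter_upwards [ht'] with k hk
        exact iff_of_false ht hk
    filter_upwards [h1] with k hk t ht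
    by_cases hs : ∃ τ : T.Simplex T.tiles n, t ∈ (T.orbitPoint τ).1
    · obtain ⟨τ, hτ⟩ := hs
      exact hk t ⟨τ, hτ, ht⟩
    · refine iff_of_false (fun htK => ?_) fun h => hs ⟨_, h⟩
      have htK' : ∀ᶠ k in 𝒰, t ∈ (T.orbitPoint (σ k)).1 := htK
      obtain ⟨m, hm⟩ := htK'.exists
      exact hs ⟨_, hm⟩
  have htil : IsFaceToFaceTiling K := by
    refine ⟨fun t ht => ?_, fun t ht => ?_, ?_, fun s hs t ht => ?_⟩
    · have ht' : ∀ᶠ k in 𝒰, t ∈ (T.orbitPoint (σ k)).1 := ht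
      obtain ⟨k, hk⟩ := ht'.exists
      exact (T.orbitPoint (σ k)).2.1.1.card_eq t hk
    · have ht' : ∀ᶠ k in 𝒰, t ∈ (T.orbitPoint (σ k)).1 := ht
      obtain ⟨k, hk⟩ := ht'.exists
      exact (T.orbitPoint (σ k)).2.1.1.affineIndependent t hk
    · rw [Set.eq_univ_iff_forall]
      intro x
      obtain ⟨k, hk⟩ := (hK ‖x‖).exists
      obtain ⟨t, ht, hx⟩ := (T.orbitPoint (σ k)).2.1.1.exists_mem_cell x
      exact mem_biUnion ((hk t ⟨x, hx, by simp⟩).2 ht) hx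
    · have hs' : ∀ᶠ k in 𝒰, s ∈ (T.orbitPoint (σ k)).1 := hs
      have ht' : ∀ᶠ k in 𝒰, t ∈ (T.orbitPoint (σ k)).1 := ht
      obtain ⟨k, hk1, hk2⟩ := (hs'.and ht').exists
      exact (T.orbitPoint (σ k)).2.1.1.face_to_face s hk1 t hk2
  have hhull : K ∈ T.hull := by
    refine ⟨htil, fun ε hε => ?_⟩
    obtain ⟨R, -, hR⟩ := exists_sameTiles_imp_tilingDist_lt (d := d) hε
    obtain ⟨k, hk⟩ := (hK R).exists
    exact ⟨_, hR _ _ hk⟩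
  obtain ⟨k, hk⟩ := (hK 0).exists
  have hmem := shift_mem_of_sameTiles le_rfl hk.symm (puncture_simplexAt (T.orbitPoint (σ k)))
  refine ⟨⟨K, hhull, (T.simplexAt (T.orbitPoint (σ k))).move 0 (by rwa [add_zero]), ?_⟩, hK⟩
  rw [Simplex.puncture_move, puncture_simplexAt, add_zero]

/-- Continuous functions on the transversal restrict to pattern equivariant cochains. -/
lemma exists_orbitBound {f : T.Xi n → ℝ} {ε : ℝ}
    (h : ∀ ξ : T.Xi n, ∃ R, ∀ η : T.Xi n, SameTiles R ξ.1 η.1 → |f η - f ξ| ≤ ε) :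
    ∃ R, 0 ≤ R ∧ T.OrbitBound (ε + ε) R fun σ => f (T.orbitPoint σ) := by
  -- A uniform continuity argument by compactness: a sequence of counterexamples with radii `k` has
  -- a limit `ξ`, which is approached by both members of the pairs, and two estimates at `ξ` give
  -- the bound `ε + ε`.
  by_contra hcon
  simp only [not_exists, not_and, OrbitBound, not_forall] at hcon
  choose σ τ hστ hgt using fun k : ℕ => hcon k k.cast_nonneg
  obtain ⟨ξ, hξ⟩ := exists_limit (hyperfilter ℕ) σ
  obtain ⟨R, hR⟩ := h ξ
  have hlarge : ∀ᶠ k : ℕ in hyperfilter ℕ, R ≤ k :=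
    (tendsto_natCast_atTop_atTop.eventually_ge_atTop R).filter_mono Nat.hyperfilter_le_atTop
  obtain ⟨k, hk1, hk2⟩ := ((hξ R).and hlarge).exists
  refine hgt k ?_
  have h1 := hR _ hk1
  have h2 := hR (T.orbitPoint (τ k)) (hk1.trans ((hστ k).mono hk2))
  rw [abs_sub_comm] at h2
  have := abs_sub_le (f (T.orbitPoint (σ k))) (f ξ) (f (T.orbitPoint (τ k)))
  linarith

end SimplicialTiling

/-! ### The cochain of a function on the transversal -/

namespace SimplicialTiling

variable {d : ℕ} {T : SimplicialTiling d} {n : ℕ}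

lemma orbitPoint_eq {σ τ : T.Simplex T.tiles n} (h : σ.puncture = τ.puncture) :
    T.orbitPoint σ = T.orbitPoint τ :=
  Subtype.ext (congrArg (translate T.tiles) h)

open Classical in
/-- The function of tuples of points which on the ordered vertices of a simplex of the tiling is the
value of `f` at the simplex, and which is zero on the other tuples. -/
def orderedCochain (f : T.Xi n → ℝ) (w : Fin (n + 1) → Space d) : ℝ :=
  if h : ∃ σ : T.Simplex T.tiles n, σ.vertex = w then f (T.orbitPoint h.choose) else 0

lemma orderedCochain_vertex (f : T.Xi n → ℝ) (σ : T.Simplex T.tiles n) :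
    orderedCochain f σ.vertex = f (T.orbitPoint σ) := by
  have h : ∃ τ : T.Simplex T.tiles n, τ.vertex = σ.vertex := ⟨σ, rfl⟩
  rw [orderedCochain, dif_pos h]
  congr 1
  exact orbitPoint_eq (Simplex.puncture_eq_of_vertex_eq T.tiles_mem_hull h.choose_spec)

/-- The alternating cochain of a function on the transversal. -/
def cochainOf (f : T.Xi n → ℝ) : (Fin (n + 1) → Space d) → ℝ := alternation (orderedCochain f)

lemma isAlternating_cochainOf (f : T.Xi n → ℝ) : IsAlternating (cochainOf f) :=
  isAlternating_alternation _

/-- The vertex set of a simplex determines its order, so only the identity permutation contributes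
to the alternating sum. -/
lemma cochainOf_vertex (f : T.Xi n → ℝ) (σ : T.Simplex T.tiles n) :
    cochainOf f σ.vertex = f (T.orbitPoint σ) := by
  rw [cochainOf, alternation, Finset.sum_eq_single 1]
  · simp [orderedCochain_vertex]
  · intro π _ hπ
    rw [orderedCochain, dif_neg, mul_zero]
    rintro ⟨τ, hτ⟩
    refine hπ (Equiv.ext fun i => σ.vertex_injective ?_)
    have hr : Set.range τ.vertex = Set.range σ.vertex := by
      rw [hτ, π.surjective.range_comp]
    have := Simplex.vertex_eq_of_puncture_eq_tiles (Simplex.puncture_eq_of_range_eq hr)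
    exact (congrFun hτ i).symm.trans (congrFun this i)
  · simp

/-- Similarity carries simplices near `x` to simplices near `y` and back, so a tuple spans a simplex
on one side exactly if it does on the other. The puncture is within `T.mesh` of a vertex, which is
within `T.mesh + 1` of `x`. -/
lemma cochainBound_orderedCochain {f : T.Xi n → ℝ} {ε R : ℝ} (hε : 0 ≤ ε) (hR : 0 ≤ R)
    (h : T.OrbitBound ε R fun σ => f (T.orbitPoint σ)) :
    T.CochainBound ε (R + (2 * T.mesh + 1)) (orderedCochain f) := by
  have hm := T.mesh_pos
  have key : ∀ {x y : Space d}, T.Similar (R + (2 * T.mesh + 1)) x y →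
      ∀ σ : T.Simplex T.tiles n, σ.vertex 0 ∈ T.vertsIn x (T.mesh + 1) →
        ∃ τ : T.Simplex T.tiles n, (τ.vertex = fun i => σ.vertex i + (y - x)) ∧
          T.Similar R σ.puncture τ.puncture := by
    intro x y hxy σ hσ
    have hd := (T.mem_vertsIn.1 hσ).2
    have hmem := hxy.shift_mem_simplex σ (subset_convexHull _ _ (σ.vertex_mem 0)) (by linarith)
    refine ⟨σ.move _ hmem, funext fun i => σ.vertex_move _ hmem i, ?_⟩
    rw [Simplex.puncture_move]
    have hp : dist σ.puncture (σ.vertex 0) ≤ T.mesh :=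
      T.dist_le_mesh σ.shift_mem σ.puncture_mem (subset_convexHull _ _ (σ.vertex_mem 0))
    have hpx := dist_triangle σ.puncture (σ.vertex 0) x
    have hs : T.Similar R (x + (σ.puncture - x)) (y + (σ.puncture - x)) :=
      hxy.add (by rw [← dist_eq_norm]; linarith)
    rwa [show x + (σ.puncture - x) = σ.puncture by abel,
      show y + (σ.puncture - x) = σ.puncture + (y - x) by abel] at hs
  intro x y hxy w hw
  by_cases hσ : ∃ σ : T.Simplex T.tiles n, σ.vertex = w
  · obtain ⟨σ, rfl⟩ := hσ
    obtain ⟨τ, hτ, hsim⟩ := key hxy σ (hw 0)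
    rw [← hτ, orderedCochain_vertex, orderedCochain_vertex, abs_sub_comm]
    exact h σ τ hsim
  · have hσ' : ¬ ∃ σ : T.Simplex T.tiles n, σ.vertex = fun i => w i + (y - x) := by
      rintro ⟨σ, hσe⟩
      have h0 : σ.vertex 0 ∈ T.vertsIn y (T.mesh + 1) := by
        rw [hσe, Similar.vertsIn_eq (SameTiles.mono hxy (by linarith))]
        simpa using hw 0
      obtain ⟨τ, hτ, -⟩ := key (SameTiles.symm hxy) σ h0
      refine hσ ⟨τ, hτ.trans (funext fun i => ?_)⟩
      rw [hσe]
      change w i + (y - x) + (x - y) = w i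
      abel
    rw [orderedCochain, orderedCochain, dif_neg hσ, dif_neg hσ']
    simpa using hε

lemma CochainBound.alternation {c : (Fin n → Space d) → ℝ} {ε R : ℝ} (h : T.CochainBound ε R c) :
    T.CochainBound (n.factorial * ε) R (alternation c) := by
  intro x y hxy w hw
  unfold PVTiling.alternation
  rw [← Finset.sum_sub_distrib]
  refine (Finset.abs_sum_le_sum_abs _ _).trans ?_
  have : ∀ π ∈ (Finset.univ : Finset (Equiv.Perm (Fin n))),
      |((Equiv.Perm.sign π : ℤ) : ℝ) * c ((fun i => w i + (y - x)) ∘ π) -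
        ((Equiv.Perm.sign π : ℤ) : ℝ) * c (w ∘ π)| ≤ ε := by
    intro π _
    rw [← mul_sub, abs_mul]
    have h1 : |((Equiv.Perm.sign π : ℤ) : ℝ)| = 1 := by
      rcases Int.units_eq_one_or (Equiv.Perm.sign π) with e | e <;> simp [e]
    rw [h1, one_mul]
    exact h x y hxy (w ∘ π) fun i => hw (π i)
  refine (Finset.sum_le_card_nsmul _ _ _ this).trans ?_
  rw [Finset.card_univ, Fintype.card_perm, Fintype.card_fin, nsmul_eq_mul]

lemma exists_cochainBound_cochainOf_zero {f : T.Xi n → ℝ} (hf : f ∈ T.strongCochains n) :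
    ∃ R, 0 ≤ R ∧ T.CochainBound 0 R (cochainOf f) := by
  obtain ⟨R, hR, h⟩ := exists_orbitBound (f := f) (ε := 0) fun ξ => by
    obtain ⟨R, hR⟩ := isLocallyConstant_Xi_iff.1 hf ξ
    exact ⟨R, fun η hη => by simp [hR η hη]⟩
  rw [add_zero] at h
  have hm := T.mesh_pos
  refine ⟨R + (2 * T.mesh + 1), by positivity, ?_⟩
  have := (cochainBound_orderedCochain le_rfl hR h).alternation
  rwa [mul_zero] at this

lemma exists_cochainBound_cochainOf {f : T.Xi n → ℝ} (hf : f ∈ T.weakCochains n) {ε : ℝ}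
    (hε : 0 < ε) : ∃ R, 0 ≤ R ∧ T.CochainBound ε R (cochainOf f) := by
  set N : ℝ := ((n + 1).factorial : ℝ)
  have hN : 0 < N := by positivity
  -- Division by `N` compensates for the number of permutations, halving for the two estimates at
  -- the limit point.
  obtain ⟨R, hR, h⟩ := exists_orbitBound (f := f) (ε := ε / N / 2) fun ξ =>
    continuous_Xi_iff.1 hf ξ _ (by positivity)
  rw [add_halves] at h
  have hm := T.mesh_pos
  refine ⟨R + (2 * T.mesh + 1), by positivity, ?_⟩
  have := (cochainBound_orderedCochain (by positivity) hR h).alternation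
  rwa [mul_div_cancel₀ _ hN.ne'] at this

/-- Alternating cochains which agree on the simplices of the tiling agree on all tuples of vertices
of a tile. -/
lemma eq_of_eq_vertex {c c' : (Fin (n + 1) → Space d) → ℝ} (hc : IsAlternating c)
    (hc' : IsAlternating c') (h : ∀ σ : T.Simplex T.tiles n, c σ.vertex = c' σ.vertex)
    {t : Finset (Space d)} (ht : t ∈ T.tiles) {w : Fin (n + 1) → Space d} (hw : ∀ i, w i ∈ t) :
    c w = c' w := by
  by_cases hinj : Function.Injective w
  swap
  · rw [hc.eq_zero hinj, hc'.eq_zero hinj]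
  have hk : ∀ i, ∃ k, T.vert t k = w i := fun i => by
    have : w i ∈ Set.range (T.vert t) := by
      rw [T.range_vert t ht]
      exact hw i
    exact this
  choose k hk using hk
  -- Sorting the vertex indices turns an injective tuple into the ordered vertices of a simplex;
  -- both cochains change by the same nonzero sign.
  set π := Tuple.sort k
  have hmono : StrictMono (k ∘ π) := by
    refine (Tuple.monotone_sort k).strictMono_of_injective ?_
    refine Function.Injective.comp (fun i j hij => hinj ?_) π.injective
    rw [← hk i, ← hk j, hij]
  let σ : T.Simplex T.tiles n :=
    ⟨t, ht, 0, by rwa [shift_zero], OrderEmbedding.ofStrictMono _ hmono⟩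
  have hσ : σ.vertex = w ∘ π := by
    funext i
    change T.vert t (k (π i)) + 0 = w (π i)
    rw [add_zero, hk]
  have h1 := h σ
  rw [hσ, hc.comp_perm, hc'.comp_perm] at h1
  refine mul_left_cancel₀ ?_ h1
  exact_mod_cast (Equiv.Perm.sign π).ne_zero

/-! ### The differential -/

/-- The differential does not depend on the simplex chosen at the origin, since the puncture
determines the vertices and the vertices determine the punctures of the faces. -/
lemma dPV_eq (f : T.Xi n → ℝ) (ξ : T.Xi (n + 1)) (c : T.Simplex ξ.1 (n + 1))
    (hc : c.puncture = 0) :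
    T.dPV n f ξ = ∑ i : Fin (n + 2), (-1 : ℝ) ^ (i : ℕ) * f (T.pointAt ξ.2.1 (c.face i)) := by
  have hv : (T.simplexAt ξ).vertex = c.vertex :=
    Simplex.vertex_eq_of_puncture_eq ξ.2.1 ((puncture_simplexAt ξ).trans hc.symm)
  change ∑ i : Fin (n + 2), (-1 : ℝ) ^ (i : ℕ) *
    f (T.pointAt ξ.2.1 ((T.simplexAt ξ).face i)) = _
  refine Finset.sum_congr rfl fun i _ => ?_
  congr 2
  refine Subtype.ext (congrArg (translate ξ.1) (Simplex.puncture_eq_of_vertex_eq ξ.2.1 ?_))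
  rw [Simplex.vertex_face, Simplex.vertex_face, hv]

lemma dPV_orbitPoint (f : T.Xi n → ℝ) (σ : T.Simplex T.tiles (n + 1)) :
    T.dPV n f (T.orbitPoint σ) =
      ∑ i : Fin (n + 2), (-1 : ℝ) ^ (i : ℕ) * f (T.orbitPoint (σ.face i)) := by
  rw [dPV_eq f (T.orbitPoint σ) (σ.translate σ.puncture)
    ((Simplex.puncture_translate σ σ.puncture).trans (sub_self _))]
  refine Finset.sum_congr rfl fun i _ => ?_
  congr 2
  refine Subtype.ext ?_
  change translate (translate T.tiles σ.puncture) ((σ.face i).translate σ.puncture).puncture =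
    translate T.tiles (σ.face i).puncture
  rw [translate_translate, Simplex.puncture_translate, add_sub_cancel]

/-- A point close to `ξ` contains the same simplex at the origin, so its faces sit at the same
punctures, and each term of the differential is continuous. -/
lemma continuous_dPV {f : T.Xi n → ℝ} (hf : Continuous f) : Continuous (T.dPV n f) := by
  rw [continuous_Xi_iff] at hf ⊢
  intro ξ ε hε
  set c := T.simplexAt ξ
  choose R hR using fun i : Fin (n + 2) => hf (T.pointAt ξ.2.1 (c.face i)) (ε / (n + 2))
    (by positivity)
  have hpos : ∀ i, 0 ≤ |R i| + ‖(c.face i).puncture‖ := fun i => by positivity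
  -- The sum is a crude upper bound for the radii required by the individual faces.
  refine ⟨∑ i, (|R i| + ‖(c.face i).puncture‖), fun η hη => ?_⟩
  have hmem := shift_mem_of_sameTiles (Finset.sum_nonneg fun i _ => hpos i) hη
    (puncture_simplexAt ξ)
  have hmem' : shift c.tile (c.offset + 0) ∈ η.1 := by rwa [add_zero]
  rw [dPV_eq f η (c.move 0 hmem') (by rw [Simplex.puncture_move, puncture_simplexAt, add_zero]),
    dPV_eq f ξ c (puncture_simplexAt ξ), ← Finset.sum_sub_distrib]
  refine (Finset.abs_sum_le_sum_abs _ _).trans ?_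
  have hle : ∀ i ∈ (Finset.univ : Finset (Fin (n + 2))), |(-1 : ℝ) ^ (i : ℕ) * f (T.pointAt η.2.1 ((c.move 0 hmem').face i)) -
      (-1 : ℝ) ^ (i : ℕ) * f (T.pointAt ξ.2.1 (c.face i))| ≤ ε / (n + 2) := by
    intro i _
    rw [← mul_sub, abs_mul, abs_pow, abs_neg, abs_one, one_pow, one_mul]
    refine hR i _ ?_
    have hp : ((c.face i).move 0 hmem').puncture = (c.face i).puncture :=
      ((c.face i).puncture_move 0 hmem').trans (add_zero _)
    change SameTiles (R i) (translate ξ.1 (c.face i).puncture)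
      (translate η.1 ((c.face i).move 0 hmem').puncture)
    refine hp.symm ▸ hη.translate ?_
    refine le_trans ?_ (Finset.single_le_sum (fun i _ => hpos i) (Finset.mem_univ i))
    linarith [le_abs_self (R i)]
  refine (Finset.sum_le_card_nsmul _ _ _ hle).trans (le_of_eq ?_)
  rw [Finset.card_univ, Fintype.card_fin, nsmul_eq_mul]
  push_cast
  field_simp

/-! ### Integration of pattern equivariant forms -/

lemma simplexIntegral_add_const (ω : Form (Space d) n) (v : Fin (n + 1) → Space d) (a : Space d) :
    simplexIntegral ω (fun i => v i + a) = simplexIntegral (fun z => ω (z + a)) v := by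
  unfold simplexIntegral
  simp only [add_sub_add_right_eq_sub, add_right_comm _ a]

lemma volume_real_cornerSimplex_le : (volume : Measure (Fin n → ℝ)).real (cornerSimplex n) ≤ 1 := by
  have h : (volume : Measure (Fin n → ℝ)).real (Icc 0 1) = 1 := by
    rw [Measure.real, Real.volume_Icc_pi]
    simp
  rw [← h]
  exact measureReal_mono (cornerSimplex_subset_Icc n) isCompact_Icc.measure_lt_top.ne

lemma abs_simplexIntegral_le {ω : Form (Space d) n} {v : Fin (n + 1) → Space d} {D ε : ℝ}
    (hv : ∀ i, ‖v i - v 0‖ ≤ D) (hε : 0 ≤ ε) (h : ∀ z, ‖z - v 0‖ ≤ D → ‖ω z‖ ≤ ε) :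
    |simplexIntegral ω v| ≤ D ^ n * ε := by
  have hD : 0 ≤ D := (norm_nonneg _).trans (hv 0)
  have hb : ∀ s ∈ cornerSimplex n,
      ‖ω (v 0 + ∑ i, s i • (v i.succ - v 0)) (fun i => v i.succ - v 0)‖ ≤ D ^ n * ε := by
    intro s hs
    have hz : ‖∑ i, s i • (v i.succ - v 0)‖ ≤ D := by
      refine (norm_sum_le _ _).trans ?_
      calc ∑ i, ‖s i • (v i.succ - v 0)‖ ≤ ∑ i, s i * D := by
            refine Finset.sum_le_sum fun i _ => ?_
            rw [norm_smul, Real.norm_of_nonneg (hs.1 i)]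
            exact mul_le_mul_of_nonneg_left (hv i.succ) (hs.1 i)
        _ = (∑ i, s i) * D := by rw [Finset.sum_mul]
        _ ≤ 1 * D := mul_le_mul_of_nonneg_right hs.2 hD
        _ = D := one_mul D
    refine (ContinuousAlternatingMap.le_opNorm _ _).trans ?_
    rw [mul_comm (D ^ n)]
    refine mul_le_mul (h _ (by simpa using hz)) ?_ (Finset.prod_nonneg fun _ _ => norm_nonneg _) hε
    calc ∏ i : Fin n, ‖v i.succ - v 0‖ ≤ ∏ _i : Fin n, D :=
          Finset.prod_le_prod (fun _ _ => norm_nonneg _) fun i _ => hv i.succ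
      _ = D ^ n := by simp
  have := norm_setIntegral_le_of_norm_le_const (μ := (volume : Measure (Fin n → ℝ)))
    (isCompact_cornerSimplex n).measure_lt_top hb
  refine this.trans ?_
  exact mul_le_of_le_one_right (by positivity) volume_real_cornerSimplex_le

/-- Similar punctures carry translated simplices, so the difference of the integrals is the integral
of `ω (z + a) - ω z` over one simplex. Its points lie within `2 * T.mesh` of the puncture, and its
edges have length at most `T.mesh`. -/
lemma orbitBound_simplexIntegral {ω : Form (Space d) n} (hω : Smooth ω) {ε R : ℝ} (hε : 0 ≤ ε)
    (hR : 0 ≤ R) (h : T.PEBound 0 ε R ω) : T.OrbitBound (T.mesh ^ n * ε) (R + 2 * T.mesh)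
      fun σ => simplexIntegral ω σ.vertex := by
  intro σ τ hστ
  have hm := T.mesh_pos
  set a := τ.puncture - σ.puncture
  have hmem := hστ.shift_mem_simplex σ σ.puncture_mem (by rw [dist_self]; positivity)
  have hτ : τ.vertex = fun i => σ.vertex i + a := by
    rw [← Simplex.vertex_eq_of_puncture_eq_tiles (c := σ.move a hmem) (c' := τ)
      (by rw [Simplex.puncture_move]; simp [a])]
    exact funext fun i => σ.vertex_move a hmem i
  have hs : Smooth fun z => ω (z + a) := hω.comp_add a
  have hd : Smooth fun z => ω (z + a) - ω z := ContDiff.sub hs hω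
  dsimp only
  rw [hτ, simplexIntegral_add_const, abs_sub_comm, ← coneIntegral_eq_simplexIntegral hω,
    ← coneIntegral_eq_simplexIntegral hs, ← coneIntegral_sub hs hω,
    coneIntegral_eq_simplexIntegral hd]
  have hmv : ∀ i, σ.vertex i ∈ cell (shift σ.tile σ.offset) := fun i =>
    subset_convexHull _ _ (σ.vertex_mem i)
  refine abs_simplexIntegral_le (fun i => ?_) hε fun z hz => ?_
  · rw [← dist_eq_norm]
    exact T.dist_le_mesh σ.shift_mem (hmv i) (hmv 0)
  · have h0 := T.dist_le_mesh σ.shift_mem (hmv 0) σ.puncture_mem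
    rw [← dist_eq_norm] at hz
    have hzp := dist_triangle z (σ.vertex 0) σ.puncture
    have hsim : T.Similar R (σ.puncture + (z - σ.puncture)) (τ.puncture + (z - σ.puncture)) :=
      hστ.add (by rw [← dist_eq_norm]; linarith)
    rw [show σ.puncture + (z - σ.puncture) = z by abel,
      show τ.puncture + (z - σ.puncture) = z + a by simp only [a]; abel] at hsim
    exact h.norm_sub_le hsim

lemma exists_orbitBound_of_mem_weakForms {ω : smoothForms d n} (h : ω ∈ T.weakForms n) {ε : ℝ}
    (hε : 0 < ε) : ∃ R, T.OrbitBound ε R fun σ => simplexIntegral ω.1 σ.vertex := by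
  have hm := T.mesh_pos
  rw [mem_weakForms_iff] at h
  obtain ⟨R, -, hR⟩ := exists_pebound_of_operator (C := T.mesh ^ n) (ρ := 2 * T.mesh)
    (by positivity) (P := fun ε R => T.PEBound 0 ε R ω.1)
    (Q := fun ε R => T.OrbitBound ε R fun σ => simplexIntegral ω.1 σ.vertex)
    (fun ε R hε hR hP => orbitBound_simplexIntegral ω.2 hε hR hP) (by positivity)
    (fun ε ε' R hεε' hQ => OrbitBound.mono hQ hεε' le_rfl) (h 0) hε
  exact ⟨R, hR⟩

lemma exists_orbitBound_of_mem_strongForms {ω : smoothForms d n} (h : ω ∈ T.strongForms n) :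
    ∃ R, T.OrbitBound 0 R fun σ => simplexIntegral ω.1 σ.vertex := by
  rw [mem_strongForms_iff] at h
  obtain ⟨R, hR, h⟩ := h
  exact ⟨_, by simpa using orbitBound_simplexIntegral ω.2 le_rfl hR (h 0)⟩

end SimplicialTiling

/-! ### The comparison map -/

namespace SimplicialTiling

variable {d : ℕ} {T : SimplicialTiling d} {n : ℕ}

lemma integrableOn_simplexIntegrand {ω : Form (Space d) n} (hω : Smooth ω)
    (v : Fin (n + 1) → Space d) : IntegrableOn (fun s : Fin n → ℝ =>
      ω (v 0 + ∑ i, s i • (v i.succ - v 0)) fun i => v i.succ - v 0) (cornerSimplex n) := by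
  refine ContinuousOn.integrableOn_compact (isCompact_cornerSimplex n) (Continuous.continuousOn ?_)
  have h : Continuous fun s : Fin n → ℝ => v 0 + ∑ i, s i • (v i.succ - v 0) := by fun_prop
  exact (evalForm fun i => v i.succ - v 0).continuous.comp (hω.continuous.comp h)

lemma simplexIntegral_add {ω η : Form (Space d) n} (hω : Smooth ω) (hη : Smooth η)
    (v : Fin (n + 1) → Space d) :
    simplexIntegral (ω + η) v = simplexIntegral ω v + simplexIntegral η v :=
  integral_add (integrableOn_simplexIntegrand hω v) (integrableOn_simplexIntegrand hη v)

lemma simplexIntegral_smul (a : ℝ) (ω : Form (Space d) n) (v : Fin (n + 1) → Space d) :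
    simplexIntegral (a • ω) v = a * simplexIntegral ω v :=
  integral_const_mul a _

/-- The clause on strong forms is recorded together with existence so that the function chosen in
`psi` carries both properties. -/
lemma exists_integralCochain (ω : T.weakForms n) : ∃ f : T.weakCochains n,
    (∀ σ : T.Simplex T.tiles n, f.1 (T.orbitPoint σ) = simplexIntegral ω.1.1 σ.vertex) ∧
      (ω.1 ∈ T.strongForms n → f.1 ∈ T.strongCochains n) := by
  have hc : ∀ ε, 0 < ε → ∃ R, T.OrbitBound ε R fun σ => simplexIntegral ω.1.1 σ.vertex :=
    fun ε hε => exists_orbitBound_of_mem_weakForms ω.2 hε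
  obtain ⟨f, hf⟩ := exists_extension hc
  exact ⟨⟨f, continuous_extension hf hc⟩, extension_orbitPoint hf hc, fun h =>
    isLocallyConstant_extension hf (exists_orbitBound_of_mem_strongForms h)⟩

lemma weakCochains_ext {f g : T.weakCochains n}
    (h : ∀ σ : T.Simplex T.tiles n, f.1 (T.orbitPoint σ) = g.1 (T.orbitPoint σ)) : f = g :=
  Subtype.ext (eq_of_eq_orbitPoint f.2 g.2 h)

variable (T) in
/-- The continuous function on the transversal which is given on the orbit by integration over the
simplices of the tiling. -/
def psi (n : ℕ) : T.weakForms n →ₗ[ℝ] T.weakCochains n where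
  toFun ω := (exists_integralCochain ω).choose
  map_add' ω η := by
    refine weakCochains_ext fun σ => ?_
    change _ = (exists_integralCochain ω).choose.1 _ + (exists_integralCochain η).choose.1 _
    rw [(exists_integralCochain (ω + η)).choose_spec.1, (exists_integralCochain ω).choose_spec.1,
      (exists_integralCochain η).choose_spec.1]
    exact simplexIntegral_add ω.1.2 η.1.2 _
  map_smul' a ω := by
    refine weakCochains_ext fun σ => ?_
    change _ = a * (exists_integralCochain ω).choose.1 _
    rw [(exists_integralCochain (a • ω)).choose_spec.1, (exists_integralCochain ω).choose_spec.1]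
    exact simplexIntegral_smul a ω.1.1 _

lemma psi_orbitPoint (ω : T.weakForms n) (σ : T.Simplex T.tiles n) :
    (T.psi n ω).1 (T.orbitPoint σ) = simplexIntegral ω.1.1 σ.vertex :=
  (exists_integralCochain ω).choose_spec.1 σ

lemma psi_mem_strongCochains {ω : T.weakForms n} (h : ω.1 ∈ T.strongForms n) :
    (T.psi n ω).1 ∈ T.strongCochains n :=
  (exists_integralCochain ω).choose_spec.2 h

lemma eq_psi_iff (ω : T.weakForms n) (f : T.weakCochains n) :
    f = T.psi n ω ↔ ∀ σ : T.Simplex T.tiles n,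
      f.1 (T.orbitPoint σ) = simplexIntegral ω.1.1 σ.vertex := by
  constructor
  · rintro rfl σ
    exact psi_orbitPoint ω σ
  · exact fun h => weakCochains_ext fun σ => (h σ).trans (psi_orbitPoint ω σ).symm

lemma coneIntegral_vertex (ω : T.weakForms n) (σ : T.Simplex T.tiles n) :
    coneIntegral n ω.1.1 σ.vertex = (T.psi n ω).1 (T.orbitPoint σ) := by
  rw [psi_orbitPoint]
  exact coneIntegral_eq_simplexIntegral ω.1.2 _

/-- On the orbit this is Stokes' formula; both sides are continuous and the orbit is dense. -/
lemma psi_extD (ω : T.weakForms n) (h : extD d n ω.1 ∈ T.weakForms (n + 1)) :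
    (T.psi (n + 1) ⟨extD d n ω.1, h⟩).1 = T.dPV n (T.psi n ω).1 := by
  refine eq_of_eq_orbitPoint (T.psi (n + 1) ⟨extD d n ω.1, h⟩).2
    (continuous_dPV (T.psi n ω).2) fun σ => ?_
  rw [← coneIntegral_vertex, dPV_orbitPoint]
  change coneIntegral (n + 1) (extDeriv ω.1.1) σ.vertex = _
  rw [coneIntegral_extDeriv ω.1.2]
  refine Finset.sum_congr rfl fun i _ => ?_
  rw [← coneIntegral_vertex]
  rfl

/-! ### The isomorphisms in cohomology -/

lemma coboundary_cochainOf_vertex (f : T.Xi n → ℝ) (σ : T.Simplex T.tiles (n + 1)) :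
    coboundary n (cochainOf f) σ.vertex = T.dPV n f (T.orbitPoint σ) := by
  rw [dPV_orbitPoint]
  refine Finset.sum_congr rfl fun i _ => ?_
  rw [← Simplex.vertex_face, cochainOf_vertex]

lemma whitneyForm_zero (x : Space d) : T.whitneyForm n (fun _ => 0) x = 0 := by
  have := whitney_sub (S := T.vertsIn x T.mesh) (φ := T.part) (n := n) (fun _ => (0 : ℝ))
    (fun _ => 0) x
  simpa [whitneyForm] using this

lemma homotopy_zero (x : Space d) : T.homotopy n (fun _ => 0) x = 0 := by
  have := homotopyOp_sub (T.vertsIn x T.mesh) T.part (n := n) (ω := fun _ => 0) (θ := fun _ => 0)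
    contDiff_const contDiff_const x
  simpa [homotopy] using this

lemma extDeriv_eq_zero_of_extD {ω : smoothForms d n} (h : extD d n ω = 0) :
    extDeriv ω.1 = fun _ => 0 := congrArg Subtype.val h

/-- A closed form of positive degree whose integrals are the coboundary of a function on the
transversal is exact. -/
lemma extD_homotopy_add_whitney {ω : T.weakForms (n + 1)} (hd : extD d (n + 1) ω.1 = 0)
    {g : T.Xi n → ℝ} (hg : (T.psi (n + 1) ω).1 = T.dPV n g) :
    extD d n (⟨T.homotopy n ω.1.1, T.smooth_homotopy ω.1.2⟩ +
      T.whitneySmooth n (cochainOf g)) = ω.1 := by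
  rw [_root_.map_add]
  refine Subtype.ext (funext fun x => ?_)
  change extDeriv (T.homotopy n ω.1.1) x + extDeriv (T.whitneyForm n (cochainOf g)) x = ω.1.1 x
  have h1 := T.extDeriv_homotopy_add ω.1.2 x
  rw [extDeriv_eq_zero_of_extD hd, homotopy_zero, add_zero] at h1
  -- The integrals of `ω` and the coboundary of the cochain of `g` are alternating and agree on
  -- ordered simplices, hence on all tuples of vertices of a tile, which is all that the Whitney
  -- form sees.
  have h2 : T.whitneyForm (n + 1) (coneIntegral (n + 1) ω.1.1) =
      T.whitneyForm (n + 1) (coboundary n (cochainOf g)) := by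
    refine T.whitneyForm_congr fun t ht w hw => ?_
    refine eq_of_eq_vertex (isAlternating_coneIntegral ω.1.2)
      (isAlternating_cochainOf g).coboundary (fun σ => ?_) ht hw
    rw [coneIntegral_vertex, coboundary_cochainOf_vertex, hg]
  rw [h1, h2, T.whitneyForm_coboundary, sub_add_cancel]

/-- A closed form of degree zero whose integrals vanish is zero. -/
lemma eq_zero_of_psi_eq_zero {ω : T.weakForms 0} (hd : extD d 0 ω.1 = 0)
    (hg : (T.psi 0 ω).1 = 0) : ω.1 = 0 := by
  refine Subtype.ext (funext fun x => ?_)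
  have h1 := T.homotopy_extDeriv_zero ω.1.2 x
  rw [extDeriv_eq_zero_of_extD hd, homotopy_zero] at h1
  have h2 : T.whitneyForm 0 (coneIntegral 0 ω.1.1) = T.whitneyForm 0 fun _ => 0 := by
    refine T.whitneyForm_congr fun t ht w hw => ?_
    refine eq_of_eq_vertex (c' := fun _ => 0) (isAlternating_coneIntegral ω.1.2)
      (fun _ _ _ _ => neg_zero.symm) (fun σ => ?_) ht hw
    rw [coneIntegral_vertex, hg]
    rfl
  rw [h2, whitneyForm_zero, sub_zero] at h1
  exact h1.symm

lemma extD_whitneySmooth {f : T.Xi n → ℝ} (hf : T.dPV n f = 0) :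
    extD d n (T.whitneySmooth n (cochainOf f)) = 0 := by
  refine Subtype.ext (funext fun x => ?_)
  refine T.extDeriv_whitneyForm_eq_zero (fun t ht w hw => ?_) x
  refine eq_of_eq_vertex (c' := fun _ => 0) (isAlternating_cochainOf f).coboundary
    (fun _ _ _ _ => neg_zero.symm) (fun σ => ?_) ht hw
  rw [coboundary_cochainOf_vertex, hf]
  rfl

/-- Surjectivity already holds for cochains: integrating the Whitney form returns the cochain on
each simplex, and density extends the equality. -/
lemma psi_whitneySmooth {f : T.Xi n → ℝ} (hf : f ∈ T.weakCochains n)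
    (h : T.whitneySmooth n (cochainOf f) ∈ T.weakForms n) :
    (T.psi n ⟨T.whitneySmooth n (cochainOf f), h⟩).1 = f := by
  refine eq_of_eq_orbitPoint (T.psi n _).2 hf fun σ => ?_
  rw [← coneIntegral_vertex, ← cochainOf_vertex f σ]
  exact T.coneIntegral_whitneyForm (isAlternating_cochainOf f) σ.shift_mem σ.vertex_mem

section iso

variable {CF : ∀ n, Submodule ℝ (smoothForms d n)} {CP : ∀ n, Submodule ℝ (T.Xi n → ℝ)}
  (hF : ∀ n, CF n ≤ T.weakForms n) (hP : ∀ n, CP n ≤ T.weakCochains n)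
  (hψ : ∀ n (ω : T.weakForms n), ω.1 ∈ CF n → (T.psi n ω).1 ∈ CP n)

include hψ in
lemma psi_mem_pvCocycles {ω : T.weakForms n} (h : ω.1 ∈ deRhamCocycles CF n) :
    (T.psi n ω).1 ∈ pvCocycles T CP n := by
  refine ⟨hψ n ω h.1, ?_⟩
  change T.dPV n (T.psi n ω).1 = 0
  rw [← psi_extD ω (T.extD_mem_weakForms ω.2)]
  have h0 : (⟨extD d n ω.1, T.extD_mem_weakForms ω.2⟩ : T.weakForms (n + 1)) = 0 :=
    Subtype.ext h.2
  rw [h0, _root_.map_zero]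
  rfl

/-- The comparison map on cocycles. -/
def psiCocycles (n : ℕ) : deRhamCocycles CF n →ₗ[ℝ] pvCocycles T CP n :=
  LinearMap.codRestrict (pvCocycles T CP n)
    ((T.weakCochains n).subtype ∘ₗ T.psi n ∘ₗ
      Submodule.inclusion (inf_le_left.trans (hF n) : deRhamCocycles CF n ≤ T.weakForms n))
    fun z => psi_mem_pvCocycles hψ (ω := ⟨z.1, hF n z.2.1⟩) z.2

lemma psiCocycles_apply (z : deRhamCocycles CF n) :
    (psiCocycles hF hψ n z).1 = (T.psi n ⟨z.1, hF n z.2.1⟩).1 := rfl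

lemma coboundaries_le_comap (n : ℕ) :
    (deRhamCoboundaries CF n).submoduleOf (deRhamCocycles CF n) ≤
      ((pvCoboundaries T CP n).submoduleOf (pvCocycles T CP n)).comap (psiCocycles hF hψ n) := by
  intro z hz
  change (psiCocycles hF hψ n z).1 ∈ pvCoboundaries T CP n
  rw [psiCocycles_apply]
  have hz' : z.1 ∈ deRhamCoboundaries CF n := hz
  cases n with
  | zero =>
    have h0 : (⟨z.1, hF 0 z.2.1⟩ : T.weakForms 0) = 0 := Subtype.ext hz'
    rw [h0, _root_.map_zero]
    exact Submodule.zero_mem _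
  | succ n =>
    obtain ⟨η, hη, he⟩ := hz'
    have hw : extD d n η ∈ T.weakForms (n + 1) := T.extD_mem_weakForms (hF n hη)
    have h0 : (⟨z.1, hF (n + 1) z.2.1⟩ : T.weakForms (n + 1)) = ⟨extD d n η, hw⟩ :=
      Subtype.ext he.symm
    rw [h0]
    exact ⟨(T.psi n ⟨η, hF n hη⟩).1, hψ n ⟨η, hF n hη⟩ hη, (psi_extD ⟨η, hF n hη⟩ hw).symm⟩

include hF hP hψ in
/-- The comparison map induces isomorphisms in cohomology for every pair of complexes which is
preserved by the comparison map, the homotopy and the Whitney map. -/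
lemma exists_cohomology_equiv
    (hH : ∀ n (ω : smoothForms d (n + 1)), ω ∈ CF (n + 1) →
      (⟨T.homotopy n ω.1, T.smooth_homotopy ω.2⟩ : smoothForms d n) ∈ CF n)
    (hW : ∀ n (f : T.Xi n → ℝ), f ∈ CP n → T.whitneySmooth n (cochainOf f) ∈ CF n) (n : ℕ) :
    ∃ H : DeRhamCohomology CF n ≃ₗ[ℝ] PVCohomology T CP n,
      ∀ (ω : T.weakForms n) (hω : ω.1 ∈ deRhamCocycles CF n),
        ∃ h : (T.psi n ω).1 ∈ pvCocycles T CP n,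
          H (deRhamClass CF n ω.1 hω) = pvClass T CP n (T.psi n ω).1 h := by
  set Φ := Submodule.mapQ _ _ (psiCocycles hF hψ n) (coboundaries_le_comap hF hψ n)
  -- If the integrals of a closed form are the coboundary of `g`, the homotopy formula writes it as
  -- `d` of its homotopy plus the Whitney form of `g`; both primitives lie in the given complex.
  have hinj : Function.Injective Φ := by
    rw [← LinearMap.ker_eq_bot, LinearMap.ker_eq_bot']
    intro q hq
    obtain ⟨z, rfl⟩ := Submodule.Quotient.mk_surjective _ q
    rw [Submodule.mapQ_apply, Submodule.Quotient.mk_eq_zero] at hq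
    rw [Submodule.Quotient.mk_eq_zero]
    change z.1 ∈ deRhamCoboundaries CF n
    have hq' : (T.psi n ⟨z.1, hF n z.2.1⟩).1 ∈ pvCoboundaries T CP n := hq
    cases n with
    | zero => exact eq_zero_of_psi_eq_zero (ω := ⟨z.1, hF 0 z.2.1⟩) z.2.2 hq'
    | succ n =>
      obtain ⟨g, hg, he⟩ := hq'
      exact ⟨_, Submodule.add_mem _ (hH n z.1 z.2.1) (hW n g hg),
        extD_homotopy_add_whitney (ω := ⟨z.1, hF (n + 1) z.2.1⟩) z.2.2 he.symm⟩
  -- The Whitney form of a cocycle is a closed form in the complex which integrates to the cocycle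
  -- itself.
  have hsurj : Function.Surjective Φ := by
    intro q
    obtain ⟨f, rfl⟩ := Submodule.Quotient.mk_surjective _ q
    have hmem := hW n f.1 f.2.1
    refine ⟨Submodule.Quotient.mk ⟨_, hmem, extD_whitneySmooth f.2.2⟩, ?_⟩
    rw [Submodule.mapQ_apply]
    congr 1
    exact Subtype.ext (psi_whitneySmooth (hP n f.2.1) (hF n hmem))
  refine ⟨LinearEquiv.ofBijective Φ ⟨hinj, hsurj⟩, fun ω hω =>
    ⟨psi_mem_pvCocycles hψ hω, ?_⟩⟩
  exact Submodule.mapQ_apply _ _ _ (h := coboundaries_le_comap hF hψ n) ⟨ω.1, hω⟩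

end iso

lemma strongCochains_le_weakCochains : T.strongCochains n ≤ T.weakCochains n :=
  fun _ hf => IsLocallyConstant.continuous hf

end SimplicialTiling

end PVTiling

end

theorem mainTheorem3 (d : ℕ) (T : SimplicialTiling d) :
    ∃ ψ : ∀ n, T.weakForms n →ₗ[ℝ] T.weakCochains n,
      -- `ψ ω` is the unique continuous function with `ψ ω (T - p) = ∫_{σ_p} ω`
      (∀ n (ω : T.weakForms n) (f : T.weakCochains n),
        f = ψ n ω ↔ ∀ σ : T.Simplex T.tiles n,
          f.1 (T.orbitPoint σ) = simplexIntegral ω.1.1 σ.vertex) ∧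
      -- `ψ` is a chain map
      (∀ n (ω : T.weakForms n), ∃ h : extD d n ω.1 ∈ T.weakForms (n + 1),
        (ψ (n + 1) ⟨extD d n ω.1, h⟩).1 = T.dPV n (ψ n ω).1) ∧
      -- `ψ` maps strongly pattern equivariant forms to locally constant functions
      (∀ n (ω : T.weakForms n), ω.1 ∈ T.strongForms n → (ψ n ω).1 ∈ T.strongCochains n) ∧
      -- isomorphism between the weak cohomologies
      (∀ n, ∃ H : DeRhamCohomology T.weakForms n ≃ₗ[ℝ] PVCohomology T T.weakCochains n,
        ∀ (ω : T.weakForms n) (hω : ω.1 ∈ deRhamCocycles T.weakForms n),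
          ∃ h : (ψ n ω).1 ∈ pvCocycles T T.weakCochains n,
            H (deRhamClass T.weakForms n ω.1 hω) =
              pvClass T T.weakCochains n (ψ n ω).1 h) ∧
      -- isomorphism between the strong cohomologies
      (∀ n, ∃ H : DeRhamCohomology T.strongForms n ≃ₗ[ℝ] PVCohomology T T.strongCochains n,
        ∀ (ω : T.weakForms n) (hω : ω.1 ∈ deRhamCocycles T.strongForms n),
          ∃ h : (ψ n ω).1 ∈ pvCocycles T T.strongCochains n,
            H (deRhamClass T.strongForms n ω.1 hω) =
              pvClass T T.strongCochains n (ψ n ω).1 h) := by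
  refine ⟨T.psi, fun n ω f => SimplicialTiling.eq_psi_iff ω f, fun n ω =>
    ⟨T.extD_mem_weakForms ω.2, SimplicialTiling.psi_extD ω _⟩,
    fun n ω h => SimplicialTiling.psi_mem_strongCochains h, ?_, ?_⟩
  · exact SimplicialTiling.exists_cohomology_equiv (fun n => le_rfl) (fun n => le_rfl)
      (fun n ω _ => (T.psi n ω).2) (fun n ω h => T.homotopy_mem_weakForms h)
      fun n f hf => T.whitneySmooth_mem_weakForms fun ε hε =>
        SimplicialTiling.exists_cochainBound_cochainOf hf hε
  · exact SimplicialTiling.exists_cohomology_equiv (fun n => T.strongForms_le_weakForms)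
      (fun n => SimplicialTiling.strongCochains_le_weakCochains)
      (fun n ω h => SimplicialTiling.psi_mem_strongCochains h)
      (fun n ω h => T.homotopy_mem_strongForms h)
      fun n f hf => T.whitneySmooth_mem_strongForms
        (SimplicialTiling.exists_cochainBound_cochainOf_zero hf)
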